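/- **Theorem 1.3.** Let $n\ge 2$, $m\ge 0$, let $\Omega\subset\mathbb{R}^n$ be a bounded open set with boundary $\Sigma=\partial\Omega$, and let $f=(f^1,\dots,f^m):\mathbb{R}^n\setminus\Omega\to\mathbb{R}^m$ be continuous and constant along each connected component of $\Sigma$. Write $f_i^\alpha=\partial_i f^\alpha$, $f_{ij}^\alpha=\partial_i\partial_j f^\alpha$. Let $M$ be the graph of $f$ over $\mathbb{R}^n\setminus\overline\Omega$ and $\overline M$ the graph over $\mathbb{R}^n\setminus\Omega$. In the coordinates $x$, with tangent frame $\partial_i=(e_i,f_i^\alpha e_\alpha)$ and normal frame $\eta^\alpha=(-Df^\alpha,e_\alpha)$ (repeated indices are summed), $M$ has the metric $g_{ij}=\delta_{ij}+f_i^\alpha f_j^\alpha$; let $(g^{ij})=(g_{ij})^{-1}$, $G=\det(g_{ij})$, $dM=\sqrt G\,dx$, $U_{\alpha\beta}=\langle\eta^\alpha,\eta^\beta\rangle=\delta_{\alpha\beta}+\langle Df^\alpha,Df^\beta\rangle$, $(U^{\alpha\beta})=U^{-1}$. Let $B(\partial_i,\partial_j)=f_{ij}^\alpha U^{\alpha\beta}\eta^\beta$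 be the second fundamental form, $A^\alpha\partial_i=f^\alpha_{ik}g^{kj}\partial_j$ the shape operator of $\eta^\alpha$ and $\nabla f^\alpha=g^{jk}f_k^\alpha\partial_j$. The scalar curvature $S$ and the function $S^\perp$ are given through the Gauss and Ricci equations: $$S=g^{ij}g^{kl}\big(\langle B(\partial_i,\partial_j),B(\partial_l,\partial_k)\rangle-\langle B(\partial_i,\partial_k),B(\partial_l,\partial_j)\rangle\big),$$ $$S^\perp=\langle R^\perp(\nabla f^\alpha,\nabla f^\beta)\eta^\beta,\eta^\alpha\rangle=\sum_{\alpha,\beta}\big(g(A^\alpha\nabla f^\alpha,A^\beta\nabla f^\beta)-g(A^\beta\nabla f^\alpha,A^\alpha\nabla f^\beta)\big),$$ where $R^\perp(X,Y)=[\nabla^\perp_X,\nabla^\perp_Y]-\nabla^\perp_{[X,Y]}$ is the normal curvature tensor. Assume: 1. $f$ is asymptotically flat in $\mathbb{R}^n\setminus\overline\Omega$: it is $C^2$ there, $S$ is integrable over $\mathbb{R}^n\setminus\overline\Omega$ with respect to $dx$, and for some $p>\frac{n-2}{2}$ one has $f_i^\alpha=O(|x|^{-p/2})$ and $f_{ij}^\alpha=O(|x|^{-p/2-1})$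 at infinity, for all $i,j,\alpha$. 2. The graph extends $C^2$ up to its boundary: $\overline M$ is an embedded $C^2$ submanifold with boundary of $\mathbb{R}^n\times\mathbb{R}^m$, with boundary the graph of $f|_\Sigma$. (Hence $\Sigma$ is a compact $C^2$ hypersurface.) 3. $S^\perp(x)\to 0$ as $x\to\partial\Omega$. 4. For each connected component $\Sigma_i$ of $\Sigma$ there is a straight line $\ell_i\subset\mathbb{R}^m$ through the value of $f$ on $\Sigma_i$ such that $\overline M$ is tangent to the cylinder $\Sigma_i\times\ell_i$ at every point of the graph of $f|_{\Sigma_i}$, i.e. the tangent spaces coincide. Then $(S+S^\perp)/\sqrt G$ is integrable on $M$, $H^\Sigma$ is integrable on $\Sigma$, and the ADM mass $$m_{ADM}=\lim_{r\to\infty}\frac{1}{2(n-1)\omega_{n-1}}\int_{\{|x|=r\}}\sum_{i,j}\Big(\frac{\partial g_{ij}}{\partial x_i}-\frac{\partial g_{ii}}{\partial x_j}\Big)\frac{x_j}{|x|}\,d\mu$$ exists and equals $$m_{ADM}=\frac{1}{2(n-1)\omega_{n-1}}\left(\int_M (S+S^\perp)\frac{1}{\sqrt G}\,dM+\int_\Sigma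 H^\Sigma\,d\Sigma\right).$$ Here $\omega_{n-1}$ is the volume of the unit sphere of $\mathbb{R}^n$, $d\mu$ and $d\Sigma$ are the Euclidean area elements, and $H^\Sigma=\operatorname{div}_\Sigma\nu$ is the (unnormalized) mean curvature of $\Sigma\subset\mathbb{R}^n$, with $\nu$ the unit normal of $\Sigma$ pointing out of $\Omega$; with this sign the boundary of a ball of radius $r$ has $H^\Sigma=(n-1)/r$. -/

import Mathlib

open Set Filter MeasureTheory
open scoped Topology

noncomputable section

namespace GraphMass

/-- Euclidean space `ℝ^k` with its Euclidean norm. -/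
abbrev E (k : ℕ) : Type := EuclideanSpace ℝ (Fin k)

variable {n m : ℕ}

/-- The partial derivative `∂h/∂x_i` of a real function on `ℝ^n`. -/
def pd (i : Fin n) (h : E n → ℝ) (x : E n) : ℝ :=
  fderiv ℝ h x (EuclideanSpace.single i 1)

/-- `f_i^α = ∂f^α/∂x_i`. -/
def d1 (f : E n → E m) (α : Fin m) (i : Fin n) : E n → ℝ :=
  pd i (fun y => f y α)

/-- `f_{ij}^α = ∂²f^α/∂x_i∂x_j`. -/
def d2 (f : E n → E m) (α : Fin m) (i j : Fin n) : E n → ℝ :=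
  pd j (d1 f α i)

/-! ### Geometry of the graph `M = {(x, f x)} ⊆ ℝ^n × ℝ^m`

Tangent vectors at `(x, f x)` are written in the coordinate frame `∂_i = (e_i, f_i^α e_α)`, and
normal vectors in the frame `η^α = (-Df^α, e_α)`, i.e. through their coefficient vectors. -/

/-- The natural metric `g_{ij} = ⟨∂_i, ∂_j⟩ = δ_{ij} + ∑_α f_i^α f_j^α`. -/
def metric (f : E n → E m) (x : E n) : Matrix (Fin n) (Fin n) ℝ :=
  Matrix.of fun i j => (if i = j then 1 else 0) + ∑ α, d1 f α i x * d1 f α j x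

/-- `U_{αβ} = ⟨η^α, η^β⟩ = δ_{αβ} + ⟨Df^α, Df^β⟩`, the Gram matrix of the normal frame. -/
def normalGram (f : E n → E m) (x : E n) : Matrix (Fin m) (Fin m) ℝ :=
  Matrix.of fun α β => (if α = β then 1 else 0) + ∑ i, d1 f α i x * d1 f β i x

/-- `g(v, w)` for tangent vectors `v = v^i ∂_i`, `w = w^i ∂_i`. -/
def tangentInner (f : E n → E m) (x : E n) (v w : Fin n → ℝ) : ℝ :=
  dotProduct v ((metric f x).mulVec w)

/-- `⟨ξ, ζ⟩` for normal vectors `ξ = ξ^α η^α`, `ζ = ζ^α η^α`. -/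
def normalInner (f : E n → E m) (x : E n) (ξ ζ : Fin m → ℝ) : ℝ :=
  dotProduct ξ ((normalGram f x).mulVec ζ)

/-- The second fundamental form: `B(∂_i, ∂_j) = ∑_{α,β} f_{ij}^α U^{αβ} η^β` is the normal part of
the vector `(0, f_{ij}^α e_α)`, whose product with `η^α` is `f_{ij}^α`. -/
def secondFundForm (f : E n → E m) (x : E n) (i j : Fin n) : Fin m → ℝ :=
  fun β => ∑ α, d2 f α i j x * (normalGram f x)⁻¹ α β

/-- The curvature tensor `R_{ilkj} = ⟨R(∂_i, ∂_l) ∂_k, ∂_j⟩` of the graph of a `C²` map. As the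
induced metric is only `C¹`, it is given by the Gauss equation
`⟨B(∂_i, ∂_j), B(∂_l, ∂_k)⟩ - ⟨B(∂_i, ∂_k), B(∂_l, ∂_j)⟩`. -/
def riemann (f : E n → E m) (x : E n) (i l k j : Fin n) : ℝ :=
  normalInner f x (secondFundForm f x i j) (secondFundForm f x l k)
    - normalInner f x (secondFundForm f x i k) (secondFundForm f x l j)

/-- The scalar curvature `S = g^{ij} g^{kl} R_{ilkj}` of the graph. -/
def scalarCurv (f : E n → E m) (x : E n) : ℝ :=
  ∑ i, ∑ j, ∑ k, ∑ l, (metric f x)⁻¹ i j * (metric f x)⁻¹ k l * riemann f x i l k j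

/-- The shape operator `A^α` in the direction `η^α`, acting on coefficient vectors:
`A^α ∂_i = f_{ik}^α g^{kj} ∂_j`. -/
def shapeOp (f : E n → E m) (x : E n) (α : Fin m) (v : Fin n → ℝ) : Fin n → ℝ :=
  (metric f x)⁻¹.mulVec ((Matrix.of fun k i => d2 f α k i x).mulVec v)

/-- The gradient `∇f^α = g^{jk} f_k^α ∂_j` of `f^α` as a function on the graph. -/
def graphGrad (f : E n → E m) (x : E n) (α : Fin m) : Fin n → ℝ :=
  (metric f x)⁻¹.mulVec (fun k => d1 f α k x)

/-- `⟨R^⊥(X, Y) η^β, η^α⟩`, where `R^⊥` is the curvature tensor of the normal connection, with the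
convention `R^⊥(X, Y) = [∇^⊥_X, ∇^⊥_Y] - ∇^⊥_{[X, Y]}`. As the normal frame is only `C¹`, it is
given by the Ricci equation `⟨R^⊥(X, Y) ξ, ζ⟩ = g([A_ξ, A_ζ] X, Y)` in flat ambient space. -/
def normalCurv (f : E n → E m) (x : E n) (X Y : Fin n → ℝ) (β α : Fin m) : ℝ :=
  tangentInner f x (shapeOp f x α X) (shapeOp f x β Y)
    - tangentInner f x (shapeOp f x β X) (shapeOp f x α Y)

/-- `S^⊥ = ∑_{α,β} ⟨R^⊥(∇f^α, ∇f^β) η^β, η^α⟩`. -/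
def Sperp (f : E n → E m) (x : E n) : ℝ :=
  ∑ α, ∑ β, normalCurv f x (graphGrad f x α) (graphGrad f x β) β α

/-- The determinant `G = det (g_{ij})`. -/
def detMetric (f : E n → E m) (x : E n) : ℝ := (metric f x).det

/-- The Riemannian volume measure `dM = √G dx` of the graph of `f` over `D`, read in the global
chart `(x, f x) ↦ x`. -/
def graphVolume (f : E n → E m) (D : Set (E n)) : Measure (E n) :=
  (volume.restrict D).withDensity (fun x => ENNReal.ofReal √(detMetric f x))

/-! ### Asymptotic flatness and the ADM mass -/

/-- `f` is `C²` on `ℝ^n ∖ closure Ω`, the scalar curvature of its graph is integrable there, and for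
some `p > (n - 2)/2` one has `f_i^α = O(|x|^{-p/2})`, `f_{ij}^α = O(|x|^{-p/2-1})` at infinity. -/
structure AsymptoticallyFlatOff (Ω : Set (E n)) (f : E n → E m) : Prop where
  contDiffOn : ContDiffOn ℝ 2 f (closure Ω)ᶜ
  integrableOn_scalarCurv : IntegrableOn (scalarCurv f) (closure Ω)ᶜ volume
  decay : ∃ p : ℝ, ((n : ℝ) - 2) / 2 < p ∧
    (∀ α i, d1 f α i =O[Bornology.cobounded (E n)] fun x => ‖x‖ ^ (-p / 2)) ∧
    (∀ α i j, d2 f α i j =O[Bornology.cobounded (E n)] fun x => ‖x‖ ^ (-p / 2 - 1))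

/-- The integral of `h` over the sphere `S_r = {|x| = r}` with respect to its area element
(`Measure.toSphere` is the area measure of the unit sphere). -/
def sphereIntegral (r : ℝ) (h : E n → ℝ) : ℝ :=
  r ^ (n - 1) * ∫ θ : Metric.sphere (0 : E n) 1, h (r • (θ : E n)) ∂(volume.toSphere)

/-- `ω_{n-1}`, the volume of the unit sphere of `ℝ^n`. -/
def unitSphereArea (n : ℕ) : ℝ := (volume : Measure (E n)).toSphere.real univ

/-- The constant `1 / (2 (n-1) ω_{n-1})`. -/
def massConst (n : ℕ) : ℝ := 1 / (2 * ((n : ℝ) - 1) * unitSphereArea n)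

/-- The metric coefficients `g_{ij}` have ADM mass `μ`: the limit
`lim_{r → ∞} 1/(2(n-1)ω_{n-1}) ∫_{S_r} ∑_{i,j} (∂_i g_{ij} - ∂_j g_{ii}) x_j/|x|`
exists and equals `μ`. -/
def HasADMMass (g : E n → Matrix (Fin n) (Fin n) ℝ) (μ : ℝ) : Prop :=
  Tendsto (fun r : ℝ => massConst n * sphereIntegral r (fun x =>
      ∑ i, ∑ j, (pd i (fun y => g y i j) x - pd j (fun y => g y i i) x) * (x j / ‖x‖)))
    atTop (𝓝 μ)

/-! ### The boundary -/

/-- The graph of `f` over `D`. -/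
def graphOver (f : E n → E m) (D : Set (E n)) : Set (E n × E m) :=
  {w | w.1 ∈ D ∧ w.2 = f w.1}

/-- Near `z`, the set `N` is an `n`-dimensional embedded `C²` submanifold with boundary of
`ℝ^n × ℝ^m`, with boundary `B`, and `z ∈ B`: locally `N = {F = 0, h ≥ 0}` and `B = {F = 0, h = 0}`
for `C²` functions `F`, `h` with values in `ℝ^m`, `ℝ` and jointly independent differentials. -/
def IsC2BoundaryPoint (N B : Set (E n × E m)) (z : E n × E m) : Prop :=
  ∃ (F : E n × E m → E m) (h : E n × E m → ℝ),
    ContDiffAt ℝ 2 F z ∧ ContDiffAt ℝ 2 h z ∧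
    Function.Surjective (fderiv ℝ (fun w => (F w, h w)) z) ∧
    ∀ᶠ w in 𝓝 z, (w ∈ N ↔ F w = 0 ∧ 0 ≤ h w) ∧ (w ∈ B ↔ F w = 0 ∧ h w = 0)

/-- The graph of `f` over `ℝ^n ∖ closure Ω` extends `C²` up to its boundary: together with the graph
over `∂Ω` it is an embedded `C²` submanifold with boundary, whose boundary is the graph over
`∂Ω`. (At the other points this holds because `f` is `C²` there.) -/
def GraphExtendsC2 (Ω : Set (E n)) (f : E n → E m) : Prop :=
  ∀ x ∈ frontier Ω, IsC2BoundaryPoint (graphOver f Ωᶜ) (graphOver f (frontier Ω)) (x, f x)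

/-- The tangent space of a `C¹` submanifold `N`, possibly with boundary, at a point `z` of it: the
linear span of its tangent directions at `z` (which form a half-space at a boundary point). -/
def tangentSpaceAt {V : Type*} [NormedAddCommGroup V] [NormedSpace ℝ V] (N : Set V) (z : V) :
    Submodule ℝ V :=
  Submodule.span ℝ (tangentConeAt ℝ N z)

/-- The cylinder `C × ℓ`, with `ℓ` the straight line through `c` of direction `e`. -/
def cylinder (C : Set (E n)) (c e : E m) : Set (E n × E m) :=
  C ×ˢ Set.range (fun t : ℝ => c + t • e)

/-- Along each connected component of the boundary, the closed graph is tangent to a cylinder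
`Σ_i × ℓ_i`, with `Σ_i` a component of `∂Ω` and `ℓ_i` a straight line of `ℝ^m` depending only on
the component. -/
def TangentToCylinders (Ω : Set (E n)) (f : E n → E m) : Prop :=
  ∀ x₀ ∈ frontier Ω, ∃ e : E m, e ≠ 0 ∧
    ∀ x ∈ connectedComponentIn (frontier Ω) x₀,
      tangentSpaceAt (graphOver f Ωᶜ) (x, f x) =
        tangentSpaceAt (cylinder (connectedComponentIn (frontier Ω) x₀) (f x₀) e) (x, f x)

/-- `v` is the unit normal of `∂Ω` at `x` pointing out of `Ω`: near `x`, the points `y` for which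
`⟨y - x, v⟩` is negative (positive) and not negligible with respect to `|y - x|` lie in `Ω` (lie
outside `closure Ω`). Such a `v` is unique. -/
def IsOuterUnitNormal (Ω : Set (E n)) (x v : E n) : Prop :=
  ‖v‖ = 1 ∧ ∀ ε > 0, ∀ᶠ y in 𝓝 x,
    (inner ℝ (y - x) v < -ε * ‖y - x‖ → y ∈ Ω) ∧
    (ε * ‖y - x‖ < inner ℝ (y - x) v → y ∉ closure Ω)

open Classical in
/-- The outer unit normal field `ν` of `∂Ω` (`0` where there is none). -/
def outerNormal (Ω : Set (E n)) (x : E n) : E n :=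
  if h : ∃ v, IsOuterUnitNormal Ω x v then h.choose else 0

/-- The mean curvature of `Σ = ∂Ω` in `ℝ^n`: the divergence `∑_a ⟨D_{e_a} ν, e_a⟩` along `Σ` of the
unit normal `ν` pointing out of `Ω`, where `(e_a)` is an orthonormal basis of the tangent space
`ν^⊥` of `Σ`. The trace over `ν^⊥` is the full trace minus the `ν`-term; it only involves the
derivative of `ν` in directions tangent to `Σ`. The boundary of a ball of radius `r` has mean
curvature `(n - 1)/r`. -/
def meanCurv (Ω : Set (E n)) (x : E n) : ℝ :=
  let D : E n →L[ℝ] E n := fderivWithin ℝ (outerNormal Ω) (frontier Ω) x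
  LinearMap.trace ℝ (E n) (D : E n →ₗ[ℝ] E n)
    - inner ℝ (D (outerNormal Ω x)) (outerNormal Ω x)

/-- The area measure `dΣ` of the hypersurface `∂Ω`: the `(n-1)`-dimensional Hausdorff measure,
normalized to agree with Lebesgue measure on Euclidean `(n-1)`-spaces. -/
def boundaryArea (Ω : Set (E n)) : Measure (E n) :=
  (Measure.euclideanHausdorffMeasure (n - 1)).restrict (frontier Ω)

end GraphMass

end

open Set Filter MeasureTheory
open scoped Topology

noncomputable section

namespace GraphMass

section

variable {n m : ℕ}

/-! ### The 2-jet of `f` and the mass field -/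

/-! The formula is the divergence theorem for one vector field. Read in the coordinates x, the field
X = ∑ ((tr A^α) ∇f^α - A^α ∇f^α) (`massField`) has Euclidean divergence S + S^⊥ on the exterior of
Ω, has the ADM integrand as its leading radial part at infinity, and has the mean curvature of Σ as
its flux through the boundary.

Divergence. Third derivatives of f cancel by symmetry. The remaining terms come from ∂_k g⁻¹, which
is a sum of outer products of ∇f^β with the k-th column of A^β. Since U^{αβ} = δ_{αβ} - ⟨∇f^β, Df^α⟩
(`uJ_inv`), part of them assembles to the Gauss expression of S, and the rest is the Ricci
expression S^⊥; this is the algebraic identity `sum_XJDeriv`. As f is only C², X is merely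
continuous and the identity is used weakly. Both X and S + S^⊥ are continuous functions of the 2-jet
alone, so mollification gives `integral_mass_identity`.

Infinity. X differs by O(|x|^{-2p-1}) from the field with components ∑ (f_ii^α f_j^α - f_ij^α
f_i^α), whose radial part is exactly the ADM integrand (`adm_integrand_eq`). Since 2p + 1 > n - 1,
the error has vanishing flux. The same exponent count makes S^⊥ = O(|x|^{-2p-2}) integrable at
infinity, and the hypothesis S^⊥ → 0 bounds it near ∂Ω.

Boundary. The first derivatives of f blow up at Σ, but the closed graph is C². It is parametrized by
z ↦ (χ z, y z) over a half-ball, where χ only changes the coordinate z_κ, into φ z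
(`exists_boundaryChart`). The Jacobian determinant of χ is ∂_κ φ, which vanishes exactly on z_κ = 0.
Second derivatives of f bring one factor 1/∂_κ φ into X, so the Piola transform det(Dχ) Dχ⁻¹ X
extends continuously to z_κ = 0 (`smul_XJ_eq_chartField`). Tangency to a cylinder over a straight
line makes ∂_κ(χ, y) vertical along the boundary, which collapses the limit of the κ-component to ±
√(1 + |Dw|²) H^Σ, with w = φ on z_κ = 0 the function whose graph is Σ (`chartField_boundary`,
`exists_sign`).

Testing the weak identity against ζ times a step in the height z_κ/ε and letting ε → 0 gives Green's
formula near each boundary point (`green_local`). Partitions of unity globalize it (`greenHolds`),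
and radial cutoffs turn it into the flux through large spheres (`sphereIntegral_cutFlux`). -/

open Matrix in
/-- The induced metric as a function of the first derivatives. -/
def gJ (p : Matrix (Fin m) (Fin n) ℝ) : Matrix (Fin n) (Fin n) ℝ := 1 + pᵀ * p

open Matrix in
/-- The Gram matrix of the normal frame as a function of the first derivatives. -/
def uJ (p : Matrix (Fin m) (Fin n) ℝ) : Matrix (Fin m) (Fin m) ℝ := 1 + p * pᵀ

/-- The shape operators as functions of the 2-jet. -/
def AJ (p : Matrix (Fin m) (Fin n) ℝ) (h : Fin m → Matrix (Fin n) (Fin n) ℝ) (α : Fin m) :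
    Matrix (Fin n) (Fin n) ℝ := (gJ p)⁻¹ * h α

open Matrix in
/-- The gradients of the components of `f` as functions of the first derivatives. -/
def vJ (p : Matrix (Fin m) (Fin n) ℝ) (α : Fin m) : Fin n → ℝ := (gJ p)⁻¹ *ᵥ p α

open Matrix in
/-- The mass field `(tr A^α) ∇f^α - A^α ∇f^α` as a function of the 2-jet. -/
def XJ (p : Matrix (Fin m) (Fin n) ℝ) (h : Fin m → Matrix (Fin n) (Fin n) ℝ) : Fin n → ℝ :=
  ∑ α, ((AJ p h α).trace • vJ p α - AJ p h α *ᵥ vJ p α)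

/-- The scalar curvature as a function of the 2-jet. -/
def SJ (p : Matrix (Fin m) (Fin n) ℝ) (h : Fin m → Matrix (Fin n) (Fin n) ℝ) : ℝ :=
  ∑ α, ∑ β, (uJ p)⁻¹ α β *
    ((AJ p h α).trace * (AJ p h β).trace - (AJ p h α * AJ p h β).trace)

open Matrix in
/-- The function `S^⊥` as a function of the 2-jet. -/
def PJ (p : Matrix (Fin m) (Fin n) ℝ) (h : Fin m → Matrix (Fin n) (Fin n) ℝ) : ℝ :=
  ∑ α, ∑ β, ((AJ p h α *ᵥ vJ p α) ⬝ᵥ (h β *ᵥ vJ p β) - (AJ p h β *ᵥ vJ p α) ⬝ᵥ (h α *ᵥ vJ p β))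

/-- The matrix of first derivatives of `f`. -/
def jet1 (f : E n → E m) (x : E n) : Matrix (Fin m) (Fin n) ℝ := Matrix.of fun α i => d1 f α i x

/-- The matrices of second derivatives of `f`. -/
def jet2 (f : E n → E m) (x : E n) : Fin m → Matrix (Fin n) (Fin n) ℝ :=
  fun α => Matrix.of fun i j => d2 f α i j x

/-- The mass field of the graph of `f`. -/
def massField (f : E n → E m) (x : E n) : E n := WithLp.toLp 2 (XJ (jet1 f x) (jet2 f x))

theorem metric_eq (f : E n → E m) (x : E n) : metric f x = gJ (jet1 f x) := by
  ext i j
  simp [metric, gJ, jet1, Matrix.mul_apply, Matrix.one_apply]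

theorem normalGram_eq (f : E n → E m) (x : E n) : normalGram f x = uJ (jet1 f x) := by
  ext i j
  simp [normalGram, uJ, jet1, Matrix.mul_apply, Matrix.one_apply]

open Matrix in
theorem posDef_one_add_transpose_mul {k l : ℕ} (p : Matrix (Fin k) (Fin l) ℝ) :
    (1 + pᵀ * p).PosDef := by
  have := Matrix.posSemidef_conjTranspose_mul_self p
  rw [Matrix.conjTranspose_eq_transpose_of_trivial] at this
  exact Matrix.PosDef.one.add_posSemidef this

theorem gJ_posDef (p : Matrix (Fin m) (Fin n) ℝ) : (gJ p).PosDef :=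
  posDef_one_add_transpose_mul p

theorem gJ_det_pos (p : Matrix (Fin m) (Fin n) ℝ) : 0 < (gJ p).det := (gJ_posDef p).det_pos

theorem gJ_isUnit_det (p : Matrix (Fin m) (Fin n) ℝ) : IsUnit (gJ p).det :=
  (gJ_det_pos p).ne'.isUnit

open Matrix in
theorem gJ_transpose (p : Matrix (Fin m) (Fin n) ℝ) : (gJ p)ᵀ = gJ p := by
  simp [gJ, Matrix.transpose_mul]

open Matrix in
theorem gJ_inv_transpose (p : Matrix (Fin m) (Fin n) ℝ) : ((gJ p)⁻¹)ᵀ = (gJ p)⁻¹ := by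
  rw [Matrix.transpose_nonsing_inv, gJ_transpose]

theorem uJ_isUnit_det (p : Matrix (Fin m) (Fin n) ℝ) : IsUnit (uJ p).det := by
  have := posDef_one_add_transpose_mul p.transpose
  rw [Matrix.transpose_transpose] at this
  exact this.det_pos.ne'.isUnit

open Matrix in
-- The Woodbury identity. It trades the inverse Gram matrix of the normal frame for g⁻¹, the only
-- inverse that occurs in the mass field.
theorem uJ_inv (p : Matrix (Fin m) (Fin n) ℝ) : (uJ p)⁻¹ = 1 - p * (gJ p)⁻¹ * pᵀ := by
  apply Matrix.inv_eq_right_inv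
  have h : (gJ p) * (gJ p)⁻¹ = 1 := Matrix.mul_nonsing_inv _ (gJ_isUnit_det p)
  have h2 : pᵀ * p * (gJ p)⁻¹ = 1 - (gJ p)⁻¹ := by
    rw [eq_sub_iff_add_eq]
    calc _ = (1 + pᵀ * p) * (gJ p)⁻¹ := by rw [add_mul, one_mul, add_comm]
      _ = 1 := h
  have h3 : p * pᵀ * (p * (gJ p)⁻¹ * pᵀ) = p * (pᵀ * p * (gJ p)⁻¹) * pᵀ := by
    simp only [Matrix.mul_assoc]
  rw [uJ, mul_sub, Matrix.mul_one, add_mul, h3, h2]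
  simp only [Matrix.mul_sub, Matrix.sub_mul, Matrix.mul_one, Matrix.one_mul]
  abel

open Matrix in
theorem uJ_inv_apply (p : Matrix (Fin m) (Fin n) ℝ) (α β : Fin m) :
    (uJ p)⁻¹ α β = (if α = β then 1 else 0) - vJ p β ⬝ᵥ p α := by
  rw [uJ_inv, Matrix.sub_apply, Matrix.one_apply]
  congr 1
  rw [dotProduct_comm, vJ, dotProduct_mulVec]
  simp [Matrix.mul_apply, dotProduct, vecMul]

/-! ### Curvature quantities in terms of the 2-jet -/

open Matrix in
theorem Sperp_eq (f : E n → E m) (x : E n) : Sperp f x = PJ (jet1 f x) (jet2 f x) := by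
  unfold Sperp PJ
  refine Finset.sum_congr rfl fun α _ => Finset.sum_congr rfl fun β _ => ?_
  have key : ∀ (a b : Fin m) (X Y : Fin n → ℝ),
      tangentInner f x (shapeOp f x a X) (shapeOp f x b Y) =
        (AJ (jet1 f x) (jet2 f x) a *ᵥ X) ⬝ᵥ (jet2 f x b *ᵥ Y) := by
    intro a b X Y
    unfold tangentInner shapeOp AJ
    rw [metric_eq]
    rw [Matrix.mulVec_mulVec (v := (Matrix.of fun k i => d2 f b k i x) *ᵥ Y),
      Matrix.mul_nonsing_inv _ (gJ_isUnit_det _), Matrix.one_mulVec, ← Matrix.mulVec_mulVec]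
    rfl
  have hv : ∀ a, graphGrad f x a = vJ (jet1 f x) a := by
    intro a
    unfold graphGrad vJ
    rw [metric_eq]
    rfl
  rw [normalCurv, key, key, hv, hv]

open Matrix in
-- The product ⟨B, B⟩ contains U⁻¹ U U⁻¹ = U⁻¹, so a single U^{αβ} remains. Symmetry of the Hessians
-- then identifies the two contractions with tr A^α tr A^β and tr(A^α A^β).
theorem scalarCurv_eq (f : E n → E m) (x : E n)
    (hs : ∀ α, (jet2 f x α)ᵀ = jet2 f x α) :
    scalarCurv f x = SJ (jet1 f x) (jet2 f x) := by
  set p := jet1 f x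
  set h := jet2 f x
  have hB : ∀ i j k l, normalInner f x (secondFundForm f x i j) (secondFundForm f x k l) =
      ∑ α, ∑ β, (uJ p)⁻¹ α β * (h α i j * h β k l) := by
    intro i j k l
    have e : ∀ a b, secondFundForm f x a b = (fun α => h α a b) ᵥ* (uJ p)⁻¹ := by
      intro a b
      ext β
      simp only [secondFundForm, normalGram_eq, vecMul, dotProduct]
      rfl
    rw [normalInner, normalGram_eq, e, e, ← Matrix.vecMul_transpose (uJ p),
      Matrix.vecMul_vecMul]
    have ht : (uJ p)ᵀ = uJ p := by simp [uJ]
    change _ ⬝ᵥ _ ᵥ* ((uJ p)⁻¹ * (uJ p)ᵀ) = _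
    rw [ht, Matrix.nonsing_inv_mul _ (uJ_isUnit_det p), Matrix.vecMul_one]
    simp only [vecMul, dotProduct, Finset.sum_mul]
    rw [Finset.sum_comm]
    refine Finset.sum_congr rfl fun _ _ => Finset.sum_congr rfl fun _ _ => by ring
  have hs' : ∀ α i j, h α i j = h α j i := fun α i j => by
    conv_lhs => rw [← hs α]
    rfl
  have gs : ∀ i j, (gJ p)⁻¹ i j = (gJ p)⁻¹ j i := fun i j => by
    conv_lhs => rw [← gJ_inv_transpose p]
    rfl
  have e1 : ∀ α, (AJ p h α).trace = ∑ i, ∑ j, (gJ p)⁻¹ i j * h α i j := by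
    intro α
    simp only [Matrix.trace, Matrix.diag, AJ, Matrix.mul_apply]
    exact Finset.sum_congr rfl fun i _ => Finset.sum_congr rfl fun j _ => by rw [hs' α j i]
  have e2 : ∀ α β, (AJ p h α * AJ p h β).trace =
      ∑ i, ∑ j, ∑ k, ∑ l, (gJ p)⁻¹ i j * (gJ p)⁻¹ k l * (h α i k * h β l j) := by
    intro α β
    simp only [Matrix.trace, Matrix.diag, AJ, Matrix.mul_apply, Finset.sum_mul, Finset.mul_sum]
    have r1 : ∀ k, ∑ x_1, ∑ i, ∑ i_1, (gJ p)⁻¹ k i_1 * h α i_1 x_1 * ((gJ p)⁻¹ x_1 i * h β i k) =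
        ∑ i_1, ∑ x_1, ∑ i, (gJ p)⁻¹ k i_1 * h α i_1 x_1 * ((gJ p)⁻¹ x_1 i * h β i k) := by
      intro k
      rw [Finset.sum_comm]
      conv_rhs => rw [Finset.sum_comm]
      rw [Finset.sum_comm]
      exact Finset.sum_congr rfl fun _ _ => by rw [Finset.sum_comm]
    simp only [r1]
    rw [Finset.sum_comm]
    refine Finset.sum_congr rfl fun i _ => Finset.sum_congr rfl fun j _ =>
      Finset.sum_congr rfl fun k _ => Finset.sum_congr rfl fun l _ => ?_
    rw [gs j i]; ring
  -- The index types fix the direction of this exchange: as a `simp` rule it can only move sums over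
  -- normal indices outwards, so rewriting terminates.
  have sw : ∀ F : Fin n → Fin m → ℝ, ∑ i, ∑ α, F i α = ∑ α, ∑ i, F i α :=
    fun F => Finset.sum_comm
  have e3 : scalarCurv f x = ∑ i, ∑ j, ∑ k, ∑ l, ∑ α, ∑ β, (uJ p)⁻¹ α β *
      (((gJ p)⁻¹ i j * h α i j) * ((gJ p)⁻¹ k l * h β k l) -
        (gJ p)⁻¹ i j * (gJ p)⁻¹ k l * (h α i k * h β l j)) := by
    unfold scalarCurv riemann
    refine Finset.sum_congr rfl fun i _ => Finset.sum_congr rfl fun j _ =>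
      Finset.sum_congr rfl fun k _ => Finset.sum_congr rfl fun l _ => ?_
    rw [hB, hB, metric_eq, ← Finset.sum_sub_distrib, Finset.mul_sum]
    refine Finset.sum_congr rfl fun α _ => ?_
    rw [← Finset.sum_sub_distrib, Finset.mul_sum]
    refine Finset.sum_congr rfl fun β _ => ?_
    rw [hs' β l k]
    ring
  rw [e3]
  simp only [sw]
  unfold SJ
  refine Finset.sum_congr rfl fun α _ => Finset.sum_congr rfl fun β _ => ?_
  rw [e1, e1, e2, mul_sub]
  simp only [mul_sub, Finset.sum_sub_distrib, ← Finset.mul_sum, ← Finset.sum_mul]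

end

section

variable {n m : ℕ}

/-! ### Smoothness of matrix inversion -/

theorem contDiffAt_matrix_det {V : Type*} [NormedAddCommGroup V] [NormedSpace ℝ V]
    {N : WithTop ℕ∞} {M : V → Matrix (Fin n) (Fin n) ℝ} {x : V}
    (h : ∀ i j, ContDiffAt ℝ N (fun y => M y i j) x) :
    ContDiffAt ℝ N (fun y => (M y).det) x := by
  simp only [Matrix.det_apply']
  exact ContDiffAt.sum fun σ _ => contDiffAt_const.mul (contDiffAt_prod fun i _ => h _ _)

theorem contDiffAt_matrix_inv {V : Type*} [NormedAddCommGroup V] [NormedSpace ℝ V]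
    {N : WithTop ℕ∞} {M : V → Matrix (Fin n) (Fin n) ℝ} {x : V}
    (h : ∀ i j, ContDiffAt ℝ N (fun y => M y i j) x) (hu : IsUnit (M x).det) (i j : Fin n) :
    ContDiffAt ℝ N (fun y => (M y)⁻¹ i j) x := by
  simp only [Matrix.inv_def, Ring.inverse_eq_inv', Matrix.smul_apply, Matrix.adjugate_apply,
    smul_eq_mul]
  refine ((contDiffAt_matrix_det h).inv hu.ne_zero).mul (contDiffAt_matrix_det fun a b => ?_)
  by_cases hj : a = j
  · subst hj
    simpa using contDiffAt_const
  · simpa [Matrix.updateRow_ne hj] using h a b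

section MatrixInv

attribute [local instance] Matrix.linftyOpNormedRing Matrix.linftyOpNormedAlgebra

/-- The derivative of inversion in a Banach algebra. The norm chosen on matrices is immaterial,
because hypothesis and conclusion are entrywise. -/
theorem hasDerivAt_matrix_inv {M : ℝ → Matrix (Fin n) (Fin n) ℝ} {M' : Matrix (Fin n) (Fin n) ℝ}
    {t : ℝ} (h : ∀ i j, HasDerivAt (fun s => M s i j) (M' i j) t) (hu : IsUnit (M t).det)
    (i j : Fin n) :
    HasDerivAt (fun s => (M s)⁻¹ i j) ((-((M t)⁻¹ * M' * (M t)⁻¹)) i j) t := by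
  have hM : HasDerivAt (fun s => M s) M' t := hasDerivAt_pi.2 fun i => hasDerivAt_pi.2 fun j => h i j
  obtain ⟨u, hu⟩ := (Matrix.isUnit_iff_isUnit_det _).2 hu
  have h2 := hasFDerivAt_ringInverse (𝕜 := ℝ) u
  rw [hu] at h2
  have h3 := h2.comp_hasDerivAt t hM
  have h4 : (Ring.inverse ∘ fun y => M y) = fun y => (M y)⁻¹ := by
    ext1 y
    exact (Matrix.nonsing_inv_eq_ringInverse _).symm
  rw [h4] at h3
  have h5 : ((↑u⁻¹ : Matrix (Fin n) (Fin n) ℝ)) = (M t)⁻¹ := by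
    rw [← hu, Matrix.coe_units_inv]
  have h6 := hasDerivAt_pi.1 (hasDerivAt_pi.1 h3 i) j
  simpa [h5] using h6

end MatrixInv

theorem continuous_gJ_inv :
    Continuous fun p : Matrix (Fin m) (Fin n) ℝ => (gJ p)⁻¹ := by
  have hg : Continuous fun p : Matrix (Fin m) (Fin n) ℝ => gJ p := by
    unfold gJ; fun_prop
  simp_rw [Matrix.inv_def, Ring.inverse_eq_inv']
  exact (hg.matrix_det.inv₀ fun p => (gJ_det_pos p).ne').smul hg.matrix_adjugate

theorem continuous_uJ_inv :
    Continuous fun p : Matrix (Fin m) (Fin n) ℝ => (uJ p)⁻¹ := by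
  have hg : Continuous fun p : Matrix (Fin m) (Fin n) ℝ => uJ p := by
    unfold uJ; fun_prop
  simp_rw [Matrix.inv_def, Ring.inverse_eq_inv']
  exact (hg.matrix_det.inv₀ fun p => (uJ_isUnit_det p).ne_zero).smul hg.matrix_adjugate

/-- The space of 2-jets (up to the value of the function). -/
abbrev Jet (n m : ℕ) : Type :=
  Matrix (Fin m) (Fin n) ℝ × (Fin m → Matrix (Fin n) (Fin n) ℝ)

theorem continuous_AJ (α : Fin m) :
    Continuous fun q : Jet n m => AJ q.1 q.2 α := by
  unfold AJ
  exact (continuous_gJ_inv.comp continuous_fst).matrix_mul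
    ((continuous_apply α).comp continuous_snd)

theorem continuous_vJ (α : Fin m) :
    Continuous fun q : Jet n m => vJ q.1 α := by
  unfold vJ
  exact (continuous_gJ_inv.comp continuous_fst).matrix_mulVec
    ((continuous_apply α).comp continuous_fst)

theorem continuous_XJ : Continuous fun q : Jet n m => XJ q.1 q.2 := by
  unfold XJ
  refine continuous_finsetSum _ fun α _ => ?_
  exact ((continuous_AJ α).matrix_trace.smul (continuous_vJ α)).sub
    ((continuous_AJ α).matrix_mulVec (continuous_vJ α))

theorem continuous_SJ : Continuous fun q : Jet n m => SJ q.1 q.2 := by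
  unfold SJ
  refine continuous_finsetSum _ fun α _ => continuous_finsetSum _ fun β _ => ?_
  exact ((continuous_uJ_inv.comp continuous_fst).matrix_elem α β).mul
    (((continuous_AJ α).matrix_trace.mul (continuous_AJ β).matrix_trace).sub
      ((continuous_AJ α).matrix_mul (continuous_AJ β)).matrix_trace)

theorem continuous_PJ : Continuous fun q : Jet n m => PJ q.1 q.2 := by
  unfold PJ
  refine continuous_finsetSum _ fun α _ => continuous_finsetSum _ fun β _ => ?_
  have h : ∀ β : Fin m, Continuous fun q : Jet n m => q.2 β :=
    fun β => (continuous_apply β).comp continuous_snd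
  exact (((continuous_AJ α).matrix_mulVec (continuous_vJ α)).dotProduct
      ((h β).matrix_mulVec (continuous_vJ β))).sub
    (((continuous_AJ β).matrix_mulVec (continuous_vJ α)).dotProduct
      ((h α).matrix_mulVec (continuous_vJ β)))

/-! ### The divergence of the mass field -/

open Matrix in
/-- The derivative of `g⁻¹` when the first derivatives vary with velocity `p'`. -/
def gInvDeriv (p p' : Matrix (Fin m) (Fin n) ℝ) : Matrix (Fin n) (Fin n) ℝ :=
  -((gJ p)⁻¹ * (p'ᵀ * p + pᵀ * p') * (gJ p)⁻¹)

theorem hasDerivAt_gJ_inv {p : ℝ → Matrix (Fin m) (Fin n) ℝ} {p' : Matrix (Fin m) (Fin n) ℝ}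
    {t : ℝ} (hp : ∀ α i, HasDerivAt (fun s => p s α i) (p' α i) t) (i j : Fin n) :
    HasDerivAt (fun s => (gJ (p s))⁻¹ i j) (gInvDeriv (p t) p' i j) t := by
  refine hasDerivAt_matrix_inv (fun i j => ?_) (gJ_isUnit_det _) i j
  simp only [gJ, Matrix.add_apply, Matrix.mul_apply, Matrix.transpose_apply,
    ← Finset.sum_add_distrib]
  have h := HasDerivAt.fun_sum (u := Finset.univ) fun α _ => (hp α i).mul (hp α j)
  exact h.const_add _

open Matrix in
/-- The derivative of the mass field when the 2-jet varies with velocity `(p', h')`. -/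
def XJDeriv (p : Matrix (Fin m) (Fin n) ℝ) (h : Fin m → Matrix (Fin n) (Fin n) ℝ)
    (p' : Matrix (Fin m) (Fin n) ℝ) (h' : Fin m → Matrix (Fin n) (Fin n) ℝ) : Fin n → ℝ :=
  ∑ α, ((gInvDeriv p p' * h α + (gJ p)⁻¹ * h' α).trace • vJ p α
    + (AJ p h α).trace • (gInvDeriv p p' *ᵥ p α + (gJ p)⁻¹ *ᵥ p' α)
    - (gInvDeriv p p' * h α + (gJ p)⁻¹ * h' α) *ᵥ vJ p α
    - AJ p h α *ᵥ (gInvDeriv p p' *ᵥ p α + (gJ p)⁻¹ *ᵥ p' α))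

theorem hasDerivAt_matrix_mul {k l r : ℕ} {M : ℝ → Matrix (Fin k) (Fin l) ℝ}
    {N : ℝ → Matrix (Fin l) (Fin r) ℝ} {M' : Matrix (Fin k) (Fin l) ℝ}
    {N' : Matrix (Fin l) (Fin r) ℝ} {t : ℝ}
    (hM : ∀ i j, HasDerivAt (fun s => M s i j) (M' i j) t)
    (hN : ∀ i j, HasDerivAt (fun s => N s i j) (N' i j) t) (i : Fin k) (j : Fin r) :
    HasDerivAt (fun s => (M s * N s) i j) ((M' * N t + M t * N') i j) t := by
  simp only [Matrix.add_apply, Matrix.mul_apply, ← Finset.sum_add_distrib]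
  exact HasDerivAt.fun_sum fun a _ => (hM i a).mul (hN a j)

open Matrix in
theorem hasDerivAt_matrix_mulVec {k l : ℕ} {M : ℝ → Matrix (Fin k) (Fin l) ℝ}
    {v : ℝ → Fin l → ℝ} {M' : Matrix (Fin k) (Fin l) ℝ} {v' : Fin l → ℝ} {t : ℝ}
    (hM : ∀ i j, HasDerivAt (fun s => M s i j) (M' i j) t)
    (hv : ∀ i, HasDerivAt (fun s => v s i) (v' i) t) (i : Fin k) :
    HasDerivAt (fun s => (M s *ᵥ v s) i) ((M' *ᵥ v t + M t *ᵥ v') i) t := by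
  simp only [Pi.add_apply, mulVec, dotProduct, ← Finset.sum_add_distrib]
  exact HasDerivAt.fun_sum fun a _ => (hM i a).mul (hv a)

theorem hasDerivAt_XJ {p : ℝ → Matrix (Fin m) (Fin n) ℝ} {p' : Matrix (Fin m) (Fin n) ℝ}
    {h : ℝ → Fin m → Matrix (Fin n) (Fin n) ℝ} {h' : Fin m → Matrix (Fin n) (Fin n) ℝ} {t : ℝ}
    (hp : ∀ α i, HasDerivAt (fun s => p s α i) (p' α i) t)
    (hh : ∀ α i j, HasDerivAt (fun s => h s α i j) (h' α i j) t) (k : Fin n) :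
    HasDerivAt (fun s => XJ (p s) (h s) k) (XJDeriv (p t) (h t) p' h' k) t := by
  have hA := fun α => hasDerivAt_matrix_mul (hasDerivAt_gJ_inv hp) (hh α)
  have hv := fun α => hasDerivAt_matrix_mulVec (hasDerivAt_gJ_inv hp) (hp α)
  have hAv := fun α => hasDerivAt_matrix_mulVec (hA α) (hv α)
  have htr := fun α => HasDerivAt.fun_sum (u := Finset.univ) fun i (_ : i ∈ Finset.univ) => hA α i i
  have := HasDerivAt.fun_sum (u := Finset.univ) fun α (_ : α ∈ Finset.univ) =>
    ((htr α).mul (hv α k)).sub (hAv α k)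
  refine (this.congr_of_eventuallyEq (Eventually.of_forall fun s => ?_)).congr_deriv ?_
  · simp only [XJ, Finset.sum_apply]
    rfl
  · simp only [XJDeriv, Finset.sum_apply]
    refine Finset.sum_congr rfl fun α _ => ?_
    simp only [Pi.add_apply, Pi.sub_apply, Pi.smul_apply, smul_eq_mul, AJ, vJ, Matrix.trace,
      Matrix.diag]
    ring

open Matrix in
-- When p varies in the direction x_k, its velocity is f_ik^α, and g⁻¹ applied to that row is the
-- k-th column of A^β. Both products in ∂_k g⁻¹ = -g⁻¹ (∂_k g) g⁻¹ are therefore sums of outer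
-- products of this column with ∇f^β.
theorem gInvDeriv_eq (p : Matrix (Fin m) (Fin n) ℝ) (h : Fin m → Matrix (Fin n) (Fin n) ℝ) (k : Fin n) :
    gInvDeriv p (Matrix.of fun α i => h α i k) =
      -∑ β, (vecMulVec ((AJ p h β)ᵀ k) (vJ p β) + vecMulVec (vJ p β) ((AJ p h β)ᵀ k)) := by
  set q : Matrix (Fin m) (Fin n) ℝ := Matrix.of fun α i => h α i k
  have hv : ∀ β i, vJ p β i = ((gJ p)⁻¹ * pᵀ) i β := fun β i => by
    simp [vJ, mulVec, dotProduct, Matrix.mul_apply]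
  have tr : ∀ (r : Matrix (Fin m) (Fin n) ℝ) β i, ((gJ p)⁻¹ * rᵀ) i β = (r * (gJ p)⁻¹) β i := by
    intro r β i
    have : ((gJ p)⁻¹ * rᵀ)ᵀ = r * (gJ p)⁻¹ := by
      rw [Matrix.transpose_mul, Matrix.transpose_transpose, gJ_inv_transpose]
    rw [← this]
    rfl
  have hv' : ∀ β i, vJ p β i = (p * (gJ p)⁻¹) β i := fun β i => by rw [hv, tr]
  have hA : ∀ β i, (AJ p h β)ᵀ k i = ((gJ p)⁻¹ * qᵀ) i β := fun β i => by
    simp [AJ, Matrix.mul_apply, q]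
  have hA' : ∀ β i, (AJ p h β)ᵀ k i = (q * (gJ p)⁻¹) β i := fun β i => by rw [hA, tr]
  have e : (gJ p)⁻¹ * (qᵀ * p + pᵀ * q) * (gJ p)⁻¹ =
      ((gJ p)⁻¹ * qᵀ) * (p * (gJ p)⁻¹) + ((gJ p)⁻¹ * pᵀ) * (q * (gJ p)⁻¹) := by
    simp only [Matrix.mul_add, Matrix.add_mul, Matrix.mul_assoc]
  rw [gInvDeriv, e]
  congr 1
  ext i j
  rw [Matrix.add_apply, Matrix.mul_apply, Matrix.mul_apply, ← Finset.sum_add_distrib,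
    Matrix.sum_apply]
  refine Finset.sum_congr rfl fun β _ => ?_
  rw [Matrix.add_apply, vecMulVec_apply, vecMulVec_apply, hA, ← hv', ← hv, ← hA', hA]

open Matrix in
theorem trace_gInvDeriv_mul (p : Matrix (Fin m) (Fin n) ℝ) (h : Fin m → Matrix (Fin n) (Fin n) ℝ)
    (k : Fin n) (M : Matrix (Fin n) (Fin n) ℝ) (hM : Mᵀ = M) :
    (gInvDeriv p (Matrix.of fun α i => h α i k) * M).trace =
      -∑ β, 2 * ((M *ᵥ vJ p β) ⬝ᵥ (AJ p h β)ᵀ k) := by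
  rw [gInvDeriv_eq, Matrix.neg_mul, Matrix.trace_neg, Matrix.sum_mul, Matrix.trace_sum]
  congr 1
  refine Finset.sum_congr rfl fun β _ => ?_
  rw [Matrix.add_mul, Matrix.trace_add, Matrix.vecMulVec_mul, Matrix.vecMulVec_mul,
    Matrix.trace_vecMulVec, Matrix.trace_vecMulVec, ← Matrix.mulVec_transpose, hM,
    ← Matrix.mulVec_transpose, hM, two_mul]
  congr 1
  · exact dotProduct_comm _ _
  · rw [dotProduct_comm, dotProduct_comm (M *ᵥ vJ p β), dotProduct_mulVec,
      ← Matrix.mulVec_transpose, hM]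

open Matrix in
theorem gInvDeriv_mulVec (p : Matrix (Fin m) (Fin n) ℝ) (h : Fin m → Matrix (Fin n) (Fin n) ℝ)
    (k : Fin n) (w : Fin n → ℝ) :
    gInvDeriv p (Matrix.of fun α i => h α i k) *ᵥ w =
      -∑ β, ((vJ p β ⬝ᵥ w) • (AJ p h β)ᵀ k + ((AJ p h β)ᵀ k ⬝ᵥ w) • vJ p β) := by
  rw [gInvDeriv_eq, Matrix.neg_mulVec, Matrix.sum_mulVec]
  congr 1
  refine Finset.sum_congr rfl fun β _ => ?_
  ext i
  simp [Matrix.add_mulVec, vecMulVec_mulVec]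

open Matrix in
-- The pointwise identity div X = S + S^⊥, with `T` in the role of the third derivatives. After
-- these drop out, `t1` to `t4` evaluate the four terms containing ∂_k g⁻¹. The products of traces
-- and the traces of products combine into S, the quartic terms combine into S^⊥, and the terms
-- linear in a trace cancel.
theorem sum_XJDeriv (p : Matrix (Fin m) (Fin n) ℝ) {h : Fin m → Matrix (Fin n) (Fin n) ℝ}
    (hs : ∀ α, (h α)ᵀ = h α) {T : Fin m → Fin n → Fin n → Fin n → ℝ}
    (hT : ∀ α i j k, T α i j k = T α i k j) :
    ∑ k, XJDeriv p h (Matrix.of fun α i => h α i k) (fun α => Matrix.of fun i j => T α i j k) k =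
      SJ p h + PJ p h := by
  set N := fun k => gInvDeriv p (Matrix.of fun α i => h α i k) with hN
  have sum1 : ∀ (a b : Fin n → ℝ) β, ∑ k, (a ⬝ᵥ (AJ p h β)ᵀ k) * b k = a ⬝ᵥ (AJ p h β *ᵥ b) := by
    intro a b β
    rw [dotProduct_mulVec]
    rfl
  have sum2 : ∀ β, ∑ k, (AJ p h β)ᵀ k k = (AJ p h β).trace := fun β => rfl
  have sum3 : ∀ (M : Matrix (Fin n) (Fin n) ℝ) β, ∑ k, (M *ᵥ (AJ p h β)ᵀ k) k =
      (M * AJ p h β).trace := fun M β => rfl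
  have hcol : ∀ β k (w : Fin n → ℝ),
      (AJ p h β)ᵀ k ⬝ᵥ w = (h β *ᵥ ((gJ p)⁻¹ *ᵥ w)) k := by
    intro β k w
    have : (AJ p h β)ᵀ k ⬝ᵥ w = ((AJ p h β)ᵀ *ᵥ w) k := rfl
    rw [this, AJ, Matrix.transpose_mul, hs, gJ_inv_transpose, Matrix.mulVec_mulVec]
  have hp' : ∀ α k, (gJ p)⁻¹ *ᵥ (Matrix.of fun α i => h α i k) α = (AJ p h α)ᵀ k := fun α k => rfl
  have sy : ∀ (a b : Fin n → ℝ) β, (h β *ᵥ a) ⬝ᵥ b = a ⬝ᵥ (h β *ᵥ b) := fun a b β => by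
    rw [dotProduct_mulVec, ← Matrix.mulVec_transpose, hs]
  have gsy : ∀ i j, (gJ p)⁻¹ i j = (gJ p)⁻¹ j i := fun i j => by
    conv_lhs => rw [← gJ_inv_transpose p]
    rfl
  -- Cancellation of the third derivatives: exchanging the last two indices of `T` carries one
  -- contraction into the other.
  have t0 : ∀ α, ∑ k, (((gJ p)⁻¹ * Matrix.of fun i j => T α i j k).trace * vJ p α k -
      (((gJ p)⁻¹ * Matrix.of fun i j => T α i j k) *ᵥ vJ p α) k) = 0 := by
    intro α
    rw [Finset.sum_sub_distrib, sub_eq_zero]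
    simp only [Matrix.trace, Matrix.diag, mulVec, dotProduct, Matrix.mul_apply, Matrix.of_apply,
      Finset.sum_mul]
    rw [Finset.sum_comm]
    refine Finset.sum_congr rfl fun i _ => Finset.sum_congr rfl fun k _ =>
      Finset.sum_congr rfl fun j _ => ?_
    rw [hT]
  have t1 : ∀ α, ∑ k, (N k * h α).trace * vJ p α k =
      -∑ β, 2 * ((h α *ᵥ vJ p β) ⬝ᵥ (AJ p h β *ᵥ vJ p α)) := by
    intro α
    simp only [hN, trace_gInvDeriv_mul p h _ (h α) (hs α), neg_mul, Finset.sum_neg_distrib,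
      Finset.sum_mul]
    rw [Finset.sum_comm]
    congr 1
    refine Finset.sum_congr rfl fun β _ => ?_
    rw [← sum1, Finset.mul_sum]
    exact Finset.sum_congr rfl fun k _ => by ring
  have t2 : ∀ α, ∑ k, (N k *ᵥ p α) k =
      -∑ β, ((vJ p β ⬝ᵥ p α) * (AJ p h β).trace + (h β *ᵥ vJ p α) ⬝ᵥ vJ p β) := by
    intro α
    simp only [hN, gInvDeriv_mulVec, Pi.neg_apply, Finset.sum_apply, Pi.add_apply, Pi.smul_apply,
      smul_eq_mul, Finset.sum_neg_distrib]
    rw [Finset.sum_comm]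
    congr 1
    refine Finset.sum_congr rfl fun β _ => ?_
    rw [Finset.sum_add_distrib, ← Finset.mul_sum, sum2]
    simp only [hcol]
    rfl
  have t3 : ∀ α, ∑ k, ((N k * h α) *ᵥ vJ p α) k =
      -∑ β, ((vJ p β ⬝ᵥ (h α *ᵥ vJ p α)) * (AJ p h β).trace +
        (h β *ᵥ (AJ p h α *ᵥ vJ p α)) ⬝ᵥ vJ p β) := by
    intro α
    simp only [hN, ← Matrix.mulVec_mulVec, gInvDeriv_mulVec, Pi.neg_apply, Finset.sum_apply,
      Pi.add_apply, Pi.smul_apply, smul_eq_mul, Finset.sum_neg_distrib]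
    rw [Finset.sum_comm]
    congr 1
    refine Finset.sum_congr rfl fun β _ => ?_
    rw [Finset.sum_add_distrib, ← Finset.mul_sum, sum2]
    simp only [hcol]
    rw [Matrix.mulVec_mulVec (v := vJ p α)]
    rfl
  have t4 : ∀ α, ∑ k, (AJ p h α *ᵥ (N k *ᵥ p α)) k =
      -∑ β, ((vJ p β ⬝ᵥ p α) * (AJ p h α * AJ p h β).trace +
        (h β *ᵥ vJ p α) ⬝ᵥ (AJ p h α *ᵥ vJ p β)) := by
    intro α
    simp only [hN, gInvDeriv_mulVec, Matrix.mulVec_neg, Matrix.mulVec_sum, Matrix.mulVec_add,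
      Matrix.mulVec_smul, Pi.neg_apply, Finset.sum_apply,
      Pi.add_apply, Pi.smul_apply, smul_eq_mul, Finset.sum_neg_distrib]
    rw [Finset.sum_comm]
    congr 1
    refine Finset.sum_congr rfl fun β _ => ?_
    rw [Finset.sum_add_distrib, ← Finset.mul_sum, sum3]
    simp only [hcol]
    rfl
  -- Besides the terms with ∂_k g⁻¹, differentiating p in ∇f^α = g⁻¹ p contributes (tr A^α)² and
  -- tr(A^α A^α): these are the diagonal part δ_{αβ} of U^{αβ}.
  have expand : ∑ k, XJDeriv p h (Matrix.of fun α i => h α i k)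
        (fun α => Matrix.of fun i j => T α i j k) k =
      ∑ α, (∑ k, (N k * h α).trace * vJ p α k
        + (AJ p h α).trace * (∑ k, (N k *ᵥ p α) k + (AJ p h α).trace)
        - ∑ k, ((N k * h α) *ᵥ vJ p α) k
        - (∑ k, (AJ p h α *ᵥ (N k *ᵥ p α)) k + (AJ p h α * AJ p h α).trace)) := by
    simp only [XJDeriv, Finset.sum_apply, hp']
    rw [Finset.sum_comm]
    refine Finset.sum_congr rfl fun α _ => ?_
    rw [← sum3, ← sum2]
    rw [← sub_eq_zero, ← t0 α]
    simp only [← Finset.sum_add_distrib, Finset.mul_sum, ← Finset.sum_sub_distrib]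
    refine Finset.sum_congr rfl fun k _ => ?_
    simp only [Pi.sub_apply, Pi.add_apply, Pi.smul_apply, smul_eq_mul, Matrix.trace_add,
      Matrix.add_mulVec, Matrix.mulVec_add]
    ring
  rw [expand]
  simp only [t1, t2, t3, t4]
  -- Splits U^{αβ} into its diagonal part and the part with ⟨∇f^β, Df^α⟩, the form in which the
  -- terms of `t2` and `t4` appear.
  have hU : ∀ α (F : Fin m → ℝ), ∑ β, (uJ p)⁻¹ α β * F β = F α - ∑ β, (vJ p β ⬝ᵥ p α) * F β := by
    intro α F
    simp only [uJ_inv_apply, sub_mul, Finset.sum_sub_distrib]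
    simp
  simp only [SJ, PJ, hU]
  have swap1 : ∑ α, ∑ β, (AJ p h α *ᵥ vJ p β) ⬝ᵥ (h β *ᵥ vJ p α) =
      ∑ α, ∑ β, (AJ p h β *ᵥ vJ p α) ⬝ᵥ (h α *ᵥ vJ p β) := Finset.sum_comm
  have swap2 : ∑ α, ∑ β, (vJ p β ⬝ᵥ (h α *ᵥ vJ p α)) * (AJ p h β).trace =
      ∑ α, ∑ β, (AJ p h α).trace * ((h β *ᵥ vJ p α) ⬝ᵥ vJ p β) := by
    rw [Finset.sum_comm]
    exact Finset.sum_congr rfl fun α _ => Finset.sum_congr rfl fun β _ => by rw [mul_comm, sy]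
  have e5 : ∀ α β, (h β *ᵥ (AJ p h α *ᵥ vJ p α)) ⬝ᵥ vJ p β =
      (AJ p h α *ᵥ vJ p α) ⬝ᵥ (h β *ᵥ vJ p β) := fun α β => sy _ _ _
  have e6 : ∀ α β, (h α *ᵥ vJ p β) ⬝ᵥ (AJ p h β *ᵥ vJ p α) =
      (AJ p h β *ᵥ vJ p α) ⬝ᵥ (h α *ᵥ vJ p β) := fun α β => dotProduct_comm _ _
  simp only [e5, e6, Finset.sum_add_distrib, Finset.sum_sub_distrib, Finset.sum_neg_distrib,
    mul_sub, mul_add, mul_neg, ← Finset.mul_sum]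
  rw [swap2, swap1]
  have e7 : ∑ α, (AJ p h α).trace * ∑ β, vJ p β ⬝ᵥ p α * (AJ p h β).trace =
      ∑ α, ∑ β, vJ p β ⬝ᵥ p α * ((AJ p h α).trace * (AJ p h β).trace) := by
    simp only [Finset.mul_sum]
    exact Finset.sum_congr rfl fun α _ => Finset.sum_congr rfl fun β _ => by ring
  rw [e7]
  simp only [Finset.mul_sum]
  simp only [← Finset.mul_sum]
  ring

end

section

variable {n m : ℕ}

/-! ### Partial derivatives -/

theorem contDiffOn_pd {N M : WithTop ℕ∞} (hN : N + 1 ≤ M) {s : Set (E n)} (hs : IsOpen s)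
    {g : E n → ℝ} (hg : ContDiffOn ℝ M g s) (i : Fin n) : ContDiffOn ℝ N (pd i g) s :=
  (hg.fderiv_of_isOpen hs hN).clm_apply contDiffOn_const

theorem contDiff_pd {N M : WithTop ℕ∞} (hN : N + 1 ≤ M)
    {g : E n → ℝ} (hg : ContDiff ℝ M g) (i : Fin n) : ContDiff ℝ N (pd i g) :=
  contDiffOn_univ.1 (contDiffOn_pd hN isOpen_univ hg.contDiffOn i)

theorem pd_congr {g h : E n → ℝ} {x : E n} (e : g =ᶠ[𝓝 x] h) (i : Fin n) : pd i g x = pd i h x := by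
  rw [pd, pd, e.fderiv_eq]

theorem pd_congr_eventually {g h : E n → ℝ} {x : E n} (e : g =ᶠ[𝓝 x] h) (i : Fin n) :
    pd i g =ᶠ[𝓝 x] pd i h :=
  e.eventuallyEq_nhds.mono fun _ hy => pd_congr hy i

theorem pd_comm {g : E n → ℝ} {x : E n} (hg : ContDiffAt ℝ 2 g x) (i j : Fin n) :
    pd j (pd i g) x = pd i (pd j g) x := by
  have hd : DifferentiableAt ℝ (fderiv ℝ g) x :=
    (hg.fderiv_right (m := 1) le_rfl).differentiableAt one_ne_zero
  have key : ∀ a b, pd b (pd a g) x =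
      fderiv ℝ (fderiv ℝ g) x (EuclideanSpace.single b 1) (EuclideanSpace.single a 1) := by
    intro a b
    unfold pd
    rw [fderiv_clm_apply hd (differentiableAt_const _)]
    simp
  rw [key, key]
  exact (hg.isSymmSndFDerivAt (by simp)).eq _ _

theorem hasDerivAt_pd {g : E n → ℝ} {x : E n} (hg : DifferentiableAt ℝ g x) (i : Fin n) :
    HasDerivAt (fun s : ℝ => g (x + s • EuclideanSpace.single i 1)) (pd i g x) 0 :=
  hg.hasFDerivAt.hasLineDerivAt (EuclideanSpace.single i 1)

theorem fderiv_apply_eq_sum (g : E n → ℝ) (x v : E n) :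
    fderiv ℝ g x v = ∑ i, v i * pd i g x := by
  conv_lhs => rw [← (EuclideanSpace.basisFun (Fin n) ℝ).sum_repr v]
  simp [pd]

theorem contDiffOn_apply {N : WithTop ℕ∞} {s : Set (E n)} {f : E n → E m}
    (hf : ContDiffOn ℝ N f s) (α : Fin m) : ContDiffOn ℝ N (fun y => f y α) s :=
  (contDiffOn_euclidean.1 hf) α

theorem continuousOn_jet1 {s : Set (E n)} (hs : IsOpen s) {f : E n → E m}
    (hf : ContDiffOn ℝ 2 f s) : ContinuousOn (jet1 f) s :=
  continuousOn_pi.2 fun α => continuousOn_pi.2 fun i =>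
    (contDiffOn_pd (N := 1) le_rfl hs (contDiffOn_apply hf α) i).continuousOn

theorem continuousOn_jet2 {s : Set (E n)} (hs : IsOpen s) {f : E n → E m}
    (hf : ContDiffOn ℝ 2 f s) : ContinuousOn (jet2 f) s :=
  continuousOn_pi.2 fun α => continuousOn_pi.2 fun i => continuousOn_pi.2 fun j =>
    (contDiffOn_pd (N := 0) (M := 1) le_rfl hs
      (contDiffOn_pd (N := 1) le_rfl hs (contDiffOn_apply hf α) i) j).continuousOn

/-- The 2-jet of `f`. -/
def jet (f : E n → E m) (x : E n) : Jet n m := (jet1 f x, jet2 f x)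

theorem continuousOn_jet {s : Set (E n)} (hs : IsOpen s) {f : E n → E m}
    (hf : ContDiffOn ℝ 2 f s) : ContinuousOn (jet f) s :=
  (continuousOn_jet1 hs hf).prodMk (continuousOn_jet2 hs hf)

theorem jet_congr {f g : E n → E m} {x : E n} (e : f =ᶠ[𝓝 x] g) : jet f x = jet g x := by
  have e0 : ∀ α, (fun y => f y α) =ᶠ[𝓝 x] fun y => g y α := fun α => e.mono fun y hy => by
    simp [hy]
  refine Prod.ext ?_ ?_
  · ext α i
    exact pd_congr (e0 α) i
  · funext α
    ext i j
    exact pd_congr (pd_congr_eventually (e0 α) i) j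

theorem jet2_symm {f : E n → E m} {x : E n} (hf : ContDiffAt ℝ 2 f x) (α : Fin m) :
    (jet2 f x α).transpose = jet2 f x α := by
  ext i j
  exact pd_comm ((contDiffAt_euclidean.1 hf) α) j i

/-- The divergence `S + S^⊥` of the mass field. -/
def massDiv (f : E n → E m) (x : E n) : ℝ := SJ (jet1 f x) (jet2 f x) + PJ (jet1 f x) (jet2 f x)

theorem massDiv_eq {f : E n → E m} {x : E n} (hf : ContDiffAt ℝ 2 f x) :
    massDiv f x = scalarCurv f x + Sperp f x := by
  rw [massDiv, Sperp_eq, scalarCurv_eq f x (jet2_symm hf)]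

/-- The mass field as a function of the 2-jet. -/
def fieldJ (q : Jet n m) : E n := WithLp.toLp 2 (XJ q.1 q.2)

/-- The divergence of the mass field as a function of the 2-jet. -/
def divJ (q : Jet n m) : ℝ := SJ q.1 q.2 + PJ q.1 q.2

theorem continuous_fieldJ : Continuous (fieldJ : Jet n m → E n) :=
  (PiLp.continuous_toLp 2 (fun _ : Fin n => ℝ)).comp continuous_XJ

theorem continuous_divJ : Continuous (divJ : Jet n m → ℝ) :=
  Continuous.add continuous_SJ continuous_PJ

theorem massField_eq (f : E n → E m) : massField f = fun x => fieldJ (jet f x) := rfl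

theorem massDiv_eq_divJ (f : E n → E m) : massDiv f = fun x => divJ (jet f x) := rfl

theorem continuousOn_massField {s : Set (E n)} (hs : IsOpen s) {f : E n → E m}
    (hf : ContDiffOn ℝ 2 f s) : ContinuousOn (massField f) s := by
  rw [massField_eq]
  exact continuous_fieldJ.comp_continuousOn (continuousOn_jet hs hf)

theorem continuousOn_massDiv {s : Set (E n)} (hs : IsOpen s) {f : E n → E m}
    (hf : ContDiffOn ℝ 2 f s) : ContinuousOn (massDiv f) s := by
  rw [massDiv_eq_divJ]
  exact continuous_divJ.comp_continuousOn (continuousOn_jet hs hf)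

/-! ### The divergence theorem for smooth maps -/

theorem contDiffAt_matrix_mul {V : Type*} [NormedAddCommGroup V] [NormedSpace ℝ V]
    {N : WithTop ℕ∞} {k l r : ℕ} {A : V → Matrix (Fin k) (Fin l) ℝ}
    {B : V → Matrix (Fin l) (Fin r) ℝ} {x : V}
    (hA : ∀ i j, ContDiffAt ℝ N (fun y => A y i j) x)
    (hB : ∀ i j, ContDiffAt ℝ N (fun y => B y i j) x) (i : Fin k) (j : Fin r) :
    ContDiffAt ℝ N (fun y => (A y * B y) i j) x := by
  simp only [Matrix.mul_apply]
  exact ContDiffAt.sum fun a _ => (hA i a).mul (hB a j)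

theorem contDiffAt_matrix_mulVec {V : Type*} [NormedAddCommGroup V] [NormedSpace ℝ V]
    {N : WithTop ℕ∞} {k l : ℕ} {A : V → Matrix (Fin k) (Fin l) ℝ}
    {v : V → Fin l → ℝ} {x : V}
    (hA : ∀ i j, ContDiffAt ℝ N (fun y => A y i j) x)
    (hv : ∀ i, ContDiffAt ℝ N (fun y => v y i) x) (i : Fin k) :
    ContDiffAt ℝ N (fun y => ((A y).mulVec (v y)) i) x := by
  simp only [Matrix.mulVec, dotProduct]
  exact ContDiffAt.sum fun a _ => (hA i a).mul (hv a)

theorem contDiffAt_gJ_inv {V : Type*} [NormedAddCommGroup V] [NormedSpace ℝ V]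
    {N : WithTop ℕ∞} {p : V → Matrix (Fin m) (Fin n) ℝ} {x : V}
    (hp : ∀ i j, ContDiffAt ℝ N (fun y => p y i j) x) (i j : Fin n) :
    ContDiffAt ℝ N (fun y => (gJ (p y))⁻¹ i j) x := by
  refine contDiffAt_matrix_inv (M := fun y => gJ (p y)) (fun i j => ?_) (gJ_isUnit_det _) i j
  simp only [gJ, Matrix.add_apply]
  exact contDiffAt_const.add
    (contDiffAt_matrix_mul (A := fun y => (p y).transpose) (fun i j => hp j i) hp i j)

theorem contDiffAt_XJ {V : Type*} [NormedAddCommGroup V] [NormedSpace ℝ V]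
    {N : WithTop ℕ∞} {p : V → Matrix (Fin m) (Fin n) ℝ}
    {h : V → Fin m → Matrix (Fin n) (Fin n) ℝ} {x : V}
    (hp : ∀ i j, ContDiffAt ℝ N (fun y => p y i j) x)
    (hh : ∀ α i j, ContDiffAt ℝ N (fun y => h y α i j) x) (k : Fin n) :
    ContDiffAt ℝ N (fun y => XJ (p y) (h y) k) x := by
  have hA := fun α => contDiffAt_matrix_mul (contDiffAt_gJ_inv hp) (hh α)
  have hv := fun α => contDiffAt_matrix_mulVec (contDiffAt_gJ_inv hp) (hp α)
  have hAv := fun α => contDiffAt_matrix_mulVec (hA α) (hv α)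
  simp only [XJ, Finset.sum_apply]
  exact ContDiffAt.sum fun α _ => ((ContDiffAt.sum fun i _ => hA α i i).mul (hv α k)).sub (hAv α k)

theorem contDiff_massField_apply {f : E n → E m} (hf : ContDiff ℝ 3 f) (k : Fin n) :
    ContDiff ℝ 1 (fun x => massField f x k) := by
  have h1 : ∀ α i, ContDiff ℝ 2 (d1 f α i) := fun α i =>
    contDiff_pd (N := 2) (by norm_num) ((contDiff_euclidean.1 hf) α) i
  refine contDiff_iff_contDiffAt.2 fun x =>
    contDiffAt_XJ (fun α i => ((h1 α i).of_le (by norm_num)).contDiffAt) (fun α i j => ?_) k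
  exact (contDiff_pd (N := 1) (by norm_num) (h1 α i) j).contDiffAt

theorem sum_pd_massField {f : E n → E m} (hf : ContDiff ℝ 3 f) (x : E n) :
    ∑ k, pd k (fun y => massField f y k) x = massDiv f x := by
  have h1 : ∀ α i, ContDiff ℝ 2 (d1 f α i) := fun α i =>
    contDiff_pd (N := 2) (by norm_num) ((contDiff_euclidean.1 hf) α) i
  have h2 : ∀ α i j, ContDiff ℝ 1 (d2 f α i j) := fun α i j =>
    contDiff_pd (N := 1) (by norm_num) (h1 α i) j
  rw [massDiv, ← sum_XJDeriv _ (jet2_symm (hf.of_le (by norm_num)).contDiffAt)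
    (T := fun α i j k => pd k (d2 f α i j) x)
    (fun α i j k => pd_comm (h1 α i).contDiffAt j k)]
  refine Finset.sum_congr rfl fun k _ => ?_
  have hl := hasDerivAt_pd ((contDiff_massField_apply hf k).differentiable one_ne_zero x) k
  have hr := hasDerivAt_XJ (t := 0)
    (p := fun s => jet1 f (x + s • EuclideanSpace.single k 1))
    (h := fun s => jet2 f (x + s • EuclideanSpace.single k 1))
    (p' := Matrix.of fun α i => jet2 f x α i k)
    (h' := fun α => Matrix.of fun i j => pd k (d2 f α i j) x)
    (fun α i => hasDerivAt_pd ((h1 α i).differentiable two_ne_zero x) k)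
    (fun α i j => hasDerivAt_pd ((h2 α i j).differentiable one_ne_zero x) k) k
  simp only [zero_smul, add_zero] at hr
  exact hl.unique hr

/-- For C³ maps the field is C¹, and coordinatewise integration by parts applies. -/
theorem integral_smooth_mass_identity {f : E n → E m} (hf : ContDiff ℝ 3 f) {ζ : E n → ℝ}
    (hζ : ContDiff ℝ 1 ζ) (hc : HasCompactSupport ζ) :
    ∫ x, (fderiv ℝ ζ x (massField f x) + ζ x * massDiv f x) = 0 := by
  have hX := contDiff_massField_apply hf
  have c1 : ∀ k, Continuous (pd k ζ) := fun k => (contDiff_pd (N := 0) (by norm_num) hζ k).continuous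
  have c2 : ∀ k, Continuous (pd k fun y => massField f y k) := fun k =>
    (contDiff_pd (N := 0) (by norm_num) (hX k) k).continuous
  have s1 : ∀ k, HasCompactSupport (pd k ζ) := fun k => by
    refine (hc.fderiv ℝ).comp_left (g := fun L : E n →L[ℝ] ℝ => L (EuclideanSpace.single k 1)) ?_
    simp
  have i1 : ∀ k, Integrable (fun x => pd k ζ x * massField f x k) := fun k =>
    ((c1 k).mul (hX k).continuous).integrable_of_hasCompactSupport ((s1 k).mul_right)
  have i2 : ∀ k, Integrable (fun x => ζ x * pd k (fun y => massField f y k) x) := fun k =>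
    (hζ.continuous.mul (c2 k)).integrable_of_hasCompactSupport hc.mul_right
  have i3 : ∀ k, Integrable (fun x => ζ x * massField f x k) := fun k =>
    (hζ.continuous.mul (hX k).continuous).integrable_of_hasCompactSupport hc.mul_right
  have key : ∀ k, ∫ x, (pd k ζ x * massField f x k + ζ x * pd k (fun y => massField f y k) x) = 0 := by
    intro k
    rw [integral_add (i1 k) (i2 k)]
    have := integral_mul_fderiv_eq_neg_fderiv_mul_of_integrable (i1 k) (i2 k) (i3 k)
      (fun x _ => hζ.differentiable one_ne_zero x)
      (fun x _ => (hX k).differentiable one_ne_zero x)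
    change ∫ x, ζ x * pd k (fun y => massField f y k) x = -∫ x, pd k ζ x * massField f x k at this
    rw [this, add_neg_cancel]
  calc ∫ x, (fderiv ℝ ζ x (massField f x) + ζ x * massDiv f x)
      = ∫ x, ∑ k, (pd k ζ x * massField f x k + ζ x * pd k (fun y => massField f y k) x) := by
        congr 1
        ext x
        rw [← sum_pd_massField hf, fderiv_apply_eq_sum, Finset.mul_sum, ← Finset.sum_add_distrib]
        exact Finset.sum_congr rfl fun k _ => by ring
    _ = 0 := by
        refine (integral_finsetSum _ fun k _ => (i1 k).add (i2 k)).trans ?_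
        exact Finset.sum_eq_zero fun k _ => key k

end

section

variable {n m : ℕ}

/-! ### Cutoff functions and mollification -/

theorem exists_cutoff {K s : Set (E n)} (hK : IsCompact K) (hs : IsOpen s) (hKs : K ⊆ s) :
    ∃ χ : E n → ℝ, ContDiff ℝ 2 χ ∧ HasCompactSupport χ ∧ tsupport χ ⊆ s ∧
      (∀ᶠ x in 𝓝ˢ K, χ x = 1) := by
  obtain ⟨L, hL, hKL, hLs⟩ := exists_compact_between hK hs hKs
  obtain ⟨χ, h1, h0, -⟩ := exists_contMDiffMap_one_nhds_of_subset_interior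
    (modelWithCornersSelf ℝ (E n)) hK.isClosed hKL (n := 2)
  have hsup : tsupport χ ⊆ L := closure_minimal (fun x hx => by
    by_contra h; exact hx (h0 x h)) hL.isClosed
  exact ⟨χ, χ.contMDiff.contDiff, hL.of_isClosed_subset (isClosed_tsupport _) hsup,
    hsup.trans hLs, h1⟩

theorem contDiff_smul_of_tsupport_subset {F : Type*} [NormedAddCommGroup F] [NormedSpace ℝ F]
    {N : WithTop ℕ∞} {s : Set (E n)} (hs : IsOpen s)
    {χ : E n → ℝ} (hχ : ContDiffOn ℝ N χ s) (hsub : tsupport χ ⊆ s) {f : E n → F}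
    (hf : ContDiffOn ℝ N f s) : ContDiff ℝ N fun x => χ x • f x := by
  refine contDiff_iff_contDiffAt.2 fun x => ?_
  by_cases hx : x ∈ s
  · exact (hχ.contDiffAt (hs.mem_nhds hx)).smul (hf.contDiffAt (hs.mem_nhds hx))
  · refine (contDiffAt_const (c := (0 : F))).congr_of_eventuallyEq ?_
    filter_upwards [(isClosed_tsupport χ).isOpen_compl.mem_nhds fun h => hx (hsub h)] with y hy
    rw [image_eq_zero_of_notMem_tsupport hy, zero_smul]

open scoped Convolution

/-- Mollification of a real function. -/
def mollify (φ : ContDiffBump (0 : E n)) (g : E n → ℝ) : E n → ℝ :=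
  φ.normed volume ⋆[ContinuousLinearMap.lsmul ℝ ℝ, volume] g

theorem contDiff_mollify (φ : ContDiffBump (0 : E n)) {g : E n → ℝ} (hg : Continuous g) :
    ContDiff ℝ 3 (mollify φ g) :=
  φ.hasCompactSupport_normed.contDiff_convolution_left (n := 3) _ φ.contDiff_normed
    hg.locallyIntegrable

theorem pd_mollify (φ : ContDiffBump (0 : E n)) {g : E n → ℝ} (hg : ContDiff ℝ 1 g)
    (hc : HasCompactSupport g) (i : Fin n) : pd i (mollify φ g) = mollify φ (pd i g) := by
  ext x
  have hφ : LocallyIntegrable (φ.normed volume) volume := φ.continuous_normed.locallyIntegrable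
  have h := hc.hasFDerivAt_convolution_right (ContinuousLinearMap.lsmul ℝ ℝ) hφ hg x
  rw [pd, mollify, h.fderiv,
    convolution_precompR_apply _ hφ (hc.fderiv ℝ) (hg.continuous_fderiv one_ne_zero)]
  rfl

/-- The mollified value is within 2C of g x, as all values of g lie in [-C, C]. The constant is not
sharp, but only a uniform bound is needed. -/
theorem abs_mollify_le (φ : ContDiffBump (0 : E n)) {g : E n → ℝ} (hg : Continuous g) {C : ℝ}
    (hC : ∀ x, |g x| ≤ C) (x : E n) : |mollify φ g x| ≤ 3 * C := by
  have h : dist (mollify φ g x) (g x) ≤ 2 * C :=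
    φ.dist_normed_convolution_le hg.aestronglyMeasurable fun y _ => by
      rw [Real.dist_eq]
      have := abs_sub (g y) (g x)
      linarith [hC y, hC x]
  rw [Real.dist_eq] at h
  have := abs_sub_abs_le_abs_sub (mollify φ g x) (g x)
  linarith [hC x]

theorem tendsto_mollify {φ : ℕ → ContDiffBump (0 : E n)}
    (hφ : Tendsto (fun i => (φ i).rOut) atTop (𝓝 0)) {g : E n → ℝ} (hg : Continuous g) (x : E n) :
    Tendsto (fun i => mollify (φ i) g x) atTop (𝓝 (g x)) :=
  ContDiffBump.convolution_tendsto_right_of_continuous hφ hg x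

/-- The jets with entries bounded by `C`. -/
def jetBox (n m : ℕ) (C : ℝ) : Set (Jet n m) :=
  (Set.univ.pi fun _ => Set.univ.pi fun _ => Icc (-C) C) ×ˢ
    (Set.univ.pi fun _ => Set.univ.pi fun _ => Set.univ.pi fun _ => Icc (-C) C)

theorem isCompact_jetBox (C : ℝ) : IsCompact (jetBox n m C) :=
  (isCompact_univ_pi fun _ => isCompact_univ_pi fun _ => isCompact_Icc).prod
    (isCompact_univ_pi fun _ => isCompact_univ_pi fun _ => isCompact_univ_pi fun _ => isCompact_Icc)

theorem mem_jetBox {C : ℝ} {q : Jet n m} (h1 : ∀ α i, |q.1 α i| ≤ C) (h2 : ∀ α i j, |q.2 α i j| ≤ C) :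
    q ∈ jetBox n m C :=
  ⟨fun α _ i _ => abs_le.1 (h1 α i), fun α _ i _ j _ => abs_le.1 (h2 α i j)⟩

/-- The 2-jets of the mollified maps are the mollified 2-jets of f. They converge pointwise and stay
in a fixed compact set, so the identity for smooth maps passes to the limit by dominated
convergence: neither the field nor its divergence involves third derivatives. -/
theorem integral_mass_identity_of_contDiff {f : E n → E m} (hf : ContDiff ℝ 2 f)
    (hfc : HasCompactSupport f) {ζ : E n → ℝ}
    (hζ : ContDiff ℝ 1 ζ) (hc : HasCompactSupport ζ) :
    ∫ x, (fderiv ℝ ζ x (massField f x) + ζ x * massDiv f x) = 0 := by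
  let φ : ℕ → ContDiffBump (0 : E n) := fun k =>
    { rIn := 1 / (2 * ((k : ℝ) + 1)), rOut := 1 / ((k : ℝ) + 1), rIn_pos := by positivity
      rIn_lt_rOut := by
        apply one_div_lt_one_div_of_lt
        · positivity
        · linarith [Nat.cast_nonneg (α := ℝ) k] }
  have hφ : Tendsto (fun k => (φ k).rOut) atTop (𝓝 0) := tendsto_one_div_add_atTop_nhds_zero_nat
  have f0 : ∀ α, ContDiff ℝ 2 fun y => f y α := fun α => (contDiff_euclidean.1 hf) α
  have f1 : ∀ α i, ContDiff ℝ 1 (d1 f α i) := fun α i => contDiff_pd (N := 1) le_rfl (f0 α) i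
  have f2 : ∀ α i j, Continuous (d2 f α i j) := fun α i j =>
    (contDiff_pd (N := 0) (by norm_num) (f1 α i) j).continuous
  have pdc : ∀ {g : E n → ℝ}, HasCompactSupport g → ∀ i, HasCompactSupport (pd i g) :=
    fun hg i => (hg.fderiv ℝ).comp_left
      (g := fun L : E n →L[ℝ] ℝ => L (EuclideanSpace.single i 1)) (by simp)
  have c0 : ∀ α, HasCompactSupport fun y => f y α := fun α =>
    hfc.comp_left (g := fun v : E m => v α) rfl
  have c1 : ∀ α i, HasCompactSupport (d1 f α i) := fun α i => pdc (c0 α) i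
  have c2 : ∀ α i j, HasCompactSupport (d2 f α i j) := fun α i j => pdc (c1 α i) j
  let F : ℕ → E n → E m := fun k y => WithLp.toLp 2 fun α => mollify (φ k) (fun y => f y α) y
  have F1 : ∀ k α i, d1 (F k) α i = mollify (φ k) (d1 f α i) := fun k α i =>
    pd_mollify (φ k) ((f0 α).of_le (by norm_num)) (c0 α) i
  have F2 : ∀ k α i j, d2 (F k) α i j = mollify (φ k) (d2 f α i j) := fun k α i j => by
    rw [d2, F1]
    exact pd_mollify (φ k) (f1 α i) (c1 α i) j
  have hF : ∀ k, ContDiff ℝ 3 (F k) := fun k => contDiff_euclidean.2 fun α =>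
    contDiff_mollify (φ k) (f0 α).continuous
  obtain ⟨M, hM1, hM2⟩ : ∃ M, (∀ α i x, |d1 f α i x| ≤ M) ∧ ∀ α i j x, |d2 f α i j x| ≤ M := by
    have b : ∀ g : E n → ℝ, Continuous g → HasCompactSupport g → ∃ C, 0 ≤ C ∧ ∀ x, |g x| ≤ C :=
      fun g hg hgc => by
        obtain ⟨C, hC⟩ := hg.bounded_above_of_compact_support hgc
        exact ⟨C, (norm_nonneg _).trans (hC 0), hC⟩
    choose B1 hB1 hB1' using fun α i => b _ (f1 α i).continuous (c1 α i)
    choose B2 hB2 hB2' using fun α i j => b _ (f2 α i j) (c2 α i j)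
    refine ⟨∑ α, ∑ i, B1 α i + ∑ α, ∑ i, ∑ j, B2 α i j, fun α i x => (hB1' α i x).trans ?_,
      fun α i j x => (hB2' α i j x).trans ?_⟩
    · have e1 := Finset.single_le_sum (f := fun i => B1 α i) (fun i _ => hB1 α i) (Finset.mem_univ i)
      have e2 := Finset.single_le_sum (f := fun α => ∑ i, B1 α i)
        (fun α _ => Finset.sum_nonneg fun i _ => hB1 α i) (Finset.mem_univ α)
      have e3 : 0 ≤ ∑ α, ∑ i, ∑ j, B2 α i j := Finset.sum_nonneg fun α _ =>
        Finset.sum_nonneg fun i _ => Finset.sum_nonneg fun j _ => hB2 α i j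
      linarith
    · have e1 := Finset.single_le_sum (f := fun j => B2 α i j) (fun j _ => hB2 α i j)
        (Finset.mem_univ j)
      have e2 := Finset.single_le_sum (f := fun i => ∑ j, B2 α i j)
        (fun i _ => Finset.sum_nonneg fun j _ => hB2 α i j) (Finset.mem_univ i)
      have e3 := Finset.single_le_sum (f := fun α => ∑ i, ∑ j, B2 α i j)
        (fun α _ => Finset.sum_nonneg fun i _ => Finset.sum_nonneg fun j _ => hB2 α i j)
        (Finset.mem_univ α)
      have e4 : 0 ≤ ∑ α, ∑ i, B1 α i := Finset.sum_nonneg fun α _ =>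
        Finset.sum_nonneg fun i _ => hB1 α i
      linarith
  have hbox : ∀ k x, jet (F k) x ∈ jetBox n m (3 * M) := fun k x => by
    refine mem_jetBox (fun α i => ?_) (fun α i j => ?_)
    · change |d1 (F k) α i x| ≤ _
      rw [F1]
      exact abs_mollify_le _ (f1 α i).continuous (hM1 α i) x
    · change |d2 (F k) α i j x| ≤ _
      rw [F2]
      exact abs_mollify_le _ (f2 α i j) (hM2 α i j) x
  have hlim : ∀ x, Tendsto (fun k => jet (F k) x) atTop (𝓝 (jet f x)) := fun x => by
    refine Tendsto.prodMk_nhds ?_ ?_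
    · refine tendsto_pi_nhds.2 fun α => tendsto_pi_nhds.2 fun i => ?_
      have := tendsto_mollify hφ (f1 α i).continuous x
      simp only [← F1] at this
      exact this
    · refine tendsto_pi_nhds.2 fun α => tendsto_pi_nhds.2 fun i => tendsto_pi_nhds.2 fun j => ?_
      have := tendsto_mollify hφ (f2 α i j) x
      simp only [← F2] at this
      exact this
  obtain ⟨C1, hC1⟩ := (isCompact_jetBox (n := n) (m := m) (3 * M)).exists_bound_of_continuousOn
    continuous_fieldJ.continuousOn
  obtain ⟨C2, hC2⟩ := (isCompact_jetBox (n := n) (m := m) (3 * M)).exists_bound_of_continuousOn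
    continuous_divJ.continuousOn
  have hζ' : Continuous (fderiv ℝ ζ) := hζ.continuous_fderiv one_ne_zero
  have hb1 : ∀ k x, ‖massField (F k) x‖ ≤ C1 := fun k x => by
    rw [massField_eq]; exact hC1 _ (hbox k x)
  have hb2 : ∀ k x, ‖massDiv (F k) x‖ ≤ C2 := fun k x => by
    rw [massDiv_eq_divJ]; exact hC2 _ (hbox k x)
  have lim1 : ∀ x, Tendsto (fun k => massField (F k) x) atTop (𝓝 (massField f x)) := fun x => by
    simp only [massField_eq]
    exact (continuous_fieldJ.tendsto (jet f x)).comp (hlim x)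
  have lim2 : ∀ x, Tendsto (fun k => massDiv (F k) x) atTop (𝓝 (massDiv f x)) := fun x => by
    simp only [massDiv_eq_divJ]
    exact (continuous_divJ.tendsto (jet f x)).comp (hlim x)
  have lim := tendsto_integral_of_dominated_convergence
    (F := fun k x => fderiv ℝ ζ x (massField (F k) x) + ζ x * massDiv (F k) x)
    (f := fun x => fderiv ℝ ζ x (massField f x) + ζ x * massDiv f x)
    (μ := volume) (fun x => ‖fderiv ℝ ζ x‖ * C1 + ‖ζ x‖ * C2) ?_ ?_ ?_ ?_
  · refine tendsto_nhds_unique lim ?_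
    simp only [integral_smooth_mass_identity (hF _) hζ hc]
    exact tendsto_const_nhds
  · intro k
    have h1 := continuousOn_massField isOpen_univ (((hF k).of_le (by norm_num)).contDiffOn (n := 2))
    have h2 := continuousOn_massDiv isOpen_univ (((hF k).of_le (by norm_num)).contDiffOn (n := 2))
    rw [continuousOn_univ] at h1 h2
    exact ((hζ'.clm_apply h1).add (hζ.continuous.mul h2)).aestronglyMeasurable
  · refine Integrable.add ?_ ?_
    · exact (hζ'.norm.integrable_of_hasCompactSupport (hc.fderiv ℝ).norm).mul_const C1
    · exact (hζ.continuous.norm.integrable_of_hasCompactSupport hc.norm).mul_const C2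
  · intro k
    refine Eventually.of_forall fun x => (norm_add_le _ _).trans (add_le_add ?_ ?_)
    · exact ((fderiv ℝ ζ x).le_opNorm _).trans
        (mul_le_mul_of_nonneg_left (hb1 k x) (norm_nonneg _))
    · rw [norm_mul]
      exact mul_le_mul_of_nonneg_left (hb2 k x) (norm_nonneg _)
  · refine Eventually.of_forall fun x => ?_
    have a3 := ((fderiv ℝ ζ x).continuous.tendsto (massField f x)).comp (lim1 x)
    exact a3.add ((lim2 x).const_mul (ζ x))

/-- The weak form of `div X = S + S^⊥` for a `C²` map on an open set. -/
theorem integral_mass_identity {f : E n → E m} {s : Set (E n)} (hs : IsOpen s)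
    (hf : ContDiffOn ℝ 2 f s) {ζ : E n → ℝ} (hζ : ContDiff ℝ 1 ζ) (hc : HasCompactSupport ζ)
    (hsub : tsupport ζ ⊆ s) :
    ∫ x, (fderiv ℝ ζ x (massField f x) + ζ x * massDiv f x) = 0 := by
  obtain ⟨χ, hχ, hχc, hχs, hχ1⟩ := exists_cutoff hc hs hsub
  rw [← integral_mass_identity_of_contDiff (f := fun x => χ x • f x)
    (contDiff_smul_of_tsupport_subset hs hχ.contDiffOn hχs hf) hχc.smul_right hζ hc]
  congr 1
  ext x
  by_cases hx : x ∈ tsupport ζ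
  · have e : f =ᶠ[𝓝 x] fun x => χ x • f x := by
      filter_upwards [(eventually_nhdsSet_iff_forall.1 hχ1) x hx] with y hy
      rw [hy, one_smul]
    simp only [massField_eq, massDiv_eq_divJ, jet_congr e]
  · rw [image_eq_zero_of_notMem_tsupport hx,
      image_eq_zero_of_notMem_tsupport fun h => hx (tsupport_fderiv_subset ℝ h)]
    simp

end

section

variable {n m : ℕ}

/-! ### The area formula for Hausdorff measure -/

section Area

open Measure ENNReal

/-- On A the map f factors through g by a c-Lipschitz map, because g x = g y forces f x = f y.
Lipschitz maps expand d-dimensional Hausdorff measure by at most c^d. -/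
theorem hausdorffMeasure_image_le_of_dist_le {X Y Z : Type*} [PseudoMetricSpace X]
    [MetricSpace Y] [MeasurableSpace Y] [BorelSpace Y]
    [MetricSpace Z] [MeasurableSpace Z] [BorelSpace Z] {f : X → Y} {g : X → Z} {A : Set X}
    {c : NNReal} (h : ∀ x ∈ A, ∀ y ∈ A, dist (f x) (f y) ≤ c * dist (g x) (g y)) (d : ℕ) :
    euclideanHausdorffMeasure d (f '' A) ≤
      (c : ℝ≥0∞) ^ d * euclideanHausdorffMeasure d (g '' A) := by
  rcases A.eq_empty_or_nonempty with rfl | ⟨x0, hx0⟩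
  · simp
  have : Nonempty X := ⟨x0⟩
  let k : Z → Y := fun z => f (Function.invFunOn g A z)
  have hk : ∀ x ∈ A, k (g x) = f x := by
    intro x hx
    have hm : Function.invFunOn g A (g x) ∈ A := Function.invFunOn_mem ⟨x, hx, rfl⟩
    have he : g (Function.invFunOn g A (g x)) = g x := Function.invFunOn_eq ⟨x, hx, rfl⟩
    have := h _ hm _ hx
    rw [he, dist_self, mul_zero] at this
    exact dist_le_zero.1 this
  have hl : LipschitzOnWith c k (g '' A) := by
    refine LipschitzOnWith.of_dist_le_mul ?_
    rintro _ ⟨x, hx, rfl⟩ _ ⟨y, hy, rfl⟩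
    rw [hk x hx, hk y hy]
    exact h x hx y hy
  have him : f '' A = k '' (g '' A) := by
    rw [image_image]
    exact image_congr fun x hx => (hk x hx).symm
  rw [him, euclideanHausdorffMeasure_def, euclideanHausdorffMeasure_def, Measure.smul_apply,
    Measure.smul_apply]
  have := hl.hausdorffMeasure_image_le (d := d) (by positivity)
  rw [ENNReal.rpow_natCast] at this
  rw [ENNReal.smul_def, ENNReal.smul_def, smul_eq_mul, smul_eq_mul, mul_left_comm]
  gcongr

variable {V W : Type*} [NormedAddCommGroup V] [InnerProductSpace ℝ V] [FiniteDimensional ℝ V]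
  [MeasurableSpace V] [BorelSpace V] [NormedAddCommGroup W] [InnerProductSpace ℝ W]
  [MeasurableSpace W] [BorelSpace W]

/-- A `C¹` map that does not shrink tangent vectors distorts small sets, up to a factor close to
`1`, by its Jacobian. -/
theorem exists_nhds_hausdorffMeasure_image_approx {γ : V → W} {γ' : V → V →L[ℝ] W} {U : Set V}
    (hU : IsOpen U) (hγ : ∀ a ∈ U, HasStrictFDerivAt γ (γ' a) a)
    (hexp : ∀ a ∈ U, ∀ v, ‖v‖ ≤ ‖γ' a v‖)
    (hJ : ContinuousOn (fun a => (γ' a : V →ₗ[ℝ] W).normDet) U)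
    {c : NNReal} (hc : 1 < c) {a : V} (ha : a ∈ U) :
    ∃ S, IsOpen S ∧ a ∈ S ∧ S ⊆ U ∧ ∀ A ⊆ S, MeasurableSet A →
      euclideanHausdorffMeasure (Module.finrank ℝ V) (γ '' A) ≤
        (c : ℝ≥0∞) ^ (Module.finrank ℝ V + 1) *
          ∫⁻ x in A, ENNReal.ofReal (γ' x : V →ₗ[ℝ] W).normDet ∧
      ∫⁻ x in A, ENNReal.ofReal (γ' x : V →ₗ[ℝ] W).normDet ≤
        (c : ℝ≥0∞) ^ (Module.finrank ℝ V + 1) *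
          euclideanHausdorffMeasure (Module.finrank ℝ V) (γ '' A) := by
  set J : V → ℝ := fun a => (γ' a : V →ₗ[ℝ] W).normDet
  have hcr : (1 : ℝ) < c := by exact_mod_cast hc
  have hJpos : 0 < J a := by
    refine lt_of_le_of_ne (LinearMap.normDet_nonneg _) fun h => ?_
    have h2 := (LinearMap.normDet_eq_zero_iff_ker_ne_bot).1 h.symm
    refine h2 ((LinearMap.ker_eq_bot').2 fun v hv => ?_)
    have := hexp a ha v
    rw [show γ' a v = 0 from hv, norm_zero] at this
    exact norm_le_zero_iff.1 this
  -- With this ε one has 1 - ε = 1/c and 1 + ε = 2 - 1/c ≤ c, so both distortion factors are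
  -- controlled by c.
  set ε : NNReal := Real.toNNReal (1 - (c : ℝ)⁻¹) with hε
  have hcinv : (c : ℝ)⁻¹ < 1 := inv_lt_one_of_one_lt₀ hcr
  have hcinv0 : 0 < (c : ℝ)⁻¹ := by positivity
  have hεr : (ε : ℝ) = 1 - (c : ℝ)⁻¹ := Real.coe_toNNReal _ (by linarith)
  obtain ⟨s, hs, hap⟩ := (hγ a ha).approximates_deriv_on_nhds
    (c := ε) (Or.inr (by rw [← NNReal.coe_pos, hεr]; linarith))
  have hJc : ContinuousAt J a := hJ.continuousAt (hU.mem_nhds ha)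
  have h1 : ∀ᶠ x in 𝓝 a, J x < c * J a :=
    hJc.eventually (gt_mem_nhds (by nlinarith))
  have h2 : ∀ᶠ x in 𝓝 a, J a < c * J x := by
    have : ContinuousAt (fun x => (c : ℝ) * J x) a := hJc.const_mul _
    exact this.eventually (lt_mem_nhds (by nlinarith))
  have hS : {x | x ∈ s ∧ x ∈ U ∧ J x < c * J a ∧ J a < c * J x} ∈ 𝓝 a := by
    filter_upwards [hs, hU.mem_nhds ha, h1, h2] with x h1 h2 h3 h4 using ⟨h1, h2, h3, h4⟩
  obtain ⟨S, hSsub, hSo, haS⟩ := mem_nhds_iff.1 hS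
  refine ⟨S, hSo, haS, fun x hx => (hSsub hx).2.1, ?_⟩
  intro A hA' hAm
  have hA := hA'.trans hSsub
  have hne : (c : ℝ) ≠ 0 := by positivity
  -- Since γ' a does not shrink vectors, the linearization error ε‖x - y‖ is also at most ε‖γ' a (x
  -- - y)‖. Hence γ is compared with its linear part directly in the target.
  have key : ∀ x ∈ A, ∀ y ∈ A, ‖γ x - γ y - γ' a (x - y)‖ ≤ ε * ‖γ' a (x - y)‖ := fun x hx y hy =>
    (hap x (hA hx).1 y (hA hy).1).trans (by gcongr; exact hexp a ha _)
  have up : ∀ x ∈ A, ∀ y ∈ A, dist (γ x) (γ y) ≤ c * dist (γ' a x) (γ' a y) := by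
    intro x hx y hy
    rw [dist_eq_norm, dist_eq_norm, ← map_sub]
    have h := key x hx y hy
    have h3 := norm_le_norm_sub_add (γ x - γ y) (γ' a (x - y))
    have h4 : (1 + (ε : ℝ)) ≤ c := by
      rw [hεr]
      have : (c : ℝ) * (c : ℝ)⁻¹ = 1 := mul_inv_cancel₀ hne
      nlinarith
    nlinarith [norm_nonneg (γ' a (x - y))]
  have down : ∀ x ∈ A, ∀ y ∈ A, dist (γ' a x) (γ' a y) ≤ c * dist (γ x) (γ y) := by
    intro x hx y hy
    rw [dist_eq_norm, dist_eq_norm, ← map_sub]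
    have h := key x hx y hy
    have h3 := norm_le_norm_sub_add (γ' a (x - y)) (γ x - γ y)
    rw [norm_sub_rev] at h3
    have h5 : (c : ℝ)⁻¹ * ‖γ' a (x - y)‖ ≤ ‖γ x - γ y‖ := by rw [hεr] at h; nlinarith
    calc ‖γ' a (x - y)‖ = c * ((c : ℝ)⁻¹ * ‖γ' a (x - y)‖) := by field_simp
      _ ≤ _ := by gcongr
  have lin := (γ' a : V →ₗ[ℝ] W).euclideanHausdorffMeasure_image_eq_normDet_mul_volume A
  have i1 : ENNReal.ofReal (J a) * volume A ≤ c * ∫⁻ x in A, ENNReal.ofReal (J x) := by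
    rw [← setLIntegral_const, ← lintegral_const_mul' _ _ (by simp)]
    refine setLIntegral_mono' hAm fun x hx => ?_
    rw [← ENNReal.ofReal_coe_nnreal, ← ENNReal.ofReal_mul c.coe_nonneg]
    exact ENNReal.ofReal_le_ofReal (hA hx).2.2.2.le
  have i2 : ∫⁻ x in A, ENNReal.ofReal (J x) ≤ c * (ENNReal.ofReal (J a) * volume A) := by
    rw [← mul_assoc, ← setLIntegral_const]
    refine setLIntegral_mono' hAm fun x hx => ?_
    rw [← ENNReal.ofReal_coe_nnreal, ← ENNReal.ofReal_mul c.coe_nonneg]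
    exact ENNReal.ofReal_le_ofReal (hA hx).2.2.1.le
  constructor
  · refine (hausdorffMeasure_image_le_of_dist_le (g := (γ' a : V →ₗ[ℝ] W)) up _).trans ?_
    rw [lin, pow_succ, mul_assoc]
    gcongr
  · refine i2.trans ?_
    rw [← lin, pow_succ', mul_assoc]
    gcongr
    exact hausdorffMeasure_image_le_of_dist_le down _

theorem ennreal_le_of_forall_pow_mul {x y : ℝ≥0∞} (k : ℕ)
    (h : ∀ c : NNReal, 1 < c → x ≤ (c : ℝ≥0∞) ^ k * y) : x ≤ y := by
  have h1 : Tendsto (fun c : NNReal => (c : ℝ≥0∞) ^ k * y) (𝓝[>] 1) (𝓝 (1 * y)) := by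
    refine ENNReal.Tendsto.mul_const ?_ (Or.inl one_ne_zero)
    have : Tendsto (fun c : NNReal => (c : ℝ≥0∞)) (𝓝[>] 1) (𝓝 ((1 : NNReal) : ℝ≥0∞)) :=
      (ENNReal.continuous_coe.tendsto 1).mono_left nhdsWithin_le_nhds
    simpa using ENNReal.Tendsto.pow (n := k) this
  rw [one_mul] at h1
  exact ge_of_tendsto h1 (eventually_nhdsWithin_of_forall fun c hc => h c hc)

/-- Countably many of the small sets above cover A. After making them disjoint, both sides add up,
by injectivity of γ, and agree up to a factor c^(d+1): d powers from the scaling of Hausdorff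
measure, one from the oscillation of the Jacobian. Then c → 1. -/
theorem hausdorffMeasure_image_eq_lintegral {γ : V → W} {γ' : V → V →L[ℝ] W} {U : Set V}
    (hU : IsOpen U) (hγ : ∀ a ∈ U, HasStrictFDerivAt γ (γ' a) a)
    (hexp : ∀ a ∈ U, ∀ v, ‖v‖ ≤ ‖γ' a v‖)
    (hJ : ContinuousOn (fun a => (γ' a : V →ₗ[ℝ] W).normDet) U) (hinj : InjOn γ U)
    {A : Set V} (hA : MeasurableSet A) (hAU : A ⊆ U) :
    euclideanHausdorffMeasure (Module.finrank ℝ V) (γ '' A) =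
      ∫⁻ x in A, ENNReal.ofReal (γ' x : V →ₗ[ℝ] W).normDet := by
  have hcont : ContinuousOn γ U := fun a ha => (hγ a ha).continuousAt.continuousWithinAt
  have pieces : ∀ c : NNReal, 1 < c → ∃ B : ℕ → Set V, (∀ i, MeasurableSet (B i)) ∧
      Pairwise (Function.onFun Disjoint B) ∧ A = ⋃ i, B i ∧ ∀ i,
      euclideanHausdorffMeasure (Module.finrank ℝ V) (γ '' B i) ≤
        (c : ℝ≥0∞) ^ (Module.finrank ℝ V + 1) *
          ∫⁻ x in B i, ENNReal.ofReal (γ' x : V →ₗ[ℝ] W).normDet ∧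
      ∫⁻ x in B i, ENNReal.ofReal (γ' x : V →ₗ[ℝ] W).normDet ≤
        (c : ℝ≥0∞) ^ (Module.finrank ℝ V + 1) *
          euclideanHausdorffMeasure (Module.finrank ℝ V) (γ '' B i) := by
    intro c hc
    rcases A.eq_empty_or_nonempty with rfl | hne
    · exact ⟨fun _ => ∅, by simp, fun _ _ _ => by simp [Function.onFun], by simp, by simp⟩
    choose! S hSo haS hSU hSA using fun a (ha : a ∈ U) =>
      exists_nhds_hausdorffMeasure_image_approx hU hγ hexp hJ hc ha
    obtain ⟨T, hTA, hTc, hT⟩ := TopologicalSpace.countable_cover_nhdsWithin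
      (f := fun a => S a) (s := A) fun a ha =>
        mem_nhdsWithin_of_mem_nhds ((hSo a (hAU ha)).mem_nhds (haS a (hAU ha)))
    have hTne : T.Nonempty := by
      rcases hne with ⟨a, ha⟩
      obtain ⟨t, ht, -⟩ := mem_iUnion₂.1 (hT ha)
      exact ⟨t, ht⟩
    obtain ⟨t, rfl⟩ := hTc.exists_eq_range hTne
    have htU : ∀ i, t i ∈ U := fun i => hAU (hTA (mem_range_self i))
    refine ⟨fun i => A ∩ disjointed (fun i => S (t i)) i, fun i => ?_, fun i j hij => ?_, ?_,
      fun i => ?_⟩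
    · exact hA.inter (MeasurableSet.disjointed (fun i => (hSo _ (htU i)).measurableSet) i)
    · exact ((disjoint_disjointed fun i => S (t i)) hij).mono inter_subset_right inter_subset_right
    · rw [← inter_iUnion, iUnion_disjointed]
      refine (inter_eq_left.2 ?_).symm
      simpa using hT
    · exact hSA _ (htU i) _ (inter_subset_right.trans (disjointed_subset _ i))
        (hA.inter (MeasurableSet.disjointed (fun i => (hSo _ (htU i)).measurableSet) i))
  have both : ∀ c : NNReal, 1 < c →
      euclideanHausdorffMeasure (Module.finrank ℝ V) (γ '' A) ≤
        (c : ℝ≥0∞) ^ (Module.finrank ℝ V + 1) *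
          ∫⁻ x in A, ENNReal.ofReal (γ' x : V →ₗ[ℝ] W).normDet ∧
      ∫⁻ x in A, ENNReal.ofReal (γ' x : V →ₗ[ℝ] W).normDet ≤
        (c : ℝ≥0∞) ^ (Module.finrank ℝ V + 1) *
          euclideanHausdorffMeasure (Module.finrank ℝ V) (γ '' A) := by
    intro c hc
    obtain ⟨B, hBm, hBd, hBA, hB⟩ := pieces c hc
    have hBU : ∀ i, B i ⊆ U := fun i => (subset_iUnion B i).trans (hBA ▸ hAU)
    have e1 : euclideanHausdorffMeasure (Module.finrank ℝ V) (γ '' A) =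
        ∑' i, euclideanHausdorffMeasure (Module.finrank ℝ V) (γ '' B i) := by
      rw [hBA, image_iUnion, measure_iUnion]
      · intro i j hij
        refine Set.disjoint_left.2 ?_
        rintro _ ⟨x, hx, rfl⟩ ⟨y, hy, e⟩
        exact Set.disjoint_left.1 (hBd hij) hx (hinj (hBU j hy) (hBU i hx) e ▸ hy)
      · exact fun i => (hBm i).image_of_continuousOn_injOn (hcont.mono (hBU i)) (hinj.mono (hBU i))
    have e2 : ∫⁻ x in A, ENNReal.ofReal (γ' x : V →ₗ[ℝ] W).normDet =
        ∑' i, ∫⁻ x in B i, ENNReal.ofReal (γ' x : V →ₗ[ℝ] W).normDet := by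
      rw [hBA, lintegral_iUnion hBm hBd]
    rw [e1, e2, ← ENNReal.tsum_mul_left, ← ENNReal.tsum_mul_left]
    exact ⟨ENNReal.tsum_le_tsum fun i => (hB i).1, ENNReal.tsum_le_tsum fun i => (hB i).2⟩
  exact le_antisymm (ennreal_le_of_forall_pow_mul _ fun c hc => (both c hc).1)
    (ennreal_le_of_forall_pow_mul _ fun c hc => (both c hc).2)

/-- The Hausdorff measure on an injectively parametrized `C¹` submanifold is the image of the
Jacobian density. -/
theorem hausdorffMeasure_restrict_image {γ : V → W} {γ' : V → V →L[ℝ] W} {U : Set V}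
    (hU : IsOpen U) (hγ : ∀ a ∈ U, HasStrictFDerivAt γ (γ' a) a)
    (hexp : ∀ a ∈ U, ∀ v, ‖v‖ ≤ ‖γ' a v‖)
    (hJ : ContinuousOn (fun a => (γ' a : V →ₗ[ℝ] W).normDet) U) (hinj : InjOn γ U) :
    (euclideanHausdorffMeasure (Module.finrank ℝ V)).restrict (γ '' U) =
      Measure.map γ ((volume.restrict U).withDensity
        fun x => ENNReal.ofReal (γ' x : V →ₗ[ℝ] W).normDet) := by
  have hcont : ContinuousOn γ U := fun a ha => (hγ a ha).continuousAt.continuousWithinAt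
  have hae : AEMeasurable γ ((volume.restrict U).withDensity
        fun x => ENNReal.ofReal (γ' x : V →ₗ[ℝ] W).normDet) :=
    (hcont.aemeasurable hU.measurableSet).mono_ac (withDensity_absolutelyContinuous _ _)
  ext s hs
  -- γ is continuous only on U, so measurability is read off from a modification outside U.
  have hm : MeasurableSet (U ∩ γ ⁻¹' s) := by
    classical
    have hg : Measurable (U.piecewise γ fun _ => 0) :=
      hcont.measurable_piecewise continuousOn_const hU.measurableSet
    have : U ∩ γ ⁻¹' s = U ∩ (U.piecewise γ fun _ => 0) ⁻¹' s := by
      ext x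
      simp only [mem_inter_iff, mem_preimage, and_congr_right_iff]
      intro hx
      rw [piecewise_eq_of_mem _ _ _ hx]
    rw [this]
    exact hU.measurableSet.inter (hg hs)
  rw [Measure.restrict_apply hs, Measure.map_apply_of_aemeasurable hae hs,
    inter_comm, ← image_inter_preimage,
    hausdorffMeasure_image_eq_lintegral hU hγ hexp hJ hinj hm inter_subset_left,
    withDensity_apply', Measure.restrict_restrict' hU.measurableSet, inter_comm]

end Area

end

section

variable {n m : ℕ}

/-! ### Graphs over coordinate hyperplanes -/

/-- The inclusion of `ℝ^k` in `ℝ^(k+1)` as the hyperplane `x_κ = 0`. -/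
def hyperplaneIncl {k : ℕ} (κ : Fin (k + 1)) : E k →L[ℝ] E (k + 1) :=
  LinearMap.toContinuousLinearMap
    { toFun := fun a => WithLp.toLp 2 (κ.insertNth (α := fun _ => ℝ) 0 a)
      map_add' := fun a b => by
        ext i
        refine Fin.succAboveCases κ ?_ (fun j => ?_) i <;> simp
      map_smul' := fun c a => by
        ext i
        refine Fin.succAboveCases κ ?_ (fun j => ?_) i <;> simp }

@[simp] theorem hyperplaneIncl_same {k : ℕ} (κ : Fin (k + 1)) (a : E k) :
    hyperplaneIncl κ a κ = 0 := by
  simp [hyperplaneIncl]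

@[simp] theorem hyperplaneIncl_succAbove {k : ℕ} (κ : Fin (k + 1)) (a : E k) (j : Fin k) :
    hyperplaneIncl κ a (κ.succAbove j) = a j := by
  simp [hyperplaneIncl]

theorem inner_hyperplaneIncl {k : ℕ} (κ : Fin (k + 1)) (a b : E k) :
    inner ℝ (hyperplaneIncl κ a) (hyperplaneIncl κ b) = inner ℝ a b := by
  simp [PiLp.inner_apply, Fin.sum_univ_succAbove _ κ]

theorem hyperplaneIncl_single {k : ℕ} (κ : Fin (k + 1)) (j : Fin k) :
    hyperplaneIncl κ (EuclideanSpace.single j 1) = EuclideanSpace.single (κ.succAbove j) 1 := by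
  ext i
  refine Fin.succAboveCases κ ?_ (fun l => ?_) i
  · simp
  · simp

/-- The point of the graph of `w` over the hyperplane `x_κ = 0`. -/
def graphPt {k : ℕ} (κ : Fin (k + 1)) (w : E k → ℝ) (a : E k) : E (k + 1) :=
  hyperplaneIncl κ a + w a • EuclideanSpace.single κ 1

/-- The derivative of `graphPt`. -/
def graphDeriv {k : ℕ} (κ : Fin (k + 1)) (w : E k → ℝ) (a : E k) : E k →L[ℝ] E (k + 1) :=
  hyperplaneIncl κ + (fderiv ℝ w a).smulRight (EuclideanSpace.single κ 1)

theorem inner_graphDeriv {k : ℕ} (κ : Fin (k + 1)) (w : E k → ℝ) (a u v : E k) :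
    inner ℝ (graphDeriv κ w a u) (graphDeriv κ w a v) =
      inner ℝ u v + fderiv ℝ w a u * fderiv ℝ w a v := by
  have h : ∀ u : E k, inner ℝ (hyperplaneIncl κ u) (EuclideanSpace.single κ (1 : ℝ)) = 0 := fun u => by
    simp [EuclideanSpace.inner_single_right]
  have h' : ∀ u : E k, inner ℝ (EuclideanSpace.single κ (1 : ℝ)) (hyperplaneIncl κ u) = 0 := fun u => by
    rw [real_inner_comm, h]
  simp only [graphDeriv, _root_.add_apply, ContinuousLinearMap.smulRight_apply,
    inner_add_left, inner_add_right, inner_hyperplaneIncl, real_inner_smul_left,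
    real_inner_smul_right, h, h']
  simp [mul_comm]

/-- The Gram matrix of the graph map is 1 + Dw Dwᵀ, and the matrix determinant lemma gives its
determinant 1 + |Dw|². -/
theorem normDet_graphDeriv {k : ℕ} (κ : Fin (k + 1)) (w : E k → ℝ) (a : E k) :
    (graphDeriv κ w a : E k →ₗ[ℝ] E (k + 1)).normDet = √(1 + ∑ j, pd j w a ^ 2) := by
  have h := (graphDeriv κ w a : E k →ₗ[ℝ] E (k + 1)).normDet_sq_eq_det_gram
    (EuclideanSpace.basisFun (Fin k) ℝ)
  have e : Matrix.gram ℝ (fun i => (graphDeriv κ w a : E k →ₗ[ℝ] E (k + 1))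
      (EuclideanSpace.basisFun (Fin k) ℝ i)) =
      1 + Matrix.replicateCol Unit (fun j => pd j w a) * Matrix.replicateRow Unit (fun j => pd j w a) := by
    ext i j
    rw [Matrix.gram_apply]
    change inner ℝ (graphDeriv κ w a _) (graphDeriv κ w a _) = _
    rw [inner_graphDeriv]
    simp [Matrix.mul_apply, Matrix.one_apply, EuclideanSpace.basisFun_apply, pd,
      EuclideanSpace.inner_single_right, eq_comm]
  rw [e, Matrix.det_one_add_replicateCol_mul_replicateRow] at h
  rw [← Real.sqrt_sq (LinearMap.normDet_nonneg _)]
  congr 1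
  simpa [dotProduct, sq] using h

/-- The area of a graph over a coordinate hyperplane. -/
theorem hausdorffMeasure_restrict_graph {k : ℕ} (κ : Fin (k + 1)) {w : E k → ℝ} {U : Set (E k)}
    (hU : IsOpen U) (hw : ContDiffOn ℝ 1 w U) :
    (Measure.euclideanHausdorffMeasure k).restrict (graphPt κ w '' U) =
      Measure.map (graphPt κ w) ((volume.restrict U).withDensity
        fun a => ENNReal.ofReal √(1 + ∑ j, pd j w a ^ 2)) := by
  have hsd : ∀ a ∈ U, HasStrictFDerivAt (graphPt κ w) (graphDeriv κ w a) a := fun a ha => by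
    have h1 := (hw.contDiffAt (hU.mem_nhds ha)).hasStrictFDerivAt one_ne_zero
    exact (hyperplaneIncl κ).hasStrictFDerivAt.add (h1.smul_const _)
  have hexp : ∀ a ∈ U, ∀ v, ‖v‖ ≤ ‖graphDeriv κ w a v‖ := fun a _ v => by
    refine le_of_sq_le_sq ?_ (norm_nonneg _)
    rw [← real_inner_self_eq_norm_sq, ← real_inner_self_eq_norm_sq, inner_graphDeriv]
    nlinarith [mul_self_nonneg (fderiv ℝ w a v)]
  have hJ : ContinuousOn (fun a => (graphDeriv κ w a : E k →ₗ[ℝ] E (k + 1)).normDet) U := by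
    simp only [normDet_graphDeriv]
    refine (continuousOn_const.add (continuousOn_finsetSum _ fun j _ => ?_)).sqrt
    exact (contDiffOn_pd (N := 0) (by norm_num) hU hw j).continuousOn.pow 2
  have hinj : InjOn (graphPt κ w) U := fun a _ b _ h => by
    ext j
    have := congrArg (fun v : E (k + 1) => v (κ.succAbove j)) h
    simpa [graphPt] using this
  have := hausdorffMeasure_restrict_image hU hsd hexp hJ hinj
  rw [finrank_euclideanSpace_fin] at this
  simpa only [normDet_graphDeriv] using this

end

section

variable {n m : ℕ}

/-! ### Level sets of submersions -/

section Submersion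

variable {V W : Type*} [NormedAddCommGroup V] [NormedSpace ℝ V] [CompleteSpace V]
  [NormedAddCommGroup W] [NormedSpace ℝ W] [FiniteDimensional ℝ W]

/-- The implicit function theorem presents the level set near `a` as the image of a small ball of
ker Θ', and a ball is connected. -/
theorem exists_preconnected_level {Θ : V → W} {Θ' : V →L[ℝ] W} {a : V}
    (hΘ : HasStrictFDerivAt Θ Θ' a) (hsurj : Θ'.range = ⊤) {N : Set V} (hN : N ∈ 𝓝 a) :
    ∃ S ⊆ N ∩ {x | Θ x = Θ a}, IsPreconnected S ∧ a ∈ S ∧ ∀ᶠ x in 𝓝 a, Θ x = Θ a → x ∈ S := by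
  have : CompleteSpace W := FiniteDimensional.complete ℝ W
  set e := hΘ.implicitToOpenPartialHomeomorph Θ Θ' hsurj with he
  have hea : e a = (Θ a, 0) := hΘ.implicitToOpenPartialHomeomorph_self hsurj
  have hsrc : a ∈ e.source := hΘ.mem_implicitToOpenPartialHomeomorph_source hsurj
  have htgt : (Θ a, (0 : Θ'.ker)) ∈ e.target := hΘ.mem_implicitToOpenPartialHomeomorph_target hsurj
  have hsa : e.symm (Θ a, 0) = a := by rw [← hea, e.left_inv hsrc]
  have h1 : ∀ᶠ q in 𝓝 (Θ a, (0 : Θ'.ker)), q ∈ e.target ∧ e.symm q ∈ N :=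
    Filter.Eventually.and (e.open_target.mem_nhds htgt)
      ((e.continuousAt_symm htgt).eventually (by rw [hsa]; exact hN))
  have h2 : ∀ᶠ k in 𝓝 (0 : Θ'.ker), (Θ a, k) ∈ e.target ∧ e.symm (Θ a, k) ∈ N :=
    (Continuous.tendsto' (f := fun k : Θ'.ker => (Θ a, k)) (by fun_prop) 0 _ rfl).eventually h1
  obtain ⟨r, hr, hball⟩ := Metric.eventually_nhds_iff_ball.1 h2
  refine ⟨(fun k : Θ'.ker => e.symm (Θ a, k)) '' Metric.ball 0 r, ?_, ?_, ?_, ?_⟩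
  · rintro _ ⟨k, hk, rfl⟩
    refine ⟨(hball k hk).2, ?_⟩
    have := e.right_inv (hball k hk).1
    exact congrArg Prod.fst this
  · refine (convex_ball (0 : Θ'.ker) r).isPreconnected.image _ ?_
    exact e.continuousOn_symm.comp (by fun_prop) fun k hk => (hball k hk).1
  · exact ⟨0, Metric.mem_ball_self hr, hsa⟩
  · have h3 : ∀ᶠ x in 𝓝 a, (e x).2 ∈ Metric.ball (0 : Θ'.ker) r := by
      refine (continuous_snd.continuousAt.comp (e.continuousAt hsrc)).eventually ?_
      simp only [Function.comp, hea]
      exact Metric.ball_mem_nhds _ hr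
    filter_upwards [h3, e.open_source.mem_nhds hsrc] with x hx hxs hΘx
    refine ⟨(e x).2, hx, ?_⟩
    have : (Θ a, (e x).2) = e x := Prod.ext hΘx.symm rfl
    simp only [this, e.left_inv hxs]

/-- The implicit function parametrizes the level set and has the inclusion of ker Θ' as derivative
at 0. As L is constant along it, its derivative along it vanishes. -/
theorem ker_le_ker_of_const_on_level {Y : Type*} [NormedAddCommGroup Y] [NormedSpace ℝ Y]
    {Θ : V → W} {Θ' : V →L[ℝ] W} {a : V}
    (hΘ : HasStrictFDerivAt Θ Θ' a) (hsurj : Θ'.range = ⊤) {L : V →L[ℝ] Y} {c : Y}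
    (hL : ∀ᶠ x in 𝓝 a, Θ x = Θ a → L x = c) {v : V} (hv : Θ' v = 0) : L v = 0 := by
  have : CompleteSpace W := FiniteDimensional.complete ℝ W
  set g := hΘ.implicitFunction Θ Θ' hsurj (Θ a) with hg
  have hgd : HasStrictFDerivAt g Θ'.ker.subtypeL 0 := hΘ.to_implicitFunction hsurj
  have hg0 : g 0 = a := hΘ.implicitFunction_apply_image hsurj
  have h1 : ∀ᶠ k in 𝓝 (0 : Θ'.ker), Θ (g k) = Θ a :=
    (Continuous.tendsto' (f := fun k : Θ'.ker => (Θ a, k)) (by fun_prop) 0 _ rfl).eventually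
      (hΘ.map_implicitFunction_eq hsurj)
  have h2 : ∀ᶠ k in 𝓝 (0 : Θ'.ker), L (g k) = c := by
    have := hgd.continuousAt
    rw [ContinuousAt, hg0] at this
    filter_upwards [this.eventually hL, h1] with k hk h using hk h
  have h3 : HasFDerivAt (fun k => L (g k)) (L.comp Θ'.ker.subtypeL) 0 :=
    L.hasFDerivAt.comp 0 hgd.hasFDerivAt
  have h4 : HasFDerivAt (fun k => L (g k)) (0 : Θ'.ker →L[ℝ] Y) 0 :=
    (hasFDerivAt_const c _).congr_of_eventuallyEq h2
  have := congrArg (fun T : Θ'.ker →L[ℝ] Y => T ⟨v, hv⟩) (h3.unique h4)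
  simpa using this

end Submersion

/-! ### Boundary charts -/

/-- The map replacing the coordinate `z_κ` by `φ z`. -/
def chartMap (κ : Fin n) (φ : E n → ℝ) (z : E n) : E n :=
  z + (φ z - z κ) • EuclideanSpace.single κ 1

theorem chartMap_same (κ : Fin n) (φ : E n → ℝ) (z : E n) : chartMap κ φ z κ = φ z := by
  simp [chartMap]

theorem chartMap_ne {κ i : Fin n} (h : i ≠ κ) (φ : E n → ℝ) (z : E n) : chartMap κ φ z i = z i := by
  simp [chartMap, h]

/-- A chart `z ↦ (chartMap κ φ z, y z)` of the closed graph of `f` near a boundary point, on a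
half-ball. -/
structure IsBoundaryChart (Ω : Set (E n)) (f : E n → E m) (κ : Fin n) (φ : E n → ℝ) (y : E n → E m)
    (H : E n → ℝ) (z₀ : E n) (r R : ℝ) (x₀ : E n) : Prop where
  r_pos : 0 < r
  r_lt : r < R
  base : z₀ κ = 0
  map_base : chartMap κ φ z₀ = x₀
  contDiffOn_φ : ContDiffOn ℝ 2 φ (Metric.ball z₀ R)
  contDiffOn_y : ContDiffOn ℝ 2 y (Metric.ball z₀ R)
  graph : ∀ z ∈ Metric.ball z₀ R, 0 ≤ z κ → f (chartMap κ φ z) = y z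
  bdry : ∀ z ∈ Metric.ball z₀ R, z κ = 0 → chartMap κ φ z ∈ frontier Ω
  ext : ∀ z ∈ Metric.ball z₀ R, 0 < z κ → chartMap κ φ z ∈ (closure Ω)ᶜ
  φ_ne : ∀ z ∈ Metric.ball z₀ R, 0 < z κ → pd κ φ z ≠ 0
  -- This and the next two conditions express tangency to the cylinder: along z_κ = 0 the derivative
  -- of (chart, y) in the direction z_κ is vertical and nonzero, while y is constant in the other
  -- directions. By `φ_ne` the chart is nonsingular on the open side.
  φ_bdry : ∀ z ∈ Metric.ball z₀ R, z κ = 0 → pd κ φ z = 0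
  y_bdry : ∀ z ∈ Metric.ball z₀ R, z κ = 0 → ∀ p, p ≠ κ → ∀ α, pd p (fun w => y w α) z = 0
  y_ne : ∀ z ∈ Metric.ball z₀ R, z κ = 0 → ∃ α, pd κ (fun w => y w α) z ≠ 0
  surj : ∀ᶠ x in 𝓝 x₀, x ∈ Ωᶜ → ∃ z ∈ Metric.ball z₀ r, 0 ≤ z κ ∧ chartMap κ φ z = x
  -- H inverts the chart in the coordinate z_κ. It is C¹ outside closure Ω, so cutoffs in z_κ can be
  -- transported to x there.
  height : ∀ z ∈ Metric.ball z₀ R, 0 ≤ z κ → H (chartMap κ φ z) = z κ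
  contDiffAt_height : ∀ z ∈ Metric.ball z₀ R, 0 < z κ → ContDiffAt ℝ 1 H (chartMap κ φ z)
  continuousWithinAt_height : ∀ᶠ x in 𝓝 x₀, x ∈ Ωᶜ → ContinuousWithinAt H Ωᶜ x

theorem mem_frontier_iff {Ω : Set (E n)} (hΩ : IsOpen Ω) {x : E n} :
    x ∈ frontier Ω ↔ x ∈ closure Ω ∧ x ∉ Ω := by
  rw [hΩ.frontier_eq, Set.mem_sdiff]

/-- The value of f and the line ℓ are only constant on components of ∂Ω. The boundary of the graph
is locally a level set of a submersion, hence its points near (x₀, f x₀) lie on a connected piece,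
whose projection stays in the component of x₀. -/
theorem eventually_mem_connectedComponentIn {Ω : Set (E n)} {f : E n → E m} {x₀ : E n}
    (hx₀ : x₀ ∈ frontier Ω) {Θ : E n × E m → E m × ℝ} {Θ' : E n × E m →L[ℝ] E m × ℝ}
    (hΘ : HasStrictFDerivAt Θ Θ' (x₀, f x₀)) (hsurj : Θ'.range = ⊤)
    (hB : ∀ᶠ w in 𝓝 (x₀, f x₀), w ∈ graphOver f (frontier Ω) ↔ Θ w = 0) :
    ∀ᶠ w in 𝓝 (x₀, f x₀), w ∈ graphOver f (frontier Ω) →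
      w.1 ∈ connectedComponentIn (frontier Ω) x₀ := by
  have h0 : Θ (x₀, f x₀) = 0 := hB.self_of_nhds.1 ⟨hx₀, rfl⟩
  obtain ⟨S, hS, hSc, hSa, hev⟩ := exists_preconnected_level hΘ hsurj hB
  rw [h0] at hS hev
  have hsub : Prod.fst '' S ⊆ connectedComponentIn (frontier Ω) x₀ := by
    refine (hSc.image _ continuous_fst.continuousOn).subset_connectedComponentIn
      ⟨_, hSa, rfl⟩ ?_
    rintro _ ⟨w, hw, rfl⟩
    exact ((hS hw).1.2 (hS hw).2).1
  filter_upwards [hB, hev] with w h1 h2 hw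
  exact hsub ⟨w, h2 (h1.1 hw), rfl⟩

/-- A direction of a line contained in the cylinder is annihilated by defining functions of the
closed graph. -/
theorem fderiv_vertical_eq_zero {Ω : Set (E n)} {f : E n → E m} {C : Set (E n)} {c e : E m}
    {x : E n} (hx : x ∈ C) (hfx : f x = c)
    (htan : tangentSpaceAt (graphOver f Ωᶜ) (x, f x) = tangentSpaceAt (cylinder C c e) (x, f x))
    {F : E n × E m → E m} (hF : DifferentiableAt ℝ F (x, f x))
    (hN : ∀ᶠ w in 𝓝 (x, f x), w ∈ graphOver f Ωᶜ → F w = 0) (hz : F (x, f x) = 0) :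
    fderiv ℝ F (x, f x) (0, e) = 0 := by
  -- The cylinder contains the vertical segment from (x, c) to (x, c + e), so (0, e) is a tangent
  -- direction.
  have h1 : ((0 : E n), e) ∈ tangentSpaceAt (cylinder C c e) (x, f x) := by
    refine Submodule.subset_span ?_
    have : ((0 : E n), e) = (x, c + e) - (x, f x) := by simp [hfx]
    rw [this]
    refine mem_tangentConeAt_of_segment_subset fun w hw => ?_
    obtain ⟨t, -, rfl⟩ := (segment_eq_image' ℝ (x, f x) (x, c + e)) ▸ hw
    refine ⟨by simpa using hx, t, ?_⟩
    simp [hfx]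
  rw [← htan] at h1
  -- F vanishes on the closed graph, so 0 is also a derivative of F within it, and dF vanishes on
  -- every tangent direction.
  have h2 : tangentSpaceAt (graphOver f Ωᶜ) (x, f x) ≤ LinearMap.ker (fderiv ℝ F (x, f x)).toLinearMap := by
    refine Submodule.span_le.2 fun v hv => ?_
    have d1 : HasFDerivWithinAt F (fderiv ℝ F (x, f x)) (graphOver f Ωᶜ) (x, f x) :=
      hF.hasFDerivAt.hasFDerivWithinAt
    have d2 : HasFDerivWithinAt F (0 : E n × E m →L[ℝ] E m) (graphOver f Ωᶜ) (x, f x) :=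
      (hasFDerivWithinAt_const (0 : E m) _ _).congr_of_eventuallyEq
        (eventually_nhdsWithin_iff.2 hN) hz
    simpa using d1.unique_on d2 hv
  exact h2 h1

end

/-! ### Construction of boundary charts -/

section

variable {n m : ℕ}

set_option maxHeartbeats 1600000 in
-- The defining functions F, h of the closed graph, together with all base coordinates but x_κ, form
-- a local diffeomorphism G. Its inverse on {F = 0} parametrizes the graph by z, with z_κ = h and
-- the other coordinates of z equal to those of x. The chart is the projection of this
-- parametrization to ℝ^n.
theorem exists_boundaryChart {Ω : Set (E n)} (hΩ : IsOpen Ω) {f : E n → E m}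
    (hcont : ContinuousOn f Ωᶜ)
    (hconst : ∀ x ∈ frontier Ω, ∀ y ∈ connectedComponentIn (frontier Ω) x, f y = f x)
    (hf : ContDiffOn ℝ 2 f (closure Ω)ᶜ) {x₀ : E n} (hx₀ : x₀ ∈ frontier Ω)
    (hext : IsC2BoundaryPoint (graphOver f Ωᶜ) (graphOver f (frontier Ω)) (x₀, f x₀))
    (htan : ∃ e : E m, e ≠ 0 ∧ ∀ x ∈ connectedComponentIn (frontier Ω) x₀,
      tangentSpaceAt (graphOver f Ωᶜ) (x, f x) =
        tangentSpaceAt (cylinder (connectedComponentIn (frontier Ω) x₀) (f x₀) e) (x, f x)) :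
    ∃ κ φ y H z₀ r R, IsBoundaryChart Ω f κ φ y H z₀ r R x₀ := by
  obtain ⟨F, h, hF, hh, hsurj, hmem⟩ := hext
  obtain ⟨e, he0, htan⟩ := htan
  set w₀ : E n × E m := (x₀, f x₀) with hw₀
  have hΩx : x₀ ∈ Ωᶜ := ((mem_frontier_iff hΩ).1 hx₀).2
  have hw₀B : w₀ ∈ graphOver f (frontier Ω) := ⟨hx₀, rfl⟩
  have hFh₀ : F w₀ = 0 ∧ h w₀ = 0 := hmem.self_of_nhds.2.1 hw₀B
  have hFd := hF.differentiableAt two_ne_zero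
  have hhd := hh.differentiableAt two_ne_zero
  -- the boundary is locally connected, and tangent vectors to it are horizontal
  have hΘ : HasStrictFDerivAt (fun w => (F w, h w)) (fderiv ℝ (fun w => (F w, h w)) w₀) w₀ :=
    (hF.prodMk hh).hasStrictFDerivAt two_ne_zero
  have hΘ' : fderiv ℝ (fun w => (F w, h w)) w₀ = (fderiv ℝ F w₀).prod (fderiv ℝ h w₀) :=
    (hFd.hasFDerivAt.prodMk hhd.hasFDerivAt).fderiv
  have hrange : (fderiv ℝ (fun w => (F w, h w)) w₀).range = ⊤ := LinearMap.range_eq_top.2 hsurj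
  have hcomp := eventually_mem_connectedComponentIn hx₀ hΘ hrange
    (hmem.mono fun w hw => by simpa using hw.2)
  have hhor : ∀ v : E n × E m, fderiv ℝ F w₀ v = 0 → fderiv ℝ h w₀ v = 0 → v.2 = 0 := by
    intro v hv1 hv2
    refine ker_le_ker_of_const_on_level (L := ContinuousLinearMap.snd ℝ (E n) (E m)) (c := f x₀)
      hΘ hrange ?_ (v := v) ?_
    · filter_upwards [hmem, hcomp] with w h1 h2 h3
      have hw : w ∈ graphOver f (frontier Ω) := h1.2.2 (by simpa [hFh₀] using h3)
      change w.2 = f x₀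
      rw [hw.2, hconst x₀ hx₀ _ (h2 hw)]
    · rw [hΘ']
      exact Prod.ext hv1 hv2
  -- a coordinate transverse to the boundary
  obtain ⟨κ, hκ⟩ : ∃ κ : Fin n, ¬(fderiv ℝ F w₀ (EuclideanSpace.single κ 1, 0) = 0 ∧
      fderiv ℝ h w₀ (EuclideanSpace.single κ 1, 0) = 0) := by
    by_contra! hall
    have h0 : ∀ x : E n, fderiv ℝ (fun w => (F w, h w)) w₀ (x, 0) = 0 := by
      intro x
      have : ((fderiv ℝ (fun w => (F w, h w)) w₀).comp (ContinuousLinearMap.inl ℝ (E n) (E m))) = 0 := by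
        refine ContinuousLinearMap.coe_injective
          ((EuclideanSpace.basisFun (Fin n) ℝ).toBasis.ext fun i => ?_)
        simp [hΘ', hall i]
      exact congrArg (fun T : E n →L[ℝ] E m × ℝ => T x) this
    have hs2 : Function.Surjective ((fderiv ℝ (fun w => (F w, h w)) w₀).comp
        (ContinuousLinearMap.inr ℝ (E n) (E m))).toLinearMap := by
      intro q
      obtain ⟨⟨v1, v2⟩, hv⟩ := hsurj q
      refine ⟨v2, ?_⟩
      have : ((v1, v2) : E n × E m) = (v1, 0) + (0, v2) := by simp
      rw [this, map_add, h0, zero_add] at hv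
      exact hv
    have := LinearMap.finrank_le_finrank_of_surjective hs2
    simp at this
  -- the local diffeomorphism straightening the graph
  set G : E n × E m → E m × E n := fun w =>
    (F w, w.1 + (h w - w.1 κ) • EuclideanSpace.single κ 1) with hG
  have hGc : ∀ {w}, ContDiffAt ℝ 2 F w → ContDiffAt ℝ 2 h w → ContDiffAt ℝ 2 G w := by
    intro w h1 h2
    have h3 : ContDiffAt ℝ 2 (fun w : E n × E m => w.1 κ) w :=
      (contDiffAt_euclidean.1 contDiffAt_fst) κ
    exact h1.prodMk (contDiffAt_fst.add ((h2.sub h3).smul contDiffAt_const))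
  have hGd := (hGc hF hh).differentiableAt two_ne_zero
  have hGv : ∀ v, fderiv ℝ G w₀ v = (fderiv ℝ F w₀ v,
      v.1 + (fderiv ℝ h w₀ v - v.1 κ) • EuclideanSpace.single κ 1) := by
    intro v
    have h3 : HasFDerivAt (fun w : E n × E m => w.1 κ)
        ((EuclideanSpace.proj κ).comp (ContinuousLinearMap.fst ℝ (E n) (E m))) w₀ :=
      ((EuclideanSpace.proj κ).comp (ContinuousLinearMap.fst ℝ (E n) (E m))).hasFDerivAt
    have h4 := hFd.hasFDerivAt.prodMk (hasFDerivAt_fst.add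
      ((hhd.hasFDerivAt.sub h3).smul_const (EuclideanSpace.single κ (1 : ℝ))))
    have h5 : HasFDerivAt G _ w₀ := h4
    rw [h5.fderiv]
    simp
  -- A kernel vector of dG is killed by dF and dh, hence horizontal by `hhor`, and its base part is
  -- a multiple of e_κ. The choice of κ forces the multiple to vanish.
  have hinj : Function.Injective (fderiv ℝ G w₀) := by
    refine (injective_iff_map_eq_zero _).2 fun v hv => ?_
    rw [hGv] at hv
    obtain ⟨hv1, hv2⟩ := Prod.mk.inj hv
    have hvκ : fderiv ℝ h w₀ v = 0 := by
      have := congrArg (fun u : E n => u κ) hv2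
      simpa using this
    have hvi : ∀ i, i ≠ κ → v.1 i = 0 := fun i hi => by
      have := congrArg (fun u : E n => u i) hv2
      simpa [hi] using this
    have hv2' := hhor v hv1 hvκ
    have hv1' : v.1 = v.1 κ • EuclideanSpace.single κ 1 := by
      ext i
      by_cases hi : i = κ
      · subst hi; simp
      · simp [hvi i hi, hi]
    have hv' : v = v.1 κ • ((EuclideanSpace.single κ 1, 0) : E n × E m) := by
      refine Prod.ext ?_ ?_
      · simpa using hv1'
      · simpa using hv2'
    by_cases hc : v.1 κ = 0
    · rw [hv', hc, zero_smul]
    · refine absurd ⟨?_, ?_⟩ hκ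
      · rw [hv', map_smul] at hv1
        exact (smul_eq_zero.1 hv1).resolve_left hc
      · rw [hv', map_smul] at hvκ
        exact (smul_eq_zero.1 hvκ).resolve_left hc
  set G' : (E n × E m) ≃L[ℝ] (E m × E n) := (LinearEquiv.ofInjectiveOfFinrankEq
    (fderiv ℝ G w₀).toLinearMap hinj (by simp [add_comm])).toContinuousLinearEquiv with hG'
  have hGs : HasFDerivAt G (G' : (E n × E m) →L[ℝ] (E m × E n)) w₀ := by
    have : (G' : (E n × E m) →L[ℝ] (E m × E n)) = fderiv ℝ G w₀ :=
      ContinuousLinearMap.ext fun v => rfl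
    rw [this]
    exact hGd.hasFDerivAt
  -- Boundary points have height h = 0, so the base point of the chart is x₀ with its κ-th
  -- coordinate replaced by 0.
  set z₀ : E n := x₀ + (0 - x₀ κ) • EuclideanSpace.single κ 1 with hz₀
  have hGw₀ : G w₀ = (0, z₀) := by
    have : G w₀ = (F w₀, x₀ + (h w₀ - x₀ κ) • EuclideanSpace.single κ 1) := rfl
    rw [this, hFh₀.1, hFh₀.2]
  set ψ : E m × E n → E n × E m := (hGc hF hh).localInverse hGs two_ne_zero with hψ
  have hψc : ContDiffAt ℝ 2 ψ (0, z₀) := by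
    rw [← hGw₀]; exact (hGc hF hh).to_localInverse hGs two_ne_zero
  have hψ0 : ψ (0, z₀) = w₀ := by
    rw [← hGw₀]; exact (hGc hF hh).localInverse_apply_image hGs two_ne_zero
  have hleft : ∀ᶠ w in 𝓝 w₀, ψ (G w) = w :=
    ((hGc hF hh).hasStrictFDerivAt' hGs two_ne_zero).eventually_left_inverse
  have hright : ∀ᶠ q in 𝓝 (0, z₀), G (ψ q) = q := by
    rw [← hGw₀]
    exact ((hGc hF hh).hasStrictFDerivAt' hGs two_ne_zero).eventually_right_inverse
  have hemb : ∀ {P : E m × E n → Prop}, (∀ᶠ q in 𝓝 ((0 : E m), z₀), P q) →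
      ∀ᶠ z in 𝓝 z₀, P (0, z) := fun hP =>
    (Continuous.tendsto' (f := fun z : E n => ((0 : E m), z)) (by fun_prop) z₀ _ rfl).eventually hP
  have hψt : Tendsto ψ (𝓝 (0, z₀)) (𝓝 w₀) := by
    have := hψc.continuousAt
    rwa [ContinuousAt, hψ0] at this
  have hgood := hemb ((hψc.eventually (by simp)).and (hright.and (hψt.eventually
    ((hF.eventually (by simp)).and ((hh.eventually (by simp)).and
      (hmem.eventually_nhds.and (hcomp.and hleft.eventually_nhds)))))))
  obtain ⟨R, hR, hball⟩ := Metric.eventually_nhds_iff_ball.1 hgood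
  set P : E n → E n × E m := fun z => ψ (0, z) with hP
  set φ : E n → ℝ := fun z => (P z).1 κ with hφ
  have hGP : ∀ z ∈ Metric.ball z₀ R, G (P z) = (0, z) := fun z hz => (hball z hz).2.1
  have hFP : ∀ z ∈ Metric.ball z₀ R, F (P z) = 0 := fun z hz => (Prod.mk.inj (hGP z hz)).1
  have hzP : ∀ z ∈ Metric.ball z₀ R,
      (P z).1 + (h (P z) - (P z).1 κ) • EuclideanSpace.single κ 1 = z :=
    fun z hz => (Prod.mk.inj (hGP z hz)).2
  have hhP : ∀ z ∈ Metric.ball z₀ R, h (P z) = z κ := fun z hz => by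
    have := congrArg (fun u : E n => u κ) (hzP z hz)
    simpa using this
  have hP1 : ∀ z ∈ Metric.ball z₀ R, chartMap κ φ z = (P z).1 := fun z hz => by
    have h1 := hzP z hz
    rw [hhP z hz] at h1
    unfold chartMap
    nth_rewrite 1 [← h1]
    rw [add_assoc, ← add_smul]
    simp [hφ]
  have hmemP : ∀ z ∈ Metric.ball z₀ R, ∀ᶠ w in 𝓝 (P z),
      (w ∈ graphOver f Ωᶜ ↔ F w = 0 ∧ 0 ≤ h w) ∧ (w ∈ graphOver f (frontier Ω) ↔ F w = 0 ∧ h w = 0) :=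
    fun z hz => (hball z hz).2.2.2.2.1
  have hNP : ∀ z ∈ Metric.ball z₀ R, 0 ≤ z κ → P z ∈ graphOver f Ωᶜ := fun z hz h0 =>
    (hmemP z hz).self_of_nhds.1.2 ⟨hFP z hz, by rwa [hhP z hz]⟩
  have hBP : ∀ z ∈ Metric.ball z₀ R, z κ = 0 → P z ∈ graphOver f (frontier Ω) := fun z hz h0 =>
    (hmemP z hz).self_of_nhds.2.2 ⟨hFP z hz, by rwa [hhP z hz]⟩
  have hgr : ∀ z ∈ Metric.ball z₀ R, 0 ≤ z κ → P z = (chartMap κ φ z, f (chartMap κ φ z)) :=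
    fun z hz h0 => by
      rw [hP1 z hz, ← (hNP z hz h0).2]
  have hextP : ∀ z ∈ Metric.ball z₀ R, 0 < z κ → chartMap κ φ z ∈ (closure Ω)ᶜ :=
    fun z hz h0 hcl => by
      rw [hP1 z hz] at hcl
      have hN := hNP z hz h0.le
      have hB : P z ∈ graphOver f (frontier Ω) := ⟨(mem_frontier_iff hΩ).2 ⟨hcl, hN.1⟩, hN.2⟩
      have := ((hmemP z hz).self_of_nhds.2.1 hB).2
      rw [hhP z hz] at this
      exact h0.ne' this
  have hPc : ∀ z ∈ Metric.ball z₀ R, ContDiffAt ℝ 2 P z := fun z hz =>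
    ContDiffAt.comp z (hball z hz).1 (contDiffAt_const.prodMk contDiffAt_id)
  have hφc : ∀ z ∈ Metric.ball z₀ R, ContDiffAt ℝ 2 φ z := fun z hz =>
    (contDiffAt_euclidean.1 (hPc z hz).fst) κ
  have hheight : ∀ z ∈ Metric.ball z₀ R, 0 ≤ z κ →
      h (chartMap κ φ z, f (chartMap κ φ z)) = z κ := fun z hz h0 => by
    rw [← hgr z hz h0, hhP z hz]
  have hfconst : ∀ z ∈ Metric.ball z₀ R, z κ = 0 → f (P z).1 = f x₀ ∧
      (P z).1 ∈ connectedComponentIn (frontier Ω) x₀ := fun z hz h0 => by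
    have h1 : (P z).1 ∈ connectedComponentIn (frontier Ω) x₀ :=
      (hball z hz).2.2.2.2.2.1 (hBP z hz h0)
    exact ⟨hconst x₀ hx₀ _ h1, h1⟩
  have hHc : ∀ z ∈ Metric.ball z₀ R, 0 < z κ →
      ContDiffAt ℝ 1 (fun x => h (x, f x)) (chartMap κ φ z) := fun z hz h0 => by
    have h1 : ContDiffAt ℝ 1 f (chartMap κ φ z) := (hf.contDiffAt
      (isClosed_closure.isOpen_compl.mem_nhds (hextP z hz h0))).of_le (by norm_num)
    have h2 : ContDiffAt ℝ 1 h (P z) := (hball z hz).2.2.2.1.of_le (by norm_num)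
    rw [hgr z hz h0.le] at h2
    exact ContDiffAt.comp (f := fun x => (x, f x)) _ h2 (contDiffAt_id.prodMk h1)
  -- the boundary curve in the direction of the line is vertical
  have hvert : ∀ z ∈ Metric.ball z₀ R, z κ = 0 → ∃ ζ : E n, fderiv ℝ P z ζ = (0, e) ∧
      ∀ i, i ≠ κ → ζ i = 0 := fun z hz h0 => by
    have hz' := hball z hz
    have hPz : P z = ((P z).1, f (P z).1) := (hNP z hz h0.ge).2 ▸ rfl
    have hFz : DifferentiableAt ℝ F (P z) := hz'.2.2.1.differentiableAt two_ne_zero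
    have hhz : DifferentiableAt ℝ h (P z) := hz'.2.2.2.1.differentiableAt two_ne_zero
    have hv : fderiv ℝ F (P z) (0, e) = 0 := by
      have h1 := hmemP z hz
      have h2 := hFP z hz
      have h3 := hFz
      rw [hPz] at h1 h2 h3 ⊢
      exact fderiv_vertical_eq_zero (hfconst z hz h0).2 (hfconst z hz h0).1
        (htan _ (hfconst z hz h0).2) h3 (h1.mono fun w hw hN => (hw.1.1 hN).1) h2
    have hGz : HasFDerivAt G (fderiv ℝ G (P z)) (P z) :=
      ((hGc hz'.2.2.1 hz'.2.2.2.1).differentiableAt two_ne_zero).hasFDerivAt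
    have hGv' : fderiv ℝ G (P z) (0, e) =
        (0, (fderiv ℝ h (P z) (0, e)) • EuclideanSpace.single κ 1) := by
      have h3 : HasFDerivAt (fun w : E n × E m => w.1 κ)
          ((EuclideanSpace.proj κ).comp (ContinuousLinearMap.fst ℝ (E n) (E m))) (P z) :=
        ((EuclideanSpace.proj κ).comp (ContinuousLinearMap.fst ℝ (E n) (E m))).hasFDerivAt
      have h4 := hFz.hasFDerivAt.prodMk (hasFDerivAt_fst.add
        ((hhz.hasFDerivAt.sub h3).smul_const
          (EuclideanSpace.single κ (1 : ℝ))))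
      have h5 : HasFDerivAt G _ (P z) := h4
      rw [h5.fderiv]
      simp [hv]
    set c : ℝ := fderiv ℝ h (P z) (0, e)
    have hψz : HasFDerivAt ψ (fderiv ℝ ψ (0, z)) (G (P z)) := by
      rw [hGP z hz]
      exact (hz'.1.differentiableAt two_ne_zero).hasFDerivAt
    -- Since dG sends (0, e) to a multiple of e_κ, the left inverse ψ sends that multiple of e_κ
    -- back to (0, e).
    have hid : (fderiv ℝ ψ (0, z)).comp (fderiv ℝ G (P z)) = ContinuousLinearMap.id ℝ _ := by
      refine (hψz.comp (P z) hGz).unique ((hasFDerivAt_id (P z)).congr_of_eventuallyEq ?_)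
      filter_upwards [hz'.2.2.2.2.2.2] with w hw using hw
    have hPd : HasFDerivAt P ((fderiv ℝ ψ (0, z)).comp (ContinuousLinearMap.inr ℝ (E m) (E n))) z :=
      HasFDerivAt.comp z (f := fun z : E n => ((0 : E m), z))
        (hz'.1.differentiableAt two_ne_zero).hasFDerivAt
        (ContinuousLinearMap.inr ℝ (E m) (E n)).hasFDerivAt
    refine ⟨c • EuclideanSpace.single κ 1, ?_, fun i hi => by simp [hi]⟩
    have := congrArg (fun T : E n × E m →L[ℝ] E n × E m => T (0, e)) hid
    simp only [ContinuousLinearMap.comp_apply, hGv', ContinuousLinearMap.id_apply] at this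
    rw [hPd.fderiv]
    exact this
  have hvert' : ∀ z ∈ Metric.ball z₀ R, z κ = 0 → ∃ c : ℝ, c ≠ 0 ∧
      fderiv ℝ P z (EuclideanSpace.single κ 1) = c • (0, e) := fun z hz h0 => by
    obtain ⟨ζ, h1, h2⟩ := hvert z hz h0
    have h3 : ζ = ζ κ • EuclideanSpace.single κ 1 := by
      ext i
      by_cases hi : i = κ
      · subst hi; simp
      · simp [h2 i hi, hi]
    -- Here the line enters as a genuine line: e ≠ 0 excludes ζ = 0, and therefore ∂_κ P is a finite
    -- nonzero multiple of (0, e).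
    have hc : ζ κ ≠ 0 := fun hc => by
      rw [h3, hc, zero_smul, map_zero] at h1
      exact he0 (Prod.mk.inj h1).2.symm
    refine ⟨(ζ κ)⁻¹, inv_ne_zero hc, ?_⟩
    rw [← h1, h3, map_smul]
    simp [hc]
  have hpdφ : ∀ z ∈ Metric.ball z₀ R, ∀ p, pd p φ z =
      (fderiv ℝ P z (EuclideanSpace.single p 1)).1 κ := fun z hz p => by
    have h1 := ((hPc z hz).differentiableAt two_ne_zero).hasFDerivAt
    have h2 : HasFDerivAt φ (((EuclideanSpace.proj κ).comp
        (ContinuousLinearMap.fst ℝ (E n) (E m))).comp (fderiv ℝ P z)) z :=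
      ((EuclideanSpace.proj κ).comp (ContinuousLinearMap.fst ℝ (E n) (E m))).hasFDerivAt.comp z h1
    rw [pd, h2.fderiv]
    rfl
  have hpdy : ∀ z ∈ Metric.ball z₀ R, ∀ p α, pd p (fun w => (P w).2 α) z =
      (fderiv ℝ P z (EuclideanSpace.single p 1)).2 α := fun z hz p α => by
    have h1 := ((hPc z hz).differentiableAt two_ne_zero).hasFDerivAt
    have h2 : HasFDerivAt (fun w => (P w).2 α) (((EuclideanSpace.proj α).comp
        (ContinuousLinearMap.snd ℝ (E n) (E m))).comp (fderiv ℝ P z)) z :=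
      ((EuclideanSpace.proj α).comp (ContinuousLinearMap.snd ℝ (E n) (E m))).hasFDerivAt.comp z h1
    rw [pd, h2.fderiv]
    rfl
  have hgt : Tendsto (fun x => (x, f x)) (𝓝[Ωᶜ] x₀) (𝓝 w₀) := by
    have : ContinuousWithinAt (fun x => (x, f x)) Ωᶜ x₀ :=
      continuousWithinAt_id.prodMk (hcont x₀ hΩx)
    exact this
  refine ⟨κ, φ, fun z => (P z).2, fun x => h (x, f x), z₀, R / 2, R, by positivity, by linarith,
    by simp [hz₀], ?_, fun z hz => (hφc z hz).contDiffWithinAt,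
    fun z hz => (hPc z hz).snd.contDiffWithinAt, fun z hz h0 => ?_, fun z hz h0 => ?_, hextP, ?_,
    ?_, ?_, ?_, ?_, hheight, hHc, ?_⟩
  · rw [hP1 z₀ (Metric.mem_ball_self hR)]
    exact congrArg Prod.fst hψ0
  · exact (congrArg Prod.snd (hgr z hz h0)).symm
  · rw [hP1 z hz]; exact (hBP z hz h0).1
  -- Differentiating H(chart z) = z_κ in the direction e_κ gives dH(e_κ) · ∂_κ φ = 1, so ∂_κ φ
  -- cannot vanish.
  · intro z hz h0 hp
    have hφz : HasFDerivAt φ (fderiv ℝ φ z) z :=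
      ((hφc z hz).differentiableAt two_ne_zero).hasFDerivAt
    have h1 := ((hHc z hz h0).differentiableAt one_ne_zero).hasFDerivAt.comp z
      ((hasFDerivAt_id z).add ((hφz.sub (EuclideanSpace.proj κ : E n →L[ℝ] ℝ).hasFDerivAt).smul_const
        (EuclideanSpace.single κ (1 : ℝ))))
    have h2 : HasFDerivAt ((fun x => h (x, f x)) ∘ (chartMap κ φ))
        (EuclideanSpace.proj κ : E n →L[ℝ] ℝ) z := by
      refine (EuclideanSpace.proj κ : E n →L[ℝ] ℝ).hasFDerivAt.congr_of_eventuallyEq ?_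
      have h3 : ∀ᶠ w : E n in 𝓝 z, 0 < w κ :=
        ((EuclideanSpace.proj κ : E n →L[ℝ] ℝ).continuous.tendsto z).eventually
          (lt_mem_nhds (by simpa using h0))
      filter_upwards [Metric.isOpen_ball.mem_nhds hz, h3] with w hw h4
      exact hheight w hw h4.le
    have h3 := congrArg (fun T : E n →L[ℝ] ℝ => T (EuclideanSpace.single κ 1)) (h2.unique h1)
    have hp' : fderiv ℝ φ z (EuclideanSpace.single κ 1) = 0 := hp
    simp [hp'] at h3
  · intro z hz h0
    obtain ⟨c, -, hc⟩ := hvert' z hz h0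
    rw [hpdφ z hz, hc]; simp
  · intro z hz h0 p hp α
    have h1 := ((hPc z hz).snd.differentiableAt two_ne_zero)
    have h1' : HasFDerivAt (fun w => (P w).2) _ z := h1.hasFDerivAt
    have hl : HasDerivAt (fun t : ℝ => z + t • EuclideanSpace.single p (1 : ℝ))
        (EuclideanSpace.single p (1 : ℝ)) 0 := by
      simpa using ((hasDerivAt_id (0 : ℝ)).smul_const (EuclideanSpace.single p (1 : ℝ))).const_add z
    have h2 : HasDerivAt (fun t : ℝ => (P (z + t • EuclideanSpace.single p (1 : ℝ))).2)
        (fderiv ℝ (fun w => (P w).2) z (EuclideanSpace.single p 1)) 0 := by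
      refine HasFDerivAt.comp_hasDerivAt (0 : ℝ) (l := fun w => (P w).2)
        (f := fun t : ℝ => z + t • EuclideanSpace.single p (1 : ℝ)) ?_ hl
      simpa using h1'
    have h3 : (fun t : ℝ => (P (z + t • EuclideanSpace.single p (1 : ℝ))).2) =ᶠ[𝓝 0]
        fun _ => f x₀ := by
      have h4 : Tendsto (fun t : ℝ => z + t • EuclideanSpace.single p (1 : ℝ)) (𝓝 0) (𝓝 z) := by
        simpa using hl.continuousAt.tendsto
      filter_upwards [h4.eventually (Metric.isOpen_ball.mem_nhds hz)] with t ht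
      have h5 : (z + t • EuclideanSpace.single p (1 : ℝ)) κ = 0 := by simp [h0, hp.symm]
      rw [(hNP _ ht h5.ge).2, (hfconst _ ht h5).1]
    have h4 := h2.unique ((hasDerivAt_const (0 : ℝ) (f x₀)).congr_of_eventuallyEq h3)
    have h5 : HasFDerivAt (fun w => (P w).2 α) ((EuclideanSpace.proj α).comp
      (fderiv ℝ (fun w => (P w).2) z)) z :=
      (EuclideanSpace.proj α : E m →L[ℝ] ℝ).hasFDerivAt.comp z h1'
    rw [pd, h5.fderiv, ContinuousLinearMap.comp_apply, h4, map_zero]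
  · intro z hz h0
    obtain ⟨c, hc0, hc⟩ := hvert' z hz h0
    by_contra! hall
    refine he0 ?_
    ext α
    have := hall α
    rw [hpdy z hz, hc] at this
    simpa [hc0] using this
  -- A point x outside Ω near x₀ is reached from z = (G (x, f x)).2, whose κ-th coordinate is h (x,
  -- f x) ≥ 0. Continuity of f up to the boundary brings this z into the smaller ball.
  · have hG1 : Tendsto (fun x => (G (x, f x)).2) (𝓝[Ωᶜ] x₀) (𝓝 z₀) := by
      have h1 : Tendsto G (𝓝 w₀) (𝓝 (0, z₀)) := by
        rw [← hGw₀]; exact hGd.continuousAt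
      exact (continuous_snd.tendsto _).comp (h1.comp hgt)
    refine eventually_nhdsWithin_iff.1 ?_
    filter_upwards [hG1.eventually (Metric.ball_mem_nhds z₀ (half_pos hR)), hgt.eventually hmem,
      hgt.eventually hleft, self_mem_nhdsWithin] with x h1 h2 h3 h4
    obtain ⟨h5, h6⟩ := h2.1.1 ⟨h4, rfl⟩
    have h7 : G (x, f x) = (0, (G (x, f x)).2) := Prod.ext h5 rfl
    have h8 : (G (x, f x)).2 κ = h (x, f x) := by simp [hG]
    refine ⟨(G (x, f x)).2, h1, by rwa [h8], ?_⟩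
    rw [hP1 _ (Metric.ball_subset_ball (by linarith) h1)]
    change (ψ (0, (G (x, f x)).2)).1 = x
    rw [← h7, h3]
  · refine eventually_nhdsWithin_iff.1 ?_
    filter_upwards [hgt.eventually (hh.eventually (by simp)), self_mem_nhdsWithin] with x h1 h2
    exact ContinuousAt.comp_continuousWithinAt (f := fun x => (x, f x)) h1.continuousAt
      (continuousWithinAt_id.prodMk (hcont x h2))

end

section

variable {n m : ℕ}

/-! ### The mass field in a boundary chart -/

open Matrix in
/-- The Jacobian matrix of `chartMap κ φ` as a function of the gradient `a` of `φ`. -/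
def chartJac (κ : Fin n) (a : Fin n → ℝ) : Matrix (Fin n) (Fin n) ℝ :=
  1 + vecMulVec (Pi.single κ 1) (a - Pi.single κ 1)

open Matrix in
/-- The metric of the graph in a boundary chart as a function of the gradients of `φ` and `y`. -/
def chartGram (κ : Fin n) (a : Fin n → ℝ) (c : Matrix (Fin m) (Fin n) ℝ) :
    Matrix (Fin n) (Fin n) ℝ :=
  1 - vecMulVec (Pi.single κ 1) (Pi.single κ 1) + vecMulVec a a + cᵀ * c

/-- The second derivatives of `f` in a boundary chart, multiplied by the Jacobian determinant. -/
def chartHess (κ : Fin n) (a : Fin n → ℝ) (b : Matrix (Fin n) (Fin n) ℝ)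
    (c : Matrix (Fin m) (Fin n) ℝ) (d : Fin m → Matrix (Fin n) (Fin n) ℝ) (α : Fin m) :
    Matrix (Fin n) (Fin n) ℝ := a κ • d α - c α κ • b

open Matrix in
/-- The mass field in a boundary chart, multiplied by the Jacobian determinant. -/
def chartField (κ : Fin n) (a : Fin n → ℝ) (b : Matrix (Fin n) (Fin n) ℝ)
    (c : Matrix (Fin m) (Fin n) ℝ) (d : Fin m → Matrix (Fin n) (Fin n) ℝ) : Fin n → ℝ :=
  ∑ α, (((chartGram κ a c)⁻¹ * chartHess κ a b c d α).trace • ((chartGram κ a c)⁻¹ *ᵥ c α)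
    - ((chartGram κ a c)⁻¹ * chartHess κ a b c d α) *ᵥ ((chartGram κ a c)⁻¹ *ᵥ c α))

open Matrix in
theorem det_chartJac (κ : Fin n) (a : Fin n → ℝ) : (chartJac κ a).det = a κ := by
  rw [chartJac, vecMulVec_eq Unit, det_one_add_replicateCol_mul_replicateRow]
  simp

open Matrix in
theorem chartJac_transpose_mul_gJ_mul (κ : Fin n) (a : Fin n → ℝ) (p : Matrix (Fin m) (Fin n) ℝ) :
    (chartJac κ a)ᵀ * gJ p * chartJac κ a = chartGram κ a (p * chartJac κ a) := by
  have h : (chartJac κ a)ᵀ * chartJac κ a =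
      1 - vecMulVec (Pi.single κ 1) (Pi.single κ 1) + vecMulVec a a := by
    have ht : ∀ u v : Fin n → ℝ, (vecMulVec u v)ᵀ = vecMulVec v u := fun u v => by
      ext i j; simp [vecMulVec_apply, mul_comm]
    simp only [chartJac, transpose_add, transpose_one, ht, add_mul, mul_add, one_mul,
      mul_one, vecMulVec_mul_vecMulVec]
    simp only [single_dotProduct, Pi.single_eq_same, mul_one, one_smul, vecMulVec_sub, sub_vecMulVec]
    abel
  rw [chartGram, gJ, mul_add, mul_one, add_mul, h, transpose_mul]
  simp only [Matrix.mul_assoc]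

open Matrix in
-- The quadratic form of the Gram matrix is |v|² - v_κ² + (a·v)² + |c v|². A null vector is thus a
-- multiple of e_κ, killed by a and by c, which a nonzero a_κ or a nonzero entry in column κ of c
-- excludes. On the boundary a_κ = 0, and c takes over.
theorem isUnit_det_chartGram {κ : Fin n} {a : Fin n → ℝ} {c : Matrix (Fin m) (Fin n) ℝ}
    (h : a κ ≠ 0 ∨ ∃ α, c α κ ≠ 0) : IsUnit (chartGram κ a c).det := by
  rw [isUnit_iff_ne_zero]
  intro h0
  obtain ⟨v, hv0, hv⟩ := exists_mulVec_eq_zero_iff.2 h0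
  have h1 : v ⬝ᵥ v - v κ * v κ + (a ⬝ᵥ v) * (a ⬝ᵥ v) + (c *ᵥ v) ⬝ᵥ (c *ᵥ v) = 0 := by
    have : v ⬝ᵥ (chartGram κ a c *ᵥ v) = 0 := by rw [hv, dotProduct_zero]
    rw [← this]
    simp only [chartGram, add_mulVec, sub_mulVec, one_mulVec, dotProduct_add, dotProduct_sub,
      vecMulVec_mulVec, ← mulVec_mulVec]
    rw [dotProduct_mulVec v cᵀ, vecMul_transpose]
    simp [dotProduct_comm]
  have h2 : v ⬝ᵥ v = v κ * v κ + ∑ i ∈ Finset.univ.erase κ, v i * v i := by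
    rw [dotProduct, Finset.add_sum_erase _ (fun i => v i * v i) (Finset.mem_univ κ)]
  have h3 : 0 ≤ ∑ i ∈ Finset.univ.erase κ, v i * v i :=
    Finset.sum_nonneg fun i _ => mul_self_nonneg _
  have h4 : 0 ≤ (c *ᵥ v) ⬝ᵥ (c *ᵥ v) := Finset.sum_nonneg fun i _ => mul_self_nonneg _
  have h5 : ∑ i ∈ Finset.univ.erase κ, v i * v i = 0 := by nlinarith [mul_self_nonneg (a ⬝ᵥ v)]
  have h6 : a ⬝ᵥ v = 0 := by
    have : (a ⬝ᵥ v) * (a ⬝ᵥ v) = 0 := by nlinarith [mul_self_nonneg (a ⬝ᵥ v)]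
    exact mul_self_eq_zero.1 this
  have h7 : c *ᵥ v = 0 := dotProduct_self_eq_zero.1 (by nlinarith [mul_self_nonneg (a ⬝ᵥ v)])
  have h8 : v = v κ • Pi.single κ 1 := by
    ext i
    by_cases hi : i = κ
    · subst hi; simp
    · have := (Finset.sum_eq_zero_iff_of_nonneg fun i _ => mul_self_nonneg (v i)).1 h5 i
        (by simp [hi])
      simp [hi, mul_self_eq_zero.1 this]
  have h9 : v κ ≠ 0 := fun h => hv0 (by rw [h8, h, zero_smul])
  rcases h with h | ⟨α, h⟩
  · rw [h8] at h6
    simp [h, h9] at h6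
  · have := congrFun h7 α
    rw [h8] at this
    simp [Matrix.mulVec_smul, h, h9] at this

open Matrix in
theorem gJ_inv_eq_chart {κ : Fin n} {a : Fin n → ℝ} (ha : a κ ≠ 0) (p : Matrix (Fin m) (Fin n) ℝ) :
    (gJ p)⁻¹ = chartJac κ a * (chartGram κ a (p * chartJac κ a))⁻¹ * (chartJac κ a)ᵀ := by
  have hA : IsUnit (chartJac κ a).det := by rw [det_chartJac]; exact ha.isUnit
  rw [← chartJac_transpose_mul_gJ_mul, Matrix.mul_inv_rev, Matrix.mul_inv_rev]
  have h1 : chartJac κ a * (chartJac κ a)⁻¹ = 1 := mul_nonsing_inv _ hA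
  have h2 : (chartJac κ a)ᵀ⁻¹ * (chartJac κ a)ᵀ = 1 :=
    nonsing_inv_mul _ (by rwa [det_transpose])
  calc (gJ p)⁻¹ = 1 * (gJ p)⁻¹ * 1 := by simp
    _ = (chartJac κ a * (chartJac κ a)⁻¹) * (gJ p)⁻¹ * ((chartJac κ a)ᵀ⁻¹ * (chartJac κ a)ᵀ) := by
        rw [h1, h2]
    _ = _ := by simp only [Matrix.mul_assoc]

open Matrix in
-- Each summand of X is linear in the Hessian of f, and a_κ times the pulled-back Hessian is
-- `chartHess`, free of denominators. The single factor a_κ this costs is the Jacobian determinant,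
-- so the Piola transform of X is expressed through 2-jets of φ and y without dividing by a_κ.
theorem smul_XJ_eq_chartField {κ : Fin n} {a : Fin n → ℝ} (ha : a κ ≠ 0)
    (b : Matrix (Fin n) (Fin n) ℝ) (p : Matrix (Fin m) (Fin n) ℝ)
    (h d : Fin m → Matrix (Fin n) (Fin n) ℝ)
    (hd : ∀ α, d α = (chartJac κ a)ᵀ * h α * chartJac κ a + p α κ • b) :
    a κ • XJ p h = chartJac κ a *ᵥ chartField κ a b (p * chartJac κ a) d := by
  set A := chartJac κ a with hA
  set N := (chartGram κ a (p * A))⁻¹ with hN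
  have hc : ∀ α, (p * A) α = Aᵀ *ᵥ p α := fun α => by
    rw [mulVec_transpose]; rfl
  have hAκ : ∀ α, (p * A) α κ = p α κ * a κ := fun α => by
    have : A *ᵥ (Pi.single κ 1) = Pi.single κ (a κ) := by
      simp only [hA, chartJac, add_mulVec, one_mulVec, vecMulVec_mulVec]
      ext i
      by_cases hi : i = κ
      · subst hi; simp
      · simp [hi]
    have h2 : (p * A) α κ = ((p * A) *ᵥ Pi.single κ 1) α := by simp
    rw [h2, ← mulVec_mulVec, this]
    change p α ⬝ᵥ Pi.single κ (a κ) = _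
    simp
  -- From c_ακ = p_ακ a_κ and d = Aᵀ h A + p_ακ b, the terms with b cancel in a_κ d - c_ακ b.
  have hK : ∀ α, chartHess κ a b (p * A) d α = a κ • (Aᵀ * h α * A) := fun α => by
    rw [chartHess, hd, hAκ, smul_add, smul_smul, mul_comm (a κ)]
    abel
  have hv : ∀ α, vJ p α = A *ᵥ (N *ᵥ (p * A) α) := fun α => by
    rw [vJ, gJ_inv_eq_chart ha, hc]
    simp only [mulVec_mulVec, Matrix.mul_assoc, hN, hA]
  have hS : ∀ α, (N * chartHess κ a b (p * A) d α).trace = a κ * (AJ p h α).trace := fun α => by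
    rw [hK, AJ, gJ_inv_eq_chart ha, Matrix.mul_smul, trace_smul, smul_eq_mul]
    congr 1
    rw [← hA, ← hN]
    rw [← Matrix.mul_assoc, trace_mul_comm]
    simp only [Matrix.mul_assoc]
  rw [XJ, chartField, Finset.smul_sum, mulVec_sum]
  refine Finset.sum_congr rfl fun α _ => ?_
  rw [← hN, hS, mulVec_sub, mulVec_smul, ← hv, smul_sub, smul_smul]
  congr 1
  rw [hK, AJ, gJ_inv_eq_chart ha, hv, ← hA, ← hN, Matrix.mul_smul, smul_mulVec, mulVec_smul]
  simp only [mulVec_mulVec, Matrix.mul_assoc]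

open Matrix in
/-- On the boundary, the mass field in a boundary chart is transverse and its size is given by the
Hessian of the boundary. -/
theorem chartField_boundary {κ : Fin n} {a : Fin n → ℝ} (ha : a κ = 0)
    {b : Matrix (Fin n) (Fin n) ℝ} (hb : ∀ p, p ≠ κ → b p κ = 0)
    {c : Matrix (Fin m) (Fin n) ℝ} (hc : ∀ α p, p ≠ κ → c α p = 0) (hc0 : ∃ α, c α κ ≠ 0)
    (d : Fin m → Matrix (Fin n) (Fin n) ℝ) :
    chartField κ a b c d κ = -(b.trace - b κ κ - (1 + a ⬝ᵥ a)⁻¹ * (a ⬝ᵥ (b *ᵥ a))) := by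
  set e : Fin n → ℝ := Pi.single κ 1 with he
  set lam : ℝ := ∑ α, c α κ * c α κ with hlam
  have hc' : ∀ α, c α = c α κ • e := fun α => by
    ext p
    by_cases hp : p = κ
    · subst hp; simp [he]
    · simp [he, hp, hc α p hp]
  have hlam0 : lam ≠ 0 := by
    obtain ⟨α, hα⟩ := hc0
    intro h
    exact hα (mul_self_eq_zero.1 ((Finset.sum_eq_zero_iff_of_nonneg
      fun α _ => mul_self_nonneg (c α κ)).1 h α (Finset.mem_univ α)))
  have hcc : cᵀ * c = lam • vecMulVec e e := by
    ext p q
    simp only [mul_apply, transpose_apply, Matrix.smul_apply, vecMulVec_apply, smul_eq_mul, hlam,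
      Finset.sum_mul]
    refine Finset.sum_congr rfl fun α _ => ?_
    conv_lhs => rw [hc' α]
    simp
    ring
  have hee : e ⬝ᵥ e = 1 := by simp [he]
  have hea : e ⬝ᵥ a = 0 := by simp [he, ha]
  have hae : a ⬝ᵥ e = 0 := by simp [he, ha]
  have hW : (1 + a ⬝ᵥ a) ≠ 0 := by
    have : 0 ≤ a ⬝ᵥ a := Finset.sum_nonneg fun i _ => mul_self_nonneg _
    positivity
  -- Here a ⊥ e and cᵀc = λ e eᵀ, so the Gram matrix is λ on e, 1 + |a|² on a, and the identity on
  -- the complement; its inverse can be written down.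
  have hinv : (chartGram κ a c)⁻¹ = 1 - vecMulVec e e + lam⁻¹ • vecMulVec e e
      - (1 + a ⬝ᵥ a)⁻¹ • vecMulVec a a := by
    refine inv_eq_right_inv ?_
    rw [chartGram, hcc, ← he]
    simp only [mul_add, mul_sub, add_mul, sub_mul, one_mul, mul_one, Matrix.mul_smul, Matrix.smul_mul,
      vecMulVec_mul_vecMulVec, hee, hea, hae, zero_smul, one_smul, smul_zero, smul_smul,
      vecMulVec_zero, vecMulVec_smul]
    rw [inv_mul_cancel₀ hlam0]
    have : (1 + a ⬝ᵥ a)⁻¹ * (a ⬝ᵥ a) = 1 - (1 + a ⬝ᵥ a)⁻¹ := by field_simp; ring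
    rw [this]
    module
  have hNe : (chartGram κ a c)⁻¹ *ᵥ e = lam⁻¹ • e := by
    rw [hinv]
    simp [sub_mulVec, add_mulVec, smul_mulVec, vecMulVec_mulVec, hee, hae]
  have hbe : b *ᵥ e = b κ κ • e := by
    ext p
    by_cases hp : p = κ
    · subst hp; simp [he]
    · simp [he, hp, hb p hp]
  have htr : ((chartGram κ a c)⁻¹ * b).trace =
      b.trace - b κ κ + lam⁻¹ * b κ κ - (1 + a ⬝ᵥ a)⁻¹ * (a ⬝ᵥ (b *ᵥ a)) := by
    have h1 : ∀ v : Fin n → ℝ, (vecMulVec v v * b).trace = v ⬝ᵥ (b *ᵥ v) := fun v => by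
      rw [vecMulVec_mul, trace_vecMulVec, dotProduct_comm, dotProduct_mulVec]
    rw [hinv]
    simp only [sub_mul, add_mul, one_mul, Matrix.smul_mul, trace_sub, trace_add, trace_smul, h1, hbe,
      smul_eq_mul, dotProduct_smul, hee, mul_one]
  -- The term λ⁻¹ b_κκ of the trace cancels against the shape operator term. What remains carries
  -- the factor c_ακ²/λ, and these add up to 1 over α: the size of the vertical derivative of y
  -- disappears.
  have hterm : ∀ α, ((chartGram κ a c)⁻¹ * chartHess κ a b c d α).trace •
      ((chartGram κ a c)⁻¹ *ᵥ c α)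
      - ((chartGram κ a c)⁻¹ * chartHess κ a b c d α) *ᵥ ((chartGram κ a c)⁻¹ *ᵥ c α) =
      (c α κ * c α κ) • (-(lam⁻¹ * (b.trace - b κ κ - (1 + a ⬝ᵥ a)⁻¹ * (a ⬝ᵥ (b *ᵥ a)))) • e) := by
    intro α
    have hK : chartHess κ a b c d α = -(c α κ) • b := by
      rw [chartHess, ha, zero_smul, zero_sub, neg_smul]
    have hNc : (chartGram κ a c)⁻¹ *ᵥ c α = (c α κ * lam⁻¹) • e := by
      conv_lhs => rw [hc' α]
      rw [mulVec_smul, hNe, smul_smul]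
    rw [hK, Matrix.mul_smul, trace_smul, htr, hNc, smul_mulVec, ← mulVec_mulVec,
      mulVec_smul, hbe, mulVec_smul, mulVec_smul, hNe]
    simp only [smul_smul, ← sub_smul, smul_eq_mul]
    congr 1
    ring
  rw [chartField, Finset.sum_congr rfl fun α _ => hterm α, ← Finset.sum_smul]
  simp only [Pi.smul_apply, smul_eq_mul, he, Pi.single_eq_same, mul_one]
  rw [← hlam]
  field_simp

end

/-! ### Chain rule and continuity of the transformed mass field in a boundary chart -/

section

variable {n m : ℕ}

/-- The gradient of a function as a row of coefficients. -/
def grad (φ : E n → ℝ) (z : E n) : Fin n → ℝ := fun p => pd p φ z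

/-- The Hessian matrix of a function. -/
def hess (φ : E n → ℝ) (z : E n) : Matrix (Fin n) (Fin n) ℝ :=
  Matrix.of fun p q => pd q (pd p φ) z

theorem hasFDerivAt_chartMap (κ : Fin n) {φ : E n → ℝ} {z : E n} (hφ : DifferentiableAt ℝ φ z) :
    HasFDerivAt (chartMap κ φ) (ContinuousLinearMap.id ℝ (E n) +
      (fderiv ℝ φ z - EuclideanSpace.proj κ).smulRight (EuclideanSpace.single κ 1)) z :=
  (hasFDerivAt_id z).add ((hφ.hasFDerivAt.sub
    (EuclideanSpace.proj κ : E n →L[ℝ] ℝ).hasFDerivAt).smul_const (EuclideanSpace.single κ (1 : ℝ)))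

theorem contDiffAt_chartMap (κ : Fin n) {φ : E n → ℝ} {z : E n} {N : WithTop ℕ∞}
    (hφ : ContDiffAt ℝ N φ z) : ContDiffAt ℝ N (chartMap κ φ) z :=
  contDiffAt_id.add ((hφ.sub
    (EuclideanSpace.proj κ : E n →L[ℝ] ℝ).contDiff.contDiffAt).smul contDiffAt_const)

theorem fderiv_chartMap_apply (κ : Fin n) {φ : E n → ℝ} {z : E n} (hφ : DifferentiableAt ℝ φ z)
    (v : Fin n → ℝ) : fderiv ℝ (chartMap κ φ) z (WithLp.toLp 2 v) =
      WithLp.toLp 2 ((chartJac κ (grad φ z)).mulVec v) := by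
  rw [(hasFDerivAt_chartMap κ hφ).fderiv]
  ext i
  simp only [add_apply, ContinuousLinearMap.smulRight_apply,
    sub_apply, fderiv_apply_eq_sum, chartJac, Matrix.add_mulVec,
    Matrix.one_mulVec, Matrix.vecMulVec_mulVec]
  by_cases hi : i = κ
  · subst hi
    simp [grad, dotProduct, mul_comm, mul_sub, Pi.single_apply]
  · simp [hi]

theorem det_fderiv_chartMap (κ : Fin n) {φ : E n → ℝ} {z : E n} (hφ : DifferentiableAt ℝ φ z) :
    (fderiv ℝ (chartMap κ φ) z).det = pd κ φ z := by
  have h : (fderiv ℝ (chartMap κ φ) z : E n →ₗ[ℝ] E n) =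
      Matrix.toLin (EuclideanSpace.basisFun (Fin n) ℝ).toBasis
        (EuclideanSpace.basisFun (Fin n) ℝ).toBasis (chartJac κ (grad φ z)) := by
    refine LinearMap.ext fun v => ?_
    have := fderiv_chartMap_apply κ hφ v.ofLp
    refine this.trans ?_
    ext i
    have hr : ⇑((EuclideanSpace.basisFun (Fin n) ℝ).toBasis.repr v) = v.ofLp := by
      ext j; simp
    simp [Matrix.toLin_apply, hr, Pi.single_apply]
  rw [ContinuousLinearMap.det, h, LinearMap.det_toLin, det_chartJac]
  rfl

theorem pd_comp_chartMap (κ : Fin n) {φ g : E n → ℝ} {z : E n} (hφ : DifferentiableAt ℝ φ z)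
    (hg : DifferentiableAt ℝ g (chartMap κ φ z)) (p : Fin n) :
    pd p (fun w => g (chartMap κ φ w)) z =
      ∑ i, pd i g (chartMap κ φ z) * chartJac κ (grad φ z) i p := by
  have h1 : HasFDerivAt (fun w => g (chartMap κ φ w)) _ z :=
    hg.hasFDerivAt.comp z (hasFDerivAt_chartMap κ hφ).differentiableAt.hasFDerivAt
  have h2 : (EuclideanSpace.single p (1 : ℝ) : E n) = WithLp.toLp 2 (Pi.single p 1) := rfl
  rw [pd, h1.fderiv, ContinuousLinearMap.comp_apply, h2, fderiv_chartMap_apply κ hφ,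
    fderiv_apply_eq_sum]
  refine Finset.sum_congr rfl fun i _ => ?_
  simp [mul_comm]

theorem pd_sum_mul {ι : Type*} (s : Finset ι) {u v : ι → E n → ℝ} {z : E n}
    (hu : ∀ i, DifferentiableAt ℝ (u i) z) (hv : ∀ i, DifferentiableAt ℝ (v i) z) (q : Fin n) :
    pd q (fun w => ∑ i ∈ s, u i w * v i w) z =
      ∑ i ∈ s, (pd q (u i) z * v i z + u i z * pd q (v i) z) := by
  have h : HasFDerivAt (fun w => ∑ i ∈ s, u i w * v i w)
      (∑ i ∈ s, (u i z • fderiv ℝ (v i) z + v i z • fderiv ℝ (u i) z)) z :=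
    HasFDerivAt.fun_sum fun i _ => (hu i).hasFDerivAt.mul (hv i).hasFDerivAt
  rw [pd, h.fderiv, sum_apply]
  refine Finset.sum_congr rfl fun i _ => ?_
  simp only [add_apply, smul_apply, smul_eq_mul, pd]
  ring

theorem chartJac_apply (κ : Fin n) (a : Fin n → ℝ) (i p : Fin n) :
    chartJac κ a i p = (1 : Matrix (Fin n) (Fin n) ℝ) i p +
      (Pi.single κ 1 : Fin n → ℝ) i * (a p - (Pi.single κ 1 : Fin n → ℝ) p) := rfl

open Matrix in
/-- The chain rule for the 2-jets of `y = f ∘ chartMap κ φ`. -/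
theorem jet_comp_chartMap (κ : Fin n) {φ : E n → ℝ} {f y : E n → E m} {z : E n}
    (hφ : ContDiffAt ℝ 2 φ z) (hf : ContDiffAt ℝ 2 f (chartMap κ φ z))
    (hy : ∀ᶠ w in 𝓝 z, f (chartMap κ φ w) = y w) :
    jet1 y z = jet1 f (chartMap κ φ z) * chartJac κ (grad φ z) ∧
    ∀ α, jet2 y z α = (chartJac κ (grad φ z))ᵀ * jet2 f (chartMap κ φ z) α * chartJac κ (grad φ z)
      + jet1 f (chartMap κ φ z) α κ • hess φ z := by
  have hfα : ∀ α, ContDiffAt ℝ 2 (fun x => f x α) (chartMap κ φ z) := contDiffAt_euclidean.1 hf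
  have hc := (contDiffAt_chartMap κ hφ)
  have hyα : ∀ α, (fun w => y w α) =ᶠ[𝓝 z] fun w => f (chartMap κ φ w) α := fun α =>
    hy.mono fun w hw => by simp [hw]
  have h1 : ∀ α p, pd p (fun w => y w α) =ᶠ[𝓝 z] fun w =>
      ∑ i, d1 f α i (chartMap κ φ w) * chartJac κ (grad φ w) i p := by
    intro α p
    filter_upwards [(hyα α).eventuallyEq_nhds, hφ.eventually (by simp),
      hc.continuousAt.eventually ((hfα α).eventually (by simp))] with w h1 h2 h3
    rw [pd_congr h1]
    exact pd_comp_chartMap κ (h2.differentiableAt two_ne_zero)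
      (h3.differentiableAt two_ne_zero) p
  refine ⟨?_, fun α => ?_⟩
  · ext α p
    exact (h1 α p).self_of_nhds
  · ext p q
    have hpd : ∀ p, ContDiffAt ℝ 1 (pd p φ) z := fun p =>
      (hφ.fderiv_right (m := 1) le_rfl).clm_apply contDiffAt_const
    have hd1 : ∀ i, ContDiffAt ℝ 1 (d1 f α i) (chartMap κ φ z) := fun i =>
      ((hfα α).fderiv_right (m := 1) le_rfl).clm_apply contDiffAt_const
    have hA : ∀ i, HasFDerivAt (fun w => chartJac κ (grad φ w) i p)
        ((Pi.single κ 1 : Fin n → ℝ) i • fderiv ℝ (pd p φ) z) z := fun i => by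
      simp only [chartJac_apply]
      exact (((hpd p).differentiableAt one_ne_zero).hasFDerivAt.sub_const _).const_mul _ |>.const_add _
    have hφd := hφ.differentiableAt two_ne_zero
    have hd1c : ∀ i, DifferentiableAt ℝ (fun w => d1 f α i (chartMap κ φ w)) z := fun i =>
      ((hd1 i).differentiableAt one_ne_zero).comp z (hc.differentiableAt two_ne_zero)
    have h2 : jet2 y z α p q = ∑ i, ((∑ j, d2 f α i j (chartMap κ φ z) * chartJac κ (grad φ z) j q) *
        chartJac κ (grad φ z) i p +
        d1 f α i (chartMap κ φ z) * ((Pi.single κ 1 : Fin n → ℝ) i * pd q (pd p φ) z)) := by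
      change pd q (pd p fun w => y w α) z = _
      rw [pd_congr (h1 α p), pd_sum_mul _ hd1c fun i => (hA i).differentiableAt]
      refine Finset.sum_congr rfl fun i _ => ?_
      rw [pd_comp_chartMap κ hφd ((hd1 i).differentiableAt one_ne_zero)]
      congr 2
      rw [pd, (hA i).fderiv]
      rfl
    rw [h2, Finset.sum_add_distrib, Matrix.add_apply]
    congr 1
    · simp only [Matrix.mul_apply, Matrix.transpose_apply, Finset.sum_mul]
      rw [Finset.sum_comm]
      refine Finset.sum_congr rfl fun j _ => Finset.sum_congr rfl fun i _ => ?_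
      change _ = chartJac κ (grad φ z) i p * d2 f α i j (chartMap κ φ z) * _
      ring
    · rw [Finset.sum_eq_single κ (fun i _ hi => by simp [hi]) (by simp)]
      simp [jet1, hess]

/-- The mass field read in a boundary chart and multiplied by the Jacobian determinant. -/
def chartVec (κ : Fin n) (φ : E n → ℝ) (y : E n → E m) (z : E n) : E n :=
  WithLp.toLp 2 (chartField κ (grad φ z) (hess φ z) (jet1 y z) (jet2 y z))

/-- `chartVec` is the Piola transform det(Dχ) Dχ⁻¹ X, stated without inverting Dχ. The equation
needs ∂_κ φ ≠ 0, although `chartVec` itself makes sense on the boundary. -/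
theorem fderiv_chartVec (κ : Fin n) {φ : E n → ℝ} {f y : E n → E m} {z : E n}
    (hφ : ContDiffAt ℝ 2 φ z) (hf : ContDiffAt ℝ 2 f (chartMap κ φ z))
    (hy : ∀ᶠ w in 𝓝 z, f (chartMap κ φ w) = y w) (h0 : pd κ φ z ≠ 0) :
    fderiv ℝ (chartMap κ φ) z (chartVec κ φ y z) = pd κ φ z • massField f (chartMap κ φ z) := by
  obtain ⟨h1, h2⟩ := jet_comp_chartMap κ hφ hf hy
  have h3 := smul_XJ_eq_chartField (a := grad φ z) h0 (hess φ z) (jet1 f (chartMap κ φ z))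
    (jet2 f (chartMap κ φ z)) (jet2 y z) h2
  rw [← h1] at h3
  rw [chartVec, fderiv_chartMap_apply κ (hφ.differentiableAt two_ne_zero), ← h3]
  rfl

/-- The only denominator in `chartField` is the determinant of `chartGram`. -/
theorem continuousAt_chartField (κ : Fin n) {a : Fin n → ℝ} {b : Matrix (Fin n) (Fin n) ℝ}
    {c : Matrix (Fin m) (Fin n) ℝ} {d : Fin m → Matrix (Fin n) (Fin n) ℝ}
    (h : IsUnit (chartGram κ a c).det) :
    ContinuousAt (fun q : ((Fin n → ℝ) × Matrix (Fin n) (Fin n) ℝ) × Jet n m =>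
      chartField κ q.1.1 q.1.2 q.2.1 q.2.2) ((a, b), (c, d)) := by
  have hg : Continuous fun q : ((Fin n → ℝ) × Matrix (Fin n) (Fin n) ℝ) × Jet n m =>
      chartGram κ q.1.1 q.2.1 := by
    unfold chartGram
    refine (Continuous.add continuous_const ?_).add ?_
    · exact (continuous_fst.comp continuous_fst).matrix_vecMulVec (continuous_fst.comp continuous_fst)
    · exact (continuous_fst.comp continuous_snd).matrix_transpose.matrix_mul
        (continuous_fst.comp continuous_snd)
  have hi : ContinuousAt (fun q : ((Fin n → ℝ) × Matrix (Fin n) (Fin n) ℝ) × Jet n m =>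
      (chartGram κ q.1.1 q.2.1)⁻¹) ((a, b), (c, d)) := by
    simp_rw [Matrix.inv_def, Ring.inverse_eq_inv']
    exact (hg.matrix_det.continuousAt.inv₀ h.ne_zero).smul hg.matrix_adjugate.continuousAt
  have hF : Continuous fun q : Matrix (Fin n) (Fin n) ℝ ×
      (((Fin n → ℝ) × Matrix (Fin n) (Fin n) ℝ) × Jet n m) =>
      ∑ α, ((q.1 * chartHess κ q.2.1.1 q.2.1.2 q.2.2.1 q.2.2.2 α).trace • (q.1.mulVec (q.2.2.1 α))
      - (q.1 * chartHess κ q.2.1.1 q.2.1.2 q.2.2.1 q.2.2.2 α).mulVec (q.1.mulVec (q.2.2.1 α))) := by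
    refine continuous_finsetSum _ fun α _ => ?_
    have h1 : Continuous fun q : Matrix (Fin n) (Fin n) ℝ ×
      (((Fin n → ℝ) × Matrix (Fin n) (Fin n) ℝ) × Jet n m) =>
        chartHess κ q.2.1.1 q.2.1.2 q.2.2.1 q.2.2.2 α := by
      unfold chartHess
      have e1 : Continuous fun q : Matrix (Fin n) (Fin n) ℝ ×
        (((Fin n → ℝ) × Matrix (Fin n) (Fin n) ℝ) × Jet n m) => q.2.1.1 κ :=
        (continuous_apply κ).comp (continuous_fst.comp (continuous_fst.comp continuous_snd))
      have e2 : Continuous fun q : Matrix (Fin n) (Fin n) ℝ ×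
        (((Fin n → ℝ) × Matrix (Fin n) (Fin n) ℝ) × Jet n m) => q.2.2.2 α :=
        (continuous_apply α).comp (continuous_snd.comp (continuous_snd.comp continuous_snd))
      have e3 : Continuous fun q : Matrix (Fin n) (Fin n) ℝ ×
        (((Fin n → ℝ) × Matrix (Fin n) (Fin n) ℝ) × Jet n m) => q.2.2.1 α κ :=
        (continuous_fst.comp (continuous_snd.comp continuous_snd)).matrix_elem α κ
      exact (e1.smul e2).sub
        (e3.smul (continuous_snd.comp (continuous_fst.comp continuous_snd)))
    have h2 : Continuous fun q : Matrix (Fin n) (Fin n) ℝ ×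
      (((Fin n → ℝ) × Matrix (Fin n) (Fin n) ℝ) × Jet n m) => q.1.mulVec (q.2.2.1 α) :=
      continuous_fst.matrix_mulVec ((continuous_apply α).comp
        (continuous_fst.comp (continuous_snd.comp continuous_snd)))
    have h3 := continuous_fst.matrix_mul h1
    exact (h3.matrix_trace.smul h2).sub (h3.matrix_mulVec h2)
  exact ContinuousAt.comp (f := fun q : ((Fin n → ℝ) × Matrix (Fin n) (Fin n) ℝ) × Jet n m =>
    ((chartGram κ q.1.1 q.2.1)⁻¹, q)) hF.continuousAt (hi.prodMk continuousAt_id)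

section chart

variable {Ω : Set (E n)} {f : E n → E m} {κ : Fin n} {φ : E n → ℝ} {y : E n → E m} {H : E n → ℝ}
  {z₀ x₀ : E n} {r R : ℝ}

theorem IsBoundaryChart.continuousOn_chartVec (h : IsBoundaryChart Ω f κ φ y H z₀ r R x₀) :
    ContinuousOn (chartVec κ φ y) (Metric.ball z₀ R ∩ {z | 0 ≤ z κ}) := by
  intro z hz
  have ho : Metric.ball z₀ R ∈ 𝓝 z := Metric.isOpen_ball.mem_nhds hz.1
  have hp : ∀ p, ContDiffOn ℝ 1 (pd p φ) (Metric.ball z₀ R) := fun p =>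
    contDiffOn_pd (by norm_num) Metric.isOpen_ball h.contDiffOn_φ p
  have h1 : ContinuousAt (grad φ) z := continuousAt_pi.2 fun p => (hp p).continuousOn.continuousAt ho
  have h2 : ContinuousAt (hess φ) z := continuousAt_pi.2 fun p => continuousAt_pi.2 fun q =>
    (contDiffOn_pd (N := 0) (by norm_num) Metric.isOpen_ball (hp p) q).continuousOn.continuousAt ho
  have h3 : ContinuousAt (jet1 y) z :=
    (continuousOn_jet1 Metric.isOpen_ball h.contDiffOn_y).continuousAt ho
  have h4 : ContinuousAt (jet2 y) z :=
    (continuousOn_jet2 Metric.isOpen_ball h.contDiffOn_y).continuousAt ho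
  have h5 : IsUnit (chartGram κ (grad φ z) (jet1 y z)).det := by
    refine isUnit_det_chartGram ?_
    rcases (show 0 ≤ z κ from hz.2).eq_or_lt with h0 | h0
    · exact Or.inr (h.y_ne z hz.1 h0.symm)
    · exact Or.inl (h.φ_ne z hz.1 h0)
  have h6 := (continuousAt_chartField κ (b := hess φ z) (d := jet2 y z) h5)
  have h7 := ContinuousAt.comp (f := fun z => ((grad φ z, hess φ z), (jet1 y z, jet2 y z))) h6
    ((h1.prodMk h2).prodMk (h3.prodMk h4))
  exact ((PiLp.continuous_toLp 2 (fun _ : Fin n => ℝ)).continuousAt.comp h7).continuousWithinAt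

theorem IsBoundaryChart.eventually_graph (h : IsBoundaryChart Ω f κ φ y H z₀ r R x₀) {z : E n}
    (hz : z ∈ Metric.ball z₀ R) (h0 : 0 < z κ) : ∀ᶠ w in 𝓝 z, f (chartMap κ φ w) = y w := by
  have h3 : ∀ᶠ w : E n in 𝓝 z, 0 < w κ :=
    ((EuclideanSpace.proj κ : E n →L[ℝ] ℝ).continuous.tendsto z).eventually
      (lt_mem_nhds (by simpa using h0))
  filter_upwards [Metric.isOpen_ball.mem_nhds hz, h3] with w h1 h2 using h.graph w h1 h2.le

theorem IsBoundaryChart.contDiffAt_φ (h : IsBoundaryChart Ω f κ φ y H z₀ r R x₀) {z : E n}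
    (hz : z ∈ Metric.ball z₀ R) : ContDiffAt ℝ 2 φ z :=
  h.contDiffOn_φ.contDiffAt (Metric.isOpen_ball.mem_nhds hz)

/-- Pulls back the flux density X·Dg, multiplied by the signed Jacobian determinant; with the change
of variables formula it transports the weak identity to the half-ball. -/
theorem IsBoundaryChart.pd_mul_fderiv_massField (h : IsBoundaryChart Ω f κ φ y H z₀ r R x₀)
    (hf : ContDiffOn ℝ 2 f (closure Ω)ᶜ) {z : E n} (hz : z ∈ Metric.ball z₀ R) (h0 : 0 < z κ)
    {g : E n → ℝ} (hg : DifferentiableAt ℝ g (chartMap κ φ z)) :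
    pd κ φ z * fderiv ℝ g (chartMap κ φ z) (massField f (chartMap κ φ z)) =
      fderiv ℝ (fun w => g (chartMap κ φ w)) z (chartVec κ φ y z) := by
  have h1 := fderiv_chartVec κ (h.contDiffAt_φ hz)
    (hf.contDiffAt (isClosed_closure.isOpen_compl.mem_nhds (h.ext z hz h0)))
    (h.eventually_graph hz h0) (h.φ_ne z hz h0)
  have h2 : HasFDerivAt (fun w => g (chartMap κ φ w)) _ z := hg.hasFDerivAt.comp z
    (hasFDerivAt_chartMap κ ((h.contDiffAt_φ hz).differentiableAt
      two_ne_zero)).differentiableAt.hasFDerivAt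
  rw [h2.fderiv, ContinuousLinearMap.comp_apply, h1, map_smul, smul_eq_mul]

open Matrix in
theorem IsBoundaryChart.chartVec_boundary (h : IsBoundaryChart Ω f κ φ y H z₀ r R x₀) {z : E n}
    (hz : z ∈ Metric.ball z₀ R) (h0 : z κ = 0) :
    chartVec κ φ y z κ = -((hess φ z).trace - hess φ z κ κ -
      (1 + grad φ z ⬝ᵥ grad φ z)⁻¹ * (grad φ z ⬝ᵥ (hess φ z *ᵥ grad φ z))) := by
  refine chartField_boundary (h.φ_bdry z hz h0) (fun p hp => ?_) (fun α p hp => ?_)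
    (h.y_ne z hz h0) _
  · have h1 : ContDiffOn ℝ 1 (pd κ φ) (Metric.ball z₀ R) :=
      contDiffOn_pd (by norm_num) Metric.isOpen_ball h.contDiffOn_φ κ
    have h2 := hasDerivAt_pd ((h1.contDiffAt (Metric.isOpen_ball.mem_nhds hz)).differentiableAt
      one_ne_zero) p
    -- ∂_κ φ vanishes on the whole hyperplane z_κ = 0, hence so do its derivatives along it;
    -- symmetry of second derivatives turns this into the vanishing of b_pκ.
    have h3 : (fun s : ℝ => pd κ φ (z + s • EuclideanSpace.single p 1)) =ᶠ[𝓝 0] fun _ => 0 := by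
      have h4 : Tendsto (fun s : ℝ => z + s • EuclideanSpace.single p (1 : ℝ)) (𝓝 0) (𝓝 z) :=
        Continuous.tendsto' (by fun_prop) _ _ (by simp)
      filter_upwards [h4.eventually (Metric.isOpen_ball.mem_nhds hz)] with s hs
      exact h.φ_bdry _ hs (by simp [h0, hp.symm])
    change pd κ (pd p φ) z = 0
    rw [pd_comm (h.contDiffAt_φ hz)]
    exact h2.unique ((hasDerivAt_const _ _).congr_of_eventuallyEq h3)
  · exact h.y_bdry z hz h0 p hp α

end chart

end

section

variable {n m : ℕ}

/-! ### Outer normal and mean curvature of a graph -/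

/-- Moving from x in the direction u - v leaves closure Ω according to u and enters Ω according to
v, because ⟨u - v, u⟩ = 1 - ⟨u, v⟩ = -⟨u - v, v⟩. Half of this slope, divided by the length of u -
v, is an admissible ε. -/
theorem IsOuterUnitNormal.unique {Ω : Set (E n)} {x u v : E n} (hu : IsOuterUnitNormal Ω x u)
    (hv : IsOuterUnitNormal Ω x v) : u = v := by
  by_contra hne
  have hlt : inner ℝ u v < 1 := by
    refine lt_of_le_of_ne ?_ fun h => hne ((inner_eq_one_iff_of_norm_eq_one hu.1 hv.1).1 h)
    simpa [hu.1, hv.1] using real_inner_le_norm u v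
  set d := u - v with hd
  have hd0 : 0 < ‖d‖ := norm_pos_iff.2 (sub_ne_zero.2 hne)
  have h1 : inner ℝ d u = 1 - inner ℝ u v := by
    rw [hd, inner_sub_left, real_inner_self_eq_norm_sq, hu.1, real_inner_comm]; ring
  have h2 : inner ℝ d v = -(1 - inner ℝ u v) := by
    rw [hd, inner_sub_left, real_inner_self_eq_norm_sq, hv.1]; ring
  set ε := (1 - inner ℝ u v) / (2 * ‖d‖) with hε
  have hε0 : 0 < ε := by have := sub_pos.2 hlt; positivity
  have hεd : ε * ‖d‖ = (1 - inner ℝ u v) / 2 := by rw [hε]; field_simp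
  have hev := (hu.2 ε hε0).and (hv.2 ε hε0)
  have ht : Tendsto (fun t : ℝ => x + t • d) (𝓝[>] 0) (𝓝 x) :=
    (Continuous.tendsto' (by fun_prop) _ _ (by simp)).mono_left nhdsWithin_le_nhds
  obtain ⟨t, ⟨ht1, ht2⟩, ht0⟩ := ((ht.eventually hev).and self_mem_nhdsWithin).exists
  have ht0 : 0 < t := ht0
  have e1 : x + t • d - x = t • d := by abel
  rw [e1, norm_smul, inner_smul_left, Real.norm_of_nonneg ht0.le] at ht1 ht2
  refine ht1.2 ?_ (subset_closure (ht2.1 ?_))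
  · simp only [conj_trivial]
    rw [h1]; nlinarith [sub_pos.2 hlt]
  · simp only [conj_trivial]
    rw [h2]; nlinarith [sub_pos.2 hlt]

theorem IsOuterUnitNormal.outerNormal_eq {Ω : Set (E n)} {x v : E n}
    (hv : IsOuterUnitNormal Ω x v) : outerNormal Ω x = v := by
  have h : ∃ v, IsOuterUnitNormal Ω x v := ⟨v, hv⟩
  rw [outerNormal, dif_pos h]
  exact h.choose_spec.unique hv

theorem isOuterUnitNormal_of_hasFDerivAt {Ω : Set (E n)} {x v : E n} {U : E n → ℝ} {c : ℝ}
    (hc : 0 < c) (hv : ‖v‖ = 1) (hU : HasFDerivAt U (c • innerSL ℝ v) x) (hx : U x = 0)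
    (hin : ∀ᶠ y in 𝓝 x, (U y < 0 → y ∈ Ω) ∧ (0 < U y → y ∉ closure Ω)) :
    IsOuterUnitNormal Ω x v := by
  refine ⟨hv, fun ε hε => ?_⟩
  filter_upwards [hU.isLittleO.bound (mul_pos hc hε), hin] with y h1 h2
  rw [hx, sub_zero] at h1
  have h3 : (c • innerSL ℝ v) (y - x) = c * inner ℝ (y - x) v := by
    simp [real_inner_comm]
  rw [h3, Real.norm_eq_abs, abs_le] at h1
  refine ⟨fun h => h2.1 ?_, fun h => h2.2 ?_⟩ <;> nlinarith

/-- Deleting a coordinate. -/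
def dropCoord {k : ℕ} (κ : Fin (k + 1)) : E (k + 1) →L[ℝ] E k :=
  LinearMap.toContinuousLinearMap
    { toFun := fun x => WithLp.toLp 2 (fun j => x (κ.succAbove j))
      map_add' := fun _ _ => rfl
      map_smul' := fun _ _ => rfl }

@[simp] theorem dropCoord_apply {k : ℕ} (κ : Fin (k + 1)) (x : E (k + 1)) (j : Fin k) :
    dropCoord κ x j = x (κ.succAbove j) := rfl

/-- The point with `κ`-th coordinate `t` and the other coordinates given by `a`. -/
def slicePt {k : ℕ} (κ : Fin (k + 1)) (a : E k) (t : ℝ) : E (k + 1) :=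
  hyperplaneIncl κ a + t • EuclideanSpace.single κ 1

section slice

variable {k : ℕ} (κ : Fin (k + 1))

@[simp] theorem slicePt_same (a : E k) (t : ℝ) : slicePt κ a t κ = t := by simp [slicePt]

@[simp] theorem slicePt_succAbove (a : E k) (t : ℝ) (j : Fin k) :
    slicePt κ a t (κ.succAbove j) = a j := by simp [slicePt]

theorem ext_succAbove {x y : E (k + 1)} (h : x κ = y κ) (h' : dropCoord κ x = dropCoord κ y) :
    x = y := by
  ext i
  refine Fin.succAboveCases κ h (fun j => ?_) i
  exact congrArg (fun a : E k => a j) h'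

@[simp] theorem dropCoord_slicePt (a : E k) (t : ℝ) : dropCoord κ (slicePt κ a t) = a := by
  ext j; simp

@[simp] theorem dropCoord_hyperplaneIncl (a : E k) : dropCoord κ (hyperplaneIncl κ a) = a := by
  ext j; simp

@[simp] theorem slicePt_dropCoord (x : E (k + 1)) : slicePt κ (dropCoord κ x) (x κ) = x :=
  ext_succAbove κ (by simp) (by simp)

theorem slicePt_zero (a : E k) : slicePt κ a 0 = hyperplaneIncl κ a := by simp [slicePt]

theorem graphPt_eq (w : E k → ℝ) (a : E k) : graphPt κ w a = slicePt κ a (w a) := rfl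

theorem chartMap_slicePt (φ : E (k + 1) → ℝ) (a : E k) (t : ℝ) :
    chartMap κ φ (slicePt κ a t) = slicePt κ a (φ (slicePt κ a t)) := by
  refine ext_succAbove κ ?_ ?_
  · rw [chartMap_same, slicePt_same]
  · ext j; simp [chartMap_ne (Fin.succAbove_ne κ j)]

theorem dropCoord_chartMap (φ : E (k + 1) → ℝ) (z : E (k + 1)) :
    dropCoord κ (chartMap κ φ z) = dropCoord κ z := by
  ext j; simp [chartMap_ne (Fin.succAbove_ne κ j)]

theorem norm_sq_eq_slice (x : E (k + 1)) : ‖x‖ ^ 2 = x κ ^ 2 + ‖dropCoord κ x‖ ^ 2 := by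
  rw [EuclideanSpace.norm_sq_eq, EuclideanSpace.norm_sq_eq, Fin.sum_univ_succAbove _ κ]
  simp

theorem continuous_slicePt : Continuous fun q : E k × ℝ => slicePt κ q.1 q.2 := by
  unfold slicePt; fun_prop

/-- The gradient of a function as a vector. -/
def gradVec (w : E k → ℝ) (a : E k) : E k := WithLp.toLp 2 fun j => pd j w a

@[simp] theorem gradVec_apply (w : E k → ℝ) (a : E k) (j : Fin k) : gradVec w a j = pd j w a := rfl

/-- The squared area density `1 + |Dw|²` of a graph. -/
def areaSq (w : E k → ℝ) (a : E k) : ℝ := 1 + ∑ j, pd j w a ^ 2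

theorem areaSq_pos (w : E k → ℝ) (a : E k) : 0 < areaSq w a := by
  have : 0 ≤ ∑ j, pd j w a ^ 2 := Finset.sum_nonneg fun _ _ => sq_nonneg _
  unfold areaSq; positivity

/-- The unit normal `± (e_κ - Dw) / √(1 + |Dw|²)` of a graph. -/
def graphNormal (σ : ℝ) (w : E k → ℝ) (a : E k) : E (k + 1) :=
  (σ * (√(areaSq w a))⁻¹) • (EuclideanSpace.single κ 1 - hyperplaneIncl κ (gradVec w a))

theorem graphNormal_same (σ : ℝ) (w : E k → ℝ) (a : E k) :
    graphNormal κ σ w a κ = σ * (√(areaSq w a))⁻¹ := by simp [graphNormal]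

theorem graphNormal_succAbove (σ : ℝ) (w : E k → ℝ) (a : E k) (j : Fin k) :
    graphNormal κ σ w a (κ.succAbove j) = -(σ * (√(areaSq w a))⁻¹) * pd j w a := by
  simp [graphNormal]

theorem norm_graphNormal {σ : ℝ} (hσ : σ * σ = 1) (w : E k → ℝ) (a : E k) :
    ‖graphNormal κ σ w a‖ = 1 := by
  have h : ‖graphNormal κ σ w a‖ ^ 2 = 1 := by
    rw [EuclideanSpace.norm_sq_eq, Fin.sum_univ_succAbove _ κ, graphNormal_same]
    simp only [graphNormal_succAbove, Real.norm_eq_abs, sq_abs, mul_pow, neg_sq, inv_pow,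
      Real.sq_sqrt (areaSq_pos w a).le, ← Finset.mul_sum]
    have h2 : ∑ j, pd j w a ^ 2 = areaSq w a - 1 := by unfold areaSq; ring
    rw [h2]
    have := (areaSq_pos w a).ne'
    field_simp
    linear_combination (areaSq w a) * hσ
  nlinarith [norm_nonneg (graphNormal κ σ w a), sq_nonneg (‖graphNormal κ σ w a‖ - 1)]

theorem hasFDerivAt_graphDefining {σ : ℝ} {w : E k → ℝ} {x : E (k + 1)}
    (hw : DifferentiableAt ℝ w (dropCoord κ x)) :
    HasFDerivAt (fun x => σ * (x κ - w (dropCoord κ x)))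
      (√(areaSq w (dropCoord κ x)) • innerSL ℝ (graphNormal κ σ w (dropCoord κ x))) x := by
  have h1 : HasFDerivAt (fun x : E (k + 1) => σ * (x κ - w (dropCoord κ x)))
      (σ • ((EuclideanSpace.proj κ : E (k + 1) →L[ℝ] ℝ) -
        (fderiv ℝ w (dropCoord κ x)).comp (dropCoord κ))) x :=
    ((EuclideanSpace.proj κ : E (k + 1) →L[ℝ] ℝ).hasFDerivAt.sub
      (hw.hasFDerivAt.comp x (dropCoord κ).hasFDerivAt)).const_mul σ
  refine h1.congr_fderiv (ContinuousLinearMap.ext fun v => Eq.symm ?_)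
  have h0 := (Real.sqrt_pos.2 (areaSq_pos w (dropCoord κ x))).ne'
  simp only [smul_apply, sub_apply, ContinuousLinearMap.comp_apply, innerSL_apply_apply,
    fderiv_apply_eq_sum, PiLp.inner_apply, Fin.sum_univ_succAbove _ κ, graphNormal_same,
    graphNormal_succAbove, smul_eq_mul, PiLp.proj_apply, dropCoord_apply]
  simp only [RCLike.inner_apply, conj_trivial, mul_add, mul_sub, Finset.mul_sum]
  rw [sub_eq_add_neg, ← Finset.sum_neg_distrib]
  congr 1
  · field_simp
  · refine Finset.sum_congr rfl fun j _ => ?_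
    field_simp

/-- The mean curvature of a graph, for any derivative of the normal field along the graph. -/
theorem trace_sub_inner_graphNormal {σ : ℝ} (hσ : σ * σ = 1) {w : E k → ℝ} {a : E k}
    (hw : ContDiffAt ℝ 2 w a) {D : E (k + 1) →L[ℝ] E (k + 1)}
    (hD : ∀ j, D (EuclideanSpace.single (κ.succAbove j) 1 + pd j w a • EuclideanSpace.single κ 1) =
      fderiv ℝ (graphNormal κ σ w) a (EuclideanSpace.single j 1)) :
    (LinearMap.trace ℝ (E (k + 1)) (D : E (k + 1) →ₗ[ℝ] E (k + 1)) -
      inner ℝ (D (graphNormal κ σ w a)) (graphNormal κ σ w a)) * √(areaSq w a) =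
    -σ * (∑ j, hess w a j j - (areaSq w a)⁻¹ * ∑ i, ∑ j, pd i w a * (hess w a i j * pd j w a)) := by
  have hpd : ∀ j, DifferentiableAt ℝ (pd j w) a := fun j =>
    ((hw.fderiv_right (m := 1) le_rfl).clm_apply contDiffAt_const).differentiableAt one_ne_zero
  have hs := Real.sqrt_pos.2 (areaSq_pos w a)
  set s := √(areaSq w a) with hsdef
  have hss : s * s = areaSq w a := Real.mul_self_sqrt (areaSq_pos w a).le
  -- the derivative of the density
  have hsq : ∀ j, HasFDerivAt (fun b => pd j w b ^ 2) ((2 * pd j w a) • fderiv ℝ (pd j w) a) a :=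
    fun j => by simpa using (hpd j).hasFDerivAt.pow 2
  have hW : HasFDerivAt (areaSq w) (∑ j, (2 * pd j w a) • fderiv ℝ (pd j w) a) a :=
    (HasFDerivAt.fun_sum fun j _ => hsq j).const_add 1
  have hc : HasFDerivAt (fun b => σ * (√(areaSq w b))⁻¹)
      (-(σ * (s ^ 3)⁻¹) • ∑ j, pd j w a • fderiv ℝ (pd j w) a) a := by
    have h1 := ((hasDerivAt_inv hs.ne').comp_hasFDerivAt a (hW.sqrt (areaSq_pos w a).ne')).const_mul σ
    refine h1.congr_fderiv ?_
    rw [← hsdef]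
    simp only [Finset.smul_sum, smul_smul]
    refine Finset.sum_congr rfl fun j _ => ?_
    congr 1
    field_simp
  have hgv : DifferentiableAt ℝ (gradVec w) a := by
    refine differentiableAt_euclidean.2 fun j => hpd j
  have hN : DifferentiableAt ℝ (graphNormal κ σ w) a :=
    hc.differentiableAt.smul ((differentiableAt_const _).sub
      ((hyperplaneIncl κ).differentiableAt.comp a hgv))
  set N := graphNormal κ σ w a with hNdef
  -- The normal has constant length, so its derivatives are orthogonal to it.
  have hunit : ∀ v, inner ℝ (fderiv ℝ (graphNormal κ σ w) a v) N = 0 := fun v => by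
    have h1 := (hN.hasFDerivAt.inner ℝ hN.hasFDerivAt)
    have h2 : HasFDerivAt (fun b => inner ℝ (graphNormal κ σ w b) (graphNormal κ σ w b))
        (0 : E k →L[ℝ] ℝ) a := by
      have : (fun b => inner ℝ (graphNormal κ σ w b) (graphNormal κ σ w b)) = fun _ => (1 : ℝ) := by
        funext b
        rw [real_inner_self_eq_norm_sq, norm_graphNormal κ hσ, one_pow]
      rw [this]
      exact hasFDerivAt_const _ _
    have h3 := congrArg (fun T : E k →L[ℝ] ℝ => T v) (h1.unique h2)
    simp only [ContinuousLinearMap.comp_apply, ContinuousLinearMap.prod_apply,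
      fderivInnerCLM_apply, zero_apply] at h3
    rw [real_inner_comm] at h3
    linarith
  -- D is prescribed only on tangent vectors, so its value t on the transverse vector e_κ is
  -- unknown. The contributions of t to the trace and to the normal term are equal and cancel; the
  -- mean curvature does not depend on the chosen derivative within ∂Ω.
  set t := D (EuclideanSpace.single κ 1) with ht
  have hDj : ∀ j, D (EuclideanSpace.single (κ.succAbove j) 1) =
      fderiv ℝ (graphNormal κ σ w) a (EuclideanSpace.single j 1) - pd j w a • t := fun j => by
    rw [← hD j, map_add, map_smul, ht]; abel
  have hcomp : ∀ j, fderiv ℝ (graphNormal κ σ w) a (EuclideanSpace.single j 1) (κ.succAbove j) =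
      -(σ * s⁻¹) * hess w a j j + σ * (s ^ 3)⁻¹ * (∑ i, pd i w a * hess w a i j) * pd j w a := by
    intro j
    have h1 : HasFDerivAt (fun b => graphNormal κ σ w b (κ.succAbove j))
        ((EuclideanSpace.proj (κ.succAbove j) : E (k + 1) →L[ℝ] ℝ).comp
          (fderiv ℝ (graphNormal κ σ w) a)) a :=
      (EuclideanSpace.proj (κ.succAbove j) : E (k + 1) →L[ℝ] ℝ).hasFDerivAt.comp a hN.hasFDerivAt
    have h2 := hc.neg.mul (hpd j).hasFDerivAt
    have h2' : (-fun b => σ * (√(areaSq w b))⁻¹) * pd j w =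
        fun b => graphNormal κ σ w b (κ.succAbove j) :=
      funext fun b => (graphNormal_succAbove κ σ w b j).symm
    have h4 : (-fun b => σ * (√(areaSq w b))⁻¹) a = -(σ * s⁻¹) := rfl
    rw [h2', h4] at h2
    have h3 := congrArg (fun T : E k →L[ℝ] ℝ => T (EuclideanSpace.single j 1)) (h1.unique h2)
    refine h3.trans ?_
    simp only [add_apply, smul_apply, neg_apply, sum_apply, smul_eq_mul]
    simp only [hess, Matrix.of_apply, pd]
    ring
  have htr : LinearMap.trace ℝ (E (k + 1)) (D : E (k + 1) →ₗ[ℝ] E (k + 1)) =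
      t κ - ∑ j, pd j w a * t (κ.succAbove j) +
        ∑ j, fderiv ℝ (graphNormal κ σ w) a (EuclideanSpace.single j 1) (κ.succAbove j) := by
    rw [LinearMap.trace_eq_sum_inner _ (EuclideanSpace.basisFun (Fin (k + 1)) ℝ),
      Fin.sum_univ_succAbove _ κ, sub_add, ← Finset.sum_sub_distrib, sub_eq_add_neg,
      ← Finset.sum_neg_distrib]
    congr 1
    · simp [ht, EuclideanSpace.inner_single_left]
    · refine Finset.sum_congr rfl fun j _ => ?_
      simp [hDj, EuclideanSpace.inner_single_left]
  have hDN : inner ℝ (D N) N = t κ - ∑ j, pd j w a * t (κ.succAbove j) := by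
    -- N in the basis of graph tangents e_j + w_j e_κ completed by e_κ; the remaining
    -- e_κ-coefficient is σ√(1 + |Dw|²).
    have hNsum : N = ∑ j, N (κ.succAbove j) • (EuclideanSpace.single (κ.succAbove j) 1 +
        pd j w a • EuclideanSpace.single κ (1 : ℝ)) + (σ * s) • EuclideanSpace.single κ 1 := by
      refine ext_succAbove κ ?_ ?_
      · simp only [hNdef, graphNormal_succAbove, graphNormal_same, PiLp.add_apply]
        simp only [WithLp.ofLp_sum, WithLp.ofLp_smul, WithLp.ofLp_add, Finset.sum_apply, Pi.smul_apply,
          Pi.add_apply, smul_eq_mul]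
        simp only [PiLp.single_apply, if_true, Fin.ne_succAbove, if_false, mul_one, zero_add]
        have h2 : ∑ j, pd j w a ^ 2 = s * s - 1 := by rw [hss]; unfold areaSq; ring
        have h3 : ∑ x, -(σ * (√(areaSq w a))⁻¹) * pd x w a * pd x w a =
            -(σ * s⁻¹) * (s * s - 1) := by
          rw [← h2, Finset.mul_sum]
          exact Finset.sum_congr rfl fun j _ => by rw [← hsdef]; ring
        rw [h3, ← hsdef]
        field_simp
        ring
      · ext i
        simp only [dropCoord_apply, PiLp.add_apply]
        simp only [WithLp.ofLp_sum, WithLp.ofLp_smul, WithLp.ofLp_add, Finset.sum_apply, Pi.smul_apply,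
          Pi.add_apply, smul_eq_mul]
        simp
    have hDNs : D N = ∑ j, N (κ.succAbove j) •
        fderiv ℝ (graphNormal κ σ w) a (EuclideanSpace.single j 1) + (σ * s) • t := by
      conv_lhs => rw [hNsum]
      rw [map_add, map_sum, map_smul]
      simp only [map_smul, hD, ht]
    rw [hDNs, inner_add_left, sum_inner]
    simp only [inner_smul_left, hunit, mul_zero, Finset.sum_const_zero, zero_add, conj_trivial]
    rw [PiLp.inner_apply, Fin.sum_univ_succAbove _ κ]
    simp only [hNdef, graphNormal_same, graphNormal_succAbove, RCLike.inner_apply, conj_trivial]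
    rw [← hsdef, mul_add, sub_eq_add_neg, ← Finset.sum_neg_distrib, Finset.mul_sum]
    have e1 : σ * s * (σ * s⁻¹) = 1 := by
      field_simp; nlinarith
    congr 1
    · linear_combination t κ * e1
    · refine Finset.sum_congr rfl fun j _ => ?_
      linear_combination (-(pd j w a) * t (κ.succAbove j)) * e1
  rw [htr, hDN, add_sub_cancel_left]
  simp only [hcomp, Finset.sum_add_distrib, ← Finset.mul_sum]
  rw [← hss]
  have e2 : ∑ j, σ * (s ^ 3)⁻¹ * (∑ i, pd i w a * hess w a i j) * pd j w a =
      σ * (s ^ 3)⁻¹ * ∑ i, ∑ j, pd i w a * (hess w a i j * pd j w a) := by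
    rw [Finset.sum_comm, Finset.mul_sum]
    refine Finset.sum_congr rfl fun j _ => ?_
    rw [mul_assoc, Finset.sum_mul]
    congr 1
    exact Finset.sum_congr rfl fun i _ => by ring
  simp only [← Finset.mul_sum] at e2
  rw [e2]
  field_simp
  ring

end slice

end

/-! ### The boundary as a graph, and its mean curvature in a chart -/

section

variable {m k : ℕ} {Ω : Set (E (k + 1))} {f : E (k + 1) → E m} {κ : Fin (k + 1)}
  {φ : E (k + 1) → ℝ} {y : E (k + 1) → E m} {H : E (k + 1) → ℝ} {z₀ x₀ : E (k + 1)} {r R : ℝ}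

/-- The function whose graph is the boundary, in a boundary chart. -/
def bdryFun (κ : Fin (k + 1)) (φ : E (k + 1) → ℝ) (a : E k) : ℝ := φ (hyperplaneIncl κ a)

theorem hasDerivAt_slicePt (a : E k) (t : ℝ) :
    HasDerivAt (slicePt κ a) (EuclideanSpace.single κ 1) t := by
  have := ((hasDerivAt_id t).smul_const (EuclideanSpace.single κ (1 : ℝ))).const_add
    (hyperplaneIncl κ a)
  rwa [one_smul] at this

theorem slicePt_mem_ball {a : E k} {s t : ℝ} (hst : s ∈ Icc 0 t) (h0 : z₀ κ = 0)
    (ht : slicePt κ a t ∈ Metric.ball z₀ R) : slicePt κ a s ∈ Metric.ball z₀ R := by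
  rw [mem_ball_iff_norm] at ht ⊢
  refine lt_of_le_of_lt (le_of_sq_le_sq ?_ (norm_nonneg _)) ht
  rw [norm_sq_eq_slice κ, norm_sq_eq_slice κ (slicePt κ a t - z₀)]
  simp only [map_sub, dropCoord_slicePt, PiLp.sub_apply, slicePt_same, h0, sub_zero]
  have := pow_le_pow_left₀ hst.1 hst.2 2
  linarith

/-- The open half-ball is convex, hence connected, and ∂_κ φ does not vanish there. The sign σ
records on which side of the boundary graph the exterior lies. -/
theorem IsBoundaryChart.exists_sign_pd (h : IsBoundaryChart Ω f κ φ y H z₀ r R x₀) :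
    ∃ σ : ℝ, σ * σ = 1 ∧ ∀ z ∈ Metric.ball z₀ R, 0 < z κ → 0 < σ * pd κ φ z := by
  set S : Set (E (k + 1)) := Metric.ball z₀ R ∩ {z | 0 < z κ} with hS
  have hconv : Convex ℝ S := (convex_ball z₀ R).inter
    (convex_halfSpace_gt (EuclideanSpace.proj κ : E (k + 1) →L[ℝ] ℝ).toLinearMap.isLinear 0)
  have hc : ContinuousOn (pd κ φ) S := (contDiffOn_pd (N := 1) (by norm_num) Metric.isOpen_ball
    h.contDiffOn_φ κ).continuousOn.mono inter_subset_left
  by_cases hpos : ∀ z ∈ S, 0 < pd κ φ z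
  · exact ⟨1, by norm_num, fun z hz h0 => by simpa using hpos z ⟨hz, h0⟩⟩
  · push Not at hpos
    obtain ⟨z₁, hz₁, hle⟩ := hpos
    refine ⟨-1, by norm_num, fun z hz h0 => ?_⟩
    by_contra hcon
    have h1 : 0 ≤ pd κ φ z := by linarith
    obtain ⟨z₂, hz₂, h2⟩ := hconv.isPreconnected.intermediate_value hz₁ ⟨hz, h0⟩ hc ⟨hle, h1⟩
    exact h.φ_ne z₂ hz₂.1 hz₂.2 h2

/-- Along the segment from the hyperplane up to height t, σφ increases strictly: its derivative is
positive except at the starting point, where it is 0. -/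
theorem IsBoundaryChart.bdryFun_lt (h : IsBoundaryChart Ω f κ φ y H z₀ r R x₀) {σ : ℝ}
    (hσ : ∀ z ∈ Metric.ball z₀ R, 0 < z κ → 0 < σ * pd κ φ z) {a : E k} {t : ℝ} (ht : 0 < t)
    (hz : slicePt κ a t ∈ Metric.ball z₀ R) :
    0 < σ * (φ (slicePt κ a t) - bdryFun κ φ a) := by
  have hd : ∀ s ∈ Icc 0 t, HasDerivAt (fun s => σ * φ (slicePt κ a s))
      (σ * pd κ φ (slicePt κ a s)) s := fun s hs =>
    (((h.contDiffAt_φ (slicePt_mem_ball hs h.base hz)).differentiableAt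
      two_ne_zero).hasFDerivAt.comp_hasDerivAt s (hasDerivAt_slicePt a s)).const_mul σ
  have hmono : StrictMonoOn (fun s => σ * φ (slicePt κ a s)) (Icc 0 t) := by
    refine strictMonoOn_of_deriv_pos (convex_Icc 0 t)
      (fun s hs => (hd s hs).continuousAt.continuousWithinAt) fun s hs => ?_
    rw [interior_Icc] at hs
    have hs' := Ioo_subset_Icc_self hs
    rw [(hd s hs').deriv]
    exact hσ _ (slicePt_mem_ball hs' h.base hz) (by simpa using hs.1)
  have := hmono (left_mem_Icc.2 ht.le) (right_mem_Icc.2 ht.le) ht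
  simp only [slicePt_zero] at this
  unfold bdryFun
  linarith

theorem IsBoundaryChart.hyperplaneIncl_base (h : IsBoundaryChart Ω f κ φ y H z₀ r R x₀) :
    hyperplaneIncl κ (dropCoord κ x₀) = z₀ := by
  refine ext_succAbove κ (by simp [h.base]) ?_
  rw [dropCoord_hyperplaneIncl, ← h.map_base, dropCoord_chartMap]

theorem IsBoundaryChart.R_pos (h : IsBoundaryChart Ω f κ φ y H z₀ r R x₀) : 0 < R :=
  h.r_pos.trans h.r_lt

theorem IsBoundaryChart.eventually_mem_ball (h : IsBoundaryChart Ω f κ φ y H z₀ r R x₀) :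
    ∀ᶠ x in 𝓝 x₀, hyperplaneIncl κ (dropCoord κ x) ∈ Metric.ball z₀ R := by
  have : Tendsto (fun x => hyperplaneIncl κ (dropCoord κ x)) (𝓝 x₀) (𝓝 z₀) :=
    Continuous.tendsto' (by fun_prop) _ _ h.hyperplaneIncl_base
  exact this.eventually (Metric.ball_mem_nhds _ h.R_pos)

theorem IsBoundaryChart.bdryFun_base (h : IsBoundaryChart Ω f κ φ y H z₀ r R x₀) :
    bdryFun κ φ (dropCoord κ x₀) = x₀ κ := by
  rw [bdryFun, h.hyperplaneIncl_base]
  conv_rhs => rw [← h.map_base]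
  rw [chartMap_same]

theorem graphPt_bdryFun (a : E k) :
    graphPt κ (bdryFun κ φ) a = chartMap κ φ (hyperplaneIncl κ a) := by
  rw [← slicePt_zero, chartMap_slicePt, slicePt_zero]; rfl

/-- Points outside Ω are chart images with z_κ ≥ 0, where σφ ≥ σw, so the wrong side of the graph
lies in Ω. The right side is covered by images with z_κ > 0, which are exterior. -/
theorem IsBoundaryChart.eventually_sides (h : IsBoundaryChart Ω f κ φ y H z₀ r R x₀) {σ : ℝ}
    (hσσ : σ * σ = 1) (hσ : ∀ z ∈ Metric.ball z₀ R, 0 < z κ → 0 < σ * pd κ φ z) :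
    ∀ᶠ x in 𝓝 x₀, (σ * (x κ - bdryFun κ φ (dropCoord κ x)) < 0 → x ∈ Ω) ∧
      (0 < σ * (x κ - bdryFun κ φ (dropCoord κ x)) → x ∉ closure Ω) ∧
      (σ * (x κ - bdryFun κ φ (dropCoord κ x)) = 0 → x ∈ frontier Ω) := by
  have hR := h.R_pos
  set a₀ := dropCoord κ x₀ with ha₀
  have ht₀ : slicePt κ a₀ (R / 2) ∈ Metric.ball z₀ R := by
    rw [slicePt, h.hyperplaneIncl_base, mem_ball_iff_norm]
    simp [norm_smul, abs_of_pos hR]; linarith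
  have hsl : Continuous fun x : E (k + 1) => slicePt κ (dropCoord κ x) (R / 2) :=
    (continuous_slicePt κ).comp ((dropCoord κ).continuous.prodMk continuous_const)
  have hev1 : ∀ᶠ x in 𝓝 x₀, slicePt κ (dropCoord κ x) (R / 2) ∈ Metric.ball z₀ R :=
    hsl.continuousAt.eventually (Metric.isOpen_ball.mem_nhds ht₀)
  have hev2 : ∀ᶠ x in 𝓝 x₀, 0 < σ * (φ (slicePt κ (dropCoord κ x) (R / 2)) - x κ) := by
    have h1 : ContinuousAt (fun x => φ (slicePt κ (dropCoord κ x) (R / 2))) x₀ :=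
      ContinuousAt.comp (f := fun x => slicePt κ (dropCoord κ x) (R / 2))
        (h.contDiffAt_φ ht₀).continuousAt hsl.continuousAt
    have h2 : ContinuousAt (fun x => σ * (φ (slicePt κ (dropCoord κ x) (R / 2)) - x κ)) x₀ :=
      continuousAt_const.mul (h1.sub (EuclideanSpace.proj κ : E (k + 1) →L[ℝ] ℝ).continuous.continuousAt)
    refine h2.eventually (lt_mem_nhds ?_)
    have := h.bdryFun_lt hσ (half_pos hR) ht₀
    rwa [h.bdryFun_base] at this
  filter_upwards [h.surj, h.eventually_mem_ball, hev1, hev2] with x h1 h2 h3 h4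
  have hσ0 : σ ≠ 0 := fun h => by simp [h] at hσσ
  refine ⟨fun hneg => ?_, fun hpos => ?_, fun h0 => ?_⟩
  · by_contra hx
    obtain ⟨z, hz, hz0, rfl⟩ := h1 hx
    have hzR := Metric.ball_subset_ball h.r_lt.le hz
    rw [dropCoord_chartMap, chartMap_same] at hneg
    rcases hz0.eq_or_lt with hz0 | hz0
    · have : hyperplaneIncl κ (dropCoord κ z) = z := ext_succAbove κ (by simp [← hz0]) (by simp)
      rw [bdryFun, this, sub_self, mul_zero] at hneg
      exact lt_irrefl _ hneg
    · have := h.bdryFun_lt hσ (a := dropCoord κ z) hz0 (by rwa [slicePt_dropCoord])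
      rw [slicePt_dropCoord] at this
      linarith
  -- Intermediate value theorem on the vertical segment of height R/2: since σ x_κ lies between the
  -- values of σφ at its ends, x is the chart image of a point with z_κ > 0.
  · have hc : ContinuousOn (fun s => σ * φ (slicePt κ (dropCoord κ x) s)) (Icc 0 (R / 2)) :=
      fun s hs => (ContinuousAt.comp (f := fun s => slicePt κ (dropCoord κ x) s)
        (h.contDiffAt_φ (slicePt_mem_ball hs h.base h3)).continuousAt
        (hasDerivAt_slicePt _ _).continuousAt).continuousWithinAt.const_smul σ
    have hmem : σ * x κ ∈ Ioo (σ * φ (slicePt κ (dropCoord κ x) 0))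
        (σ * φ (slicePt κ (dropCoord κ x) (R / 2))) := by
      rw [slicePt_zero]
      unfold bdryFun at hpos
      constructor <;> linarith
    obtain ⟨s, hs, hsx⟩ := intermediate_value_Ioo (half_pos hR).le hc hmem
    have hsx' : φ (slicePt κ (dropCoord κ x) s) = x κ := mul_left_cancel₀ hσ0 hsx
    have := h.ext (slicePt κ (dropCoord κ x) s)
      (slicePt_mem_ball (Ioo_subset_Icc_self hs) h.base h3) (by simpa using hs.1)
    rw [chartMap_slicePt, hsx', slicePt_dropCoord] at this
    exact this
  · have h5 : bdryFun κ φ (dropCoord κ x) = x κ := by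
      have := (mul_eq_zero.1 h0).resolve_left hσ0
      linarith
    have h6 := h.bdry _ h2 (by simp)
    rw [← graphPt_bdryFun, graphPt_eq, h5, slicePt_dropCoord] at h6
    exact h6

theorem IsBoundaryChart.contDiffAt_bdryFun (h : IsBoundaryChart Ω f κ φ y H z₀ r R x₀) {a : E k}
    (ha : hyperplaneIncl κ a ∈ Metric.ball z₀ R) : ContDiffAt ℝ 2 (bdryFun κ φ) a :=
  (h.contDiffAt_φ ha).comp a (hyperplaneIncl κ).contDiff.contDiffAt

theorem pd_comp_hyperplaneIncl {g : E (k + 1) → ℝ} {a : E k}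
    (hg : DifferentiableAt ℝ g (hyperplaneIncl κ a)) (j : Fin k) :
    pd j (fun a => g (hyperplaneIncl κ a)) a = pd (κ.succAbove j) g (hyperplaneIncl κ a) := by
  have h1 : HasFDerivAt (fun a => g (hyperplaneIncl κ a)) _ a :=
    hg.hasFDerivAt.comp a (hyperplaneIncl κ).hasFDerivAt
  rw [pd, h1.fderiv, ContinuousLinearMap.comp_apply, hyperplaneIncl_single]
  rfl

theorem IsBoundaryChart.pd_bdryFun (h : IsBoundaryChart Ω f κ φ y H z₀ r R x₀) {a : E k}
    (ha : hyperplaneIncl κ a ∈ Metric.ball z₀ R) (j : Fin k) :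
    pd j (bdryFun κ φ) a = pd (κ.succAbove j) φ (hyperplaneIncl κ a) :=
  pd_comp_hyperplaneIncl ((h.contDiffAt_φ ha).differentiableAt two_ne_zero) j

theorem IsBoundaryChart.hess_bdryFun (h : IsBoundaryChart Ω f κ φ y H z₀ r R x₀) {a : E k}
    (ha : hyperplaneIncl κ a ∈ Metric.ball z₀ R) (i j : Fin k) :
    hess (bdryFun κ φ) a i j = hess φ (hyperplaneIncl κ a) (κ.succAbove i) (κ.succAbove j) := by
  have h1 : pd i (bdryFun κ φ) =ᶠ[𝓝 a] fun a => pd (κ.succAbove i) φ (hyperplaneIncl κ a) := by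
    filter_upwards [(hyperplaneIncl κ).continuous.continuousAt.eventually
      (Metric.isOpen_ball.mem_nhds ha)] with b hb
    exact h.pd_bdryFun hb i
  have h2 : DifferentiableAt ℝ (pd (κ.succAbove i) φ) (hyperplaneIncl κ a) :=
    ((contDiffOn_pd (N := 1) (by norm_num) Metric.isOpen_ball h.contDiffOn_φ _).contDiffAt
      (Metric.isOpen_ball.mem_nhds ha)).differentiableAt one_ne_zero
  change pd j (pd i (bdryFun κ φ)) a = _
  rw [pd_congr h1, pd_comp_hyperplaneIncl h2]
  rfl

open Matrix in
theorem IsBoundaryChart.chartVec_boundary_eq (h : IsBoundaryChart Ω f κ φ y H z₀ r R x₀) {a : E k}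
    (ha : hyperplaneIncl κ a ∈ Metric.ball z₀ R) :
    chartVec κ φ y (hyperplaneIncl κ a) κ =
      -(∑ j, hess (bdryFun κ φ) a j j - (areaSq (bdryFun κ φ) a)⁻¹ *
        ∑ i, ∑ j, pd i (bdryFun κ φ) a * (hess (bdryFun κ φ) a i j * pd j (bdryFun κ φ) a)) := by
  have h0 : pd κ φ (hyperplaneIncl κ a) = 0 := h.φ_bdry _ ha (by simp)
  rw [h.chartVec_boundary ha (by simp)]
  simp only [areaSq, h.pd_bdryFun ha, h.hess_bdryFun ha]
  have e1 : grad φ (hyperplaneIncl κ a) ⬝ᵥ grad φ (hyperplaneIncl κ a) =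
      ∑ j, pd (κ.succAbove j) φ (hyperplaneIncl κ a) ^ 2 := by
    simp [dotProduct, Fin.sum_univ_succAbove _ κ, grad, h0, sq]
  have e2 : (hess φ (hyperplaneIncl κ a)).trace - hess φ (hyperplaneIncl κ a) κ κ =
      ∑ j, hess φ (hyperplaneIncl κ a) (κ.succAbove j) (κ.succAbove j) := by
    simp [Matrix.trace, Fin.sum_univ_succAbove _ κ]
  have e3 : grad φ (hyperplaneIncl κ a) ⬝ᵥ (hess φ (hyperplaneIncl κ a) *ᵥ
      grad φ (hyperplaneIncl κ a)) = ∑ i, ∑ j, pd (κ.succAbove i) φ (hyperplaneIncl κ a) *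
        (hess φ (hyperplaneIncl κ a) (κ.succAbove i) (κ.succAbove j) *
          pd (κ.succAbove j) φ (hyperplaneIncl κ a)) := by
    simp [dotProduct, mulVec, Fin.sum_univ_succAbove _ κ, grad, h0, Finset.mul_sum]
  rw [e1, e2, e3]

/-- Along the boundary, the transverse component of the mass field is the mean curvature. -/
theorem IsBoundaryChart.exists_sign (h : IsBoundaryChart Ω f κ φ y H z₀ r R x₀) (hΩ : IsOpen Ω) :
    ∃ σ : ℝ, σ * σ = 1 ∧ (∀ z ∈ Metric.ball z₀ R, 0 < z κ → 0 < σ * pd κ φ z) ∧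
      ∀ᶠ x in 𝓝 x₀, hyperplaneIncl κ (dropCoord κ x) ∈ Metric.ball z₀ R ∧
        (x ∈ frontier Ω ↔ x κ = bdryFun κ φ (dropCoord κ x)) ∧
        (x ∈ frontier Ω → meanCurv Ω x * √(areaSq (bdryFun κ φ) (dropCoord κ x)) =
          σ * chartVec κ φ y (hyperplaneIncl κ (dropCoord κ x)) κ) := by
  obtain ⟨σ, hσσ, hσ⟩ := h.exists_sign_pd
  refine ⟨σ, hσσ, hσ, ?_⟩
  have hσ0 : σ ≠ 0 := fun h => by simp [h] at hσσ
  set w := bdryFun κ φ with hw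
  have hsides := h.eventually_sides hσσ hσ
  have hfr : ∀ᶠ x in 𝓝 x₀, x ∈ frontier Ω ↔ x κ = w (dropCoord κ x) := by
    filter_upwards [hsides] with x hx
    constructor
    · intro hxf
      by_contra hne
      obtain ⟨h1, h2⟩ := (mem_frontier_iff hΩ).1 hxf
      rcases lt_or_gt_of_ne (mul_ne_zero hσ0 (sub_ne_zero.2 hne)) with h3 | h3
      · exact h2 (hx.1 h3)
      · exact hx.2.1 h3 h1
    · intro he
      exact hx.2.2 (by rw [he, sub_self, mul_zero])
  have hnormal : ∀ᶠ x in 𝓝 x₀, x ∈ frontier Ω →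
      outerNormal Ω x = graphNormal κ σ w (dropCoord κ x) := by
    filter_upwards [hsides.eventually_nhds, hfr, h.eventually_mem_ball] with x h1 h2 h3 hxf
    refine IsOuterUnitNormal.outerNormal_eq (isOuterUnitNormal_of_hasFDerivAt
      (Real.sqrt_pos.2 (areaSq_pos w _)) (norm_graphNormal κ hσσ w _)
      (hasFDerivAt_graphDefining κ (σ := σ) ((h.contDiffAt_bdryFun h3).differentiableAt two_ne_zero))
      ?_ (h1.mono fun z hz => ⟨hz.1, hz.2.1⟩))
    rw [h2.1 hxf, sub_self, mul_zero]
  filter_upwards [hnormal.eventually_nhds, hfr.eventually_nhds, h.eventually_mem_ball] with x h1 h2 h3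
  refine ⟨h3, h2.self_of_nhds, fun hxf => ?_⟩
  set a := dropCoord κ x with ha
  have hxa : slicePt κ a (w a) = x := by
    rw [← h2.self_of_nhds.1 hxf, ha, slicePt_dropCoord]
  have hwa := h.contDiffAt_bdryFun h3
  have hνx := h1.self_of_nhds hxf
  have hND : DifferentiableAt ℝ (graphNormal κ σ w) a := by
    have hpd : ∀ j, DifferentiableAt ℝ (pd j w) a := fun j =>
      ((hwa.fderiv_right (m := 1) le_rfl).clm_apply contDiffAt_const).differentiableAt one_ne_zero
    have hW : DifferentiableAt ℝ (areaSq w) a := by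
      refine (differentiableAt_const _).add (DifferentiableAt.fun_sum fun j _ => ?_)
      exact (hpd j).pow 2
    have hgv : DifferentiableAt ℝ (gradVec w) a := differentiableAt_euclidean.2 fun j => hpd j
    refine DifferentiableAt.smul (((hW.sqrt (areaSq_pos w a).ne').inv
      (Real.sqrt_pos.2 (areaSq_pos w a)).ne').const_mul σ) ((differentiableAt_const _).sub
      ((hyperplaneIncl κ).differentiableAt.comp a hgv))
  have hN : HasFDerivAt (fun x => graphNormal κ σ w (dropCoord κ x))
      ((fderiv ℝ (graphNormal κ σ w) a).comp (dropCoord κ)) x :=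
    HasFDerivAt.comp (g := graphNormal κ σ w) x hND.hasFDerivAt (dropCoord κ).hasFDerivAt
  have hNW : HasFDerivWithinAt (outerNormal Ω)
      ((fderiv ℝ (graphNormal κ σ w) a).comp (dropCoord κ)) (frontier Ω) x :=
    hN.hasFDerivWithinAt.congr_of_eventuallyEq (eventually_nhdsWithin_iff.2 h1) hνx
  have hD := hNW.differentiableWithinAt.hasFDerivWithinAt
  set D := fderivWithin ℝ (outerNormal Ω) (frontier Ω) x with hDdef
  -- Derivatives within ∂Ω need not be unique, but on tangent vectors of the graph they are: the
  -- curve γ runs inside ∂Ω with the given velocity, and the chain rule along it determines the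
  -- value.
  have hDj : ∀ j, D (EuclideanSpace.single (κ.succAbove j) 1 + pd j w a • EuclideanSpace.single κ 1) =
      fderiv ℝ (graphNormal κ σ w) a (EuclideanSpace.single j 1) := by
    intro j
    have hγ : HasDerivAt (fun t : ℝ => slicePt κ (a + t • EuclideanSpace.single j 1)
        (w (a + t • EuclideanSpace.single j 1)))
        (EuclideanSpace.single (κ.succAbove j) 1 + pd j w a • EuclideanSpace.single κ 1) 0 := by
      have e1 := hasDerivAt_pd (hwa.differentiableAt two_ne_zero) j
      have e2 : HasDerivAt (fun t : ℝ => a + t • EuclideanSpace.single j (1 : ℝ))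
          (EuclideanSpace.single j 1) 0 := by
        simpa using ((hasDerivAt_id (0 : ℝ)).smul_const (EuclideanSpace.single j (1 : ℝ))).const_add a
      have e3 := ((hyperplaneIncl κ).hasFDerivAt.comp_hasDerivAt (0 : ℝ) e2).add
        (e1.smul_const (EuclideanSpace.single κ (1 : ℝ)))
      rw [hyperplaneIncl_single] at e3
      exact e3
    set γ := fun t : ℝ => slicePt κ (a + t • EuclideanSpace.single j 1)
        (w (a + t • EuclideanSpace.single j 1)) with hγdef
    have hγ0 : γ 0 = x := by simp [hγdef, hxa]
    set s := γ ⁻¹' frontier Ω with hs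
    have hs0 : s ∈ 𝓝 (0 : ℝ) := by
      have h4 := hγ.continuousAt.eventually (by rw [hγ0]; exact h2)
      filter_upwards [h4] with t ht
      exact ht.2 (by simp [hγdef])
    have key : ∀ {L : E (k + 1) →L[ℝ] E (k + 1)},
        HasFDerivWithinAt (outerNormal Ω) L (frontier Ω) x →
        HasDerivAt (outerNormal Ω ∘ γ) (L (EuclideanSpace.single (κ.succAbove j) 1 +
          pd j w a • EuclideanSpace.single κ 1)) 0 := fun {L} hL => by
      rw [← hγ0] at hL
      exact (hL.comp_hasDerivWithinAt (0 : ℝ) hγ.hasDerivWithinAt (fun t ht => ht)).hasDerivAt hs0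
    rw [(key hD).unique (key hNW)]
    simp only [ContinuousLinearMap.comp_apply]
    congr 1
    ext i
    simp
  have hmain := trace_sub_inner_graphNormal κ hσσ hwa hDj
  rw [meanCurv, hνx, ← hDdef, hmain, h.chartVec_boundary_eq h3]
  ring

end

section

variable {k : ℕ}

/-! ### Slicing and boundary layers -/

/-- The splitting of `E (k + 1)` into a coordinate and the remaining ones. -/
def sliceHomeo (κ : Fin (k + 1)) : E k × ℝ ≃ₜ E (k + 1) where
  toFun q := slicePt κ q.1 q.2
  invFun x := (dropCoord κ x, x κ)
  left_inv q := by simp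
  right_inv x := by simp
  continuous_toFun := continuous_slicePt κ
  continuous_invFun := (dropCoord κ).continuous.prodMk
    (EuclideanSpace.proj κ : E (k + 1) →L[ℝ] ℝ).continuous

theorem measurePreserving_sliceHomeo (κ : Fin (k + 1)) :
    MeasurePreserving (sliceHomeo κ) (volume.prod volume) volume := by
  have h1 : MeasurePreserving (fun q : E k × ℝ => (q.2, q.1.ofLp))
      (volume.prod volume) (volume.prod volume) :=
    (MeasurePreserving.prod (MeasurePreserving.id volume)
      (PiLp.volume_preserving_ofLp (Fin k))).comp Measure.measurePreserving_swap
  have h2 := (volume_preserving_piFinSuccAbove (fun _ : Fin (k + 1) => ℝ) κ).symm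
  have h3 := (PiLp.volume_preserving_toLp (Fin (k + 1))).comp (h2.comp h1)
  have h4 : (sliceHomeo κ : E k × ℝ → E (k + 1)) = (WithLp.toLp 2) ∘
      ((MeasurableEquiv.piFinSuccAbove (fun _ : Fin (k + 1) => ℝ) κ).symm ∘
        fun q : E k × ℝ => (q.2, q.1.ofLp)) := by
    funext q
    refine ext_succAbove κ ?_ ?_
    · refine (slicePt_same κ q.1 q.2).trans ?_
      exact (Fin.insertNth_apply_same (α := fun _ => ℝ) κ q.2 q.1.ofLp).symm
    · ext j
      refine (slicePt_succAbove κ q.1 q.2 j).trans ?_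
      exact (Fin.insertNth_apply_succAbove (α := fun _ => ℝ) κ q.2 q.1.ofLp j).symm
  rw [h4]
  exact h3

theorem integral_slice (κ : Fin (k + 1)) (g : E (k + 1) → ℝ) :
    ∫ q : E k × ℝ, g (slicePt κ q.1 q.2) = ∫ z, g z :=
  (measurePreserving_sliceHomeo κ).integral_comp (sliceHomeo κ).measurableEmbedding g

/-- Integrals against a kernel concentrating on a hyperplane converge to the integral over the
hyperplane. -/
theorem tendsto_integral_boundary_layer (κ : Fin (k + 1)) {v : E (k + 1) → ℝ} (hv : Continuous v)
    (hvc : HasCompactSupport v) {η : ℝ → ℝ} (hη : Continuous η) (hηc : HasCompactSupport η) :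
    Tendsto (fun ε : ℝ => ∫ z, v z * (ε⁻¹ * η (ε⁻¹ * z κ))) (𝓝[>] 0)
      (𝓝 ((∫ a, v (hyperplaneIncl κ a)) * ∫ t, η t)) := by
  set K : Set (E k) := dropCoord κ '' tsupport v with hK
  have hKc : IsCompact K := hvc.isCompact.image (dropCoord κ).continuous
  have hvK : ∀ a t, a ∉ K → v (slicePt κ a t) = 0 := fun a t ha => by
    by_contra h
    exact ha ⟨_, subset_tsupport v h, by simp⟩
  -- The substitution z_κ = ε t absorbs the kernel's factor ε⁻¹. The resulting integrand is jointly
  -- continuous in ε, up to ε = 0, and supported in a fixed compact set.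
  set G : ℝ → E k × ℝ → ℝ := fun ε q => v (slicePt κ q.1 (ε * q.2)) * η q.2 with hG
  have hGc : Continuous G.uncurry := by
    have h1 : Continuous fun p : ℝ × E k × ℝ => slicePt κ p.2.1 (p.1 * p.2.2) :=
      (continuous_slicePt κ).comp (f := fun p : ℝ × E k × ℝ => (p.2.1, p.1 * p.2.2)) (by fun_prop)
    exact (hv.comp h1).mul (hη.comp (by fun_prop))
  have hGsupp : ∀ ε q, q ∉ K ×ˢ tsupport η → G ε q = 0 := fun ε q hq => by
    rw [mem_prod, not_and_or] at hq
    rcases hq with hq | hq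
    · simp [hG, hvK _ _ hq]
    · simp [hG, image_eq_zero_of_notMem_tsupport hq]
  have hGint : ∀ ε, Integrable (G ε) (volume.prod volume) := fun ε =>
    (hGc.comp (by fun_prop : Continuous fun q : E k × ℝ => (ε, q))).integrable_of_hasCompactSupport
      (HasCompactSupport.intro (hKc.prod hηc.isCompact) (hGsupp ε))
  have hcont : Continuous fun ε => ∫ q in K ×ˢ tsupport η, G ε q :=
    continuous_parametric_integral_of_continuous hGc (hKc.prod hηc.isCompact)
  have hfull : ∀ ε, ∫ q in K ×ˢ tsupport η, G ε q = ∫ q, G ε q := fun ε =>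
    setIntegral_eq_integral_of_forall_compl_eq_zero fun q hq => hGsupp ε q hq
  have h0 : ∫ q, G 0 q = (∫ a, v (hyperplaneIncl κ a)) * ∫ t, η t := by
    rw [← integral_prod_mul]
    simp [hG, slicePt_zero]
    rfl
  have hlim : Tendsto (fun ε => ∫ q, G ε q) (𝓝[>] 0) (𝓝 ((∫ a, v (hyperplaneIncl κ a)) * ∫ t, η t)) := by
    simp only [← h0, ← hfull]
    exact hcont.continuousAt.mono_left nhdsWithin_le_nhds
  refine hlim.congr' ?_
  filter_upwards [self_mem_nhdsWithin] with ε hε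
  have hε : 0 < ε := hε
  rw [← integral_slice κ]
  have hint : Integrable (fun q : E k × ℝ => v (slicePt κ q.1 q.2) *
      (ε⁻¹ * η (ε⁻¹ * slicePt κ q.1 q.2 κ))) (volume.prod volume) := by
    refine Continuous.integrable_of_hasCompactSupport ?_ ?_
    · have := continuous_slicePt κ
      simp only [slicePt_same]
      exact (hv.comp this).mul (continuous_const.mul (hη.comp (by fun_prop)))
    · have hsup : HasCompactSupport (v ∘ sliceHomeo κ) := hvc.comp_homeomorph _
      exact hsup.mul_right
  change ∫ q, G ε q ∂(volume.prod volume) = ∫ q, _ ∂(volume.prod volume)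
  rw [integral_prod _ (hGint ε), integral_prod _ hint]
  refine integral_congr_ae (Eventually.of_forall fun a => ?_)
  simp only [hG, slicePt_same]
  have := Measure.integral_comp_mul_left
    (fun t => v (slicePt κ a t) * (ε⁻¹ * η (ε⁻¹ * t))) ε
  rw [abs_of_pos (inv_pos.2 hε)] at this
  rw [← mul_right_inj' (inv_ne_zero hε.ne'), ← smul_eq_mul, ← smul_eq_mul, ← this, ← integral_smul]
  refine integral_congr_ae (Eventually.of_forall fun t => ?_)
  simp only [smul_eq_mul]
  rw [← mul_assoc ε⁻¹ ε t, inv_mul_cancel₀ hε.ne', one_mul]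
  ring

/-- A smooth step from `0` to `1`. -/
def stepFun (t : ℝ) : ℝ := Real.smoothTransition (t - 1)

theorem contDiff_stepFun : ContDiff ℝ 2 stepFun :=
  Real.smoothTransition.contDiff.comp (contDiff_id.sub contDiff_const)

theorem stepFun_of_le {t : ℝ} (h : t ≤ 1) : stepFun t = 0 :=
  Real.smoothTransition.zero_of_nonpos (by linarith)

theorem stepFun_of_ge {t : ℝ} (h : 2 ≤ t) : stepFun t = 1 :=
  Real.smoothTransition.one_of_one_le (by linarith)

theorem stepFun_mem (t : ℝ) : 0 ≤ stepFun t ∧ stepFun t ≤ 1 :=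
  ⟨Real.smoothTransition.nonneg _, Real.smoothTransition.le_one _⟩

theorem deriv_stepFun_of_notMem {t : ℝ} (h : t ∉ Icc (1 : ℝ) 2) : deriv stepFun t = 0 := by
  rw [mem_Icc, not_and_or, not_le, not_le] at h
  rcases h with h | h
  · have : stepFun =ᶠ[𝓝 t] fun _ => 0 := by
      filter_upwards [gt_mem_nhds h] with s hs using stepFun_of_le hs.le
    rw [this.deriv_eq, deriv_const]
  · have : stepFun =ᶠ[𝓝 t] fun _ => 1 := by
      filter_upwards [lt_mem_nhds h] with s hs using stepFun_of_ge hs.le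
    rw [this.deriv_eq, deriv_const]

theorem continuous_deriv_stepFun : Continuous (deriv stepFun) :=
  contDiff_stepFun.continuous_deriv (by norm_num)

theorem hasCompactSupport_deriv_stepFun : HasCompactSupport (deriv stepFun) :=
  HasCompactSupport.intro isCompact_Icc fun _ h => deriv_stepFun_of_notMem h

theorem integral_deriv_stepFun : ∫ t, deriv stepFun t = 1 := by
  have h1 : ∫ t in Ioc (1 / 2 : ℝ) 2, deriv stepFun t = ∫ t, deriv stepFun t :=
    setIntegral_eq_integral_of_forall_compl_eq_zero fun t ht => deriv_stepFun_of_notMem fun h =>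
      ht ⟨by linarith [h.1], h.2⟩
  rw [← h1, ← intervalIntegral.integral_of_le (by norm_num), intervalIntegral.integral_deriv_eq_sub
    (fun t _ => contDiff_stepFun.differentiable (by norm_num) t)
    (continuous_deriv_stepFun.intervalIntegrable _ _), stepFun_of_ge le_rfl,
    stepFun_of_le (by norm_num), sub_zero]

end

section

/-! ### Integration in a boundary chart -/

section

variable {k : ℕ}

open Classical in
/-- The even extension, across the hyperplane `z_κ = 0`, of a function on a half-ball, by `0` outside
of the ball. -/
def evenExt (κ : Fin (k + 1)) (z₀ : E (k + 1)) (R : ℝ) (g : E (k + 1) → ℝ) (z : E (k + 1)) : ℝ :=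
  if z ∈ Metric.ball z₀ R then g (slicePt κ (dropCoord κ z) |z κ|) else 0

variable {κ : Fin (k + 1)} {z₀ : E (k + 1)} {r R : ℝ} {g : E (k + 1) → ℝ}

theorem evenExt_of_nonneg {z : E (k + 1)} (hz : z ∈ Metric.ball z₀ R) (h0 : 0 ≤ z κ) :
    evenExt κ z₀ R g z = g z := by
  rw [evenExt, if_pos hz, abs_of_nonneg h0, slicePt_dropCoord]

theorem evenExt_of_notMem {z : E (k + 1)} (hz : z ∉ Metric.ball z₀ R) :
    evenExt κ z₀ R g z = 0 := if_neg hz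

theorem reflect_mem_ball (h0 : z₀ κ = 0) (z : E (k + 1)) (ρ : ℝ) :
    slicePt κ (dropCoord κ z) |z κ| ∈ Metric.ball z₀ ρ ↔ z ∈ Metric.ball z₀ ρ := by
  have : ‖slicePt κ (dropCoord κ z) |z κ| - z₀‖ = ‖z - z₀‖ := by
    have h : ‖slicePt κ (dropCoord κ z) |z κ| - z₀‖ ^ 2 = ‖z - z₀‖ ^ 2 := by
      rw [norm_sq_eq_slice κ, norm_sq_eq_slice κ (z - z₀)]
      simp [h0]
    exact (pow_left_inj₀ (norm_nonneg _) (norm_nonneg _) two_ne_zero).1 h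
  rw [mem_ball_iff_norm, mem_ball_iff_norm, this]

theorem support_evenExt (h0 : z₀ κ = 0)
    (hsupp : ∀ z ∈ Metric.ball z₀ R, 0 ≤ z κ → z ∉ Metric.ball z₀ r → g z = 0) {z : E (k + 1)}
    (hz : z ∉ Metric.ball z₀ r) : evenExt κ z₀ R g z = 0 := by
  by_cases hR : z ∈ Metric.ball z₀ R
  · rw [evenExt, if_pos hR]
    exact hsupp _ ((reflect_mem_ball h0 z R).2 hR) (by simp) fun h =>
      hz ((reflect_mem_ball h0 z r).1 h)
  · exact evenExt_of_notMem hR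

/-- Reflection makes the function continuous across the hyperplane; vanishing outside the smaller
ball makes it continuous across the sphere of radius R. The extension lets a function on a half-ball
enter the boundary layer limit. -/
theorem continuous_evenExt (h0 : z₀ κ = 0) (hrR : r < R)
    (hg : ContinuousOn g (Metric.ball z₀ R ∩ {z | 0 ≤ z κ}))
    (hsupp : ∀ z ∈ Metric.ball z₀ R, 0 ≤ z κ → z ∉ Metric.ball z₀ r → g z = 0) :
    Continuous (evenExt κ z₀ R g) := by
  refine continuous_iff_continuousAt.2 fun z => ?_
  by_cases hz : z ∈ Metric.ball z₀ R
  · have hc : Continuous fun z : E (k + 1) => slicePt κ (dropCoord κ z) |z κ| :=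
      (continuous_slicePt κ).comp ((dropCoord κ).continuous.prodMk
        (EuclideanSpace.proj κ : E (k + 1) →L[ℝ] ℝ).continuous.abs)
    have h1 : ContinuousOn (fun z => g (slicePt κ (dropCoord κ z) |z κ|)) (Metric.ball z₀ R) :=
      hg.comp hc.continuousOn fun z hz => ⟨(reflect_mem_ball h0 z R).2 hz, by simp⟩
    refine (h1.continuousAt (Metric.isOpen_ball.mem_nhds hz)).congr ?_
    filter_upwards [Metric.isOpen_ball.mem_nhds hz] with w hw
    rw [evenExt, if_pos hw]
  · have hz' : z ∈ (Metric.closedBall z₀ r)ᶜ := fun h =>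
      hz (Metric.closedBall_subset_ball hrR h)
    refine continuousAt_const.congr (f := fun _ => (0 : ℝ)) ?_
    filter_upwards [Metric.isClosed_closedBall.isOpen_compl.mem_nhds hz'] with w hw
    exact (support_evenExt h0 hsupp fun h => hw (Metric.ball_subset_closedBall h)).symm

theorem hasCompactSupport_evenExt (h0 : z₀ κ = 0)
    (hsupp : ∀ z ∈ Metric.ball z₀ R, 0 ≤ z κ → z ∉ Metric.ball z₀ r → g z = 0) :
    HasCompactSupport (evenExt κ z₀ R g) :=
  HasCompactSupport.intro (isCompact_closedBall z₀ r) fun _ hz =>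
    support_evenExt h0 hsupp fun h => hz (Metric.ball_subset_closedBall h)

theorem graphPt_injective (w : E k → ℝ) : Function.Injective (graphPt κ w) := fun a b h => by
  have := congrArg (dropCoord κ) h
  simpa [graphPt_eq] using this

/-- Integration over a graph with respect to the Hausdorff measure. -/
theorem integrable_graph_iff {w : E k → ℝ} {U : Set (E k)} (hU : IsOpen U) (hw : ContDiffOn ℝ 1 w U)
    (G : E (k + 1) → ℝ) :
    (Integrable G ((Measure.euclideanHausdorffMeasure k).restrict (graphPt κ w '' U)) ↔
      IntegrableOn (fun a => √(areaSq w a) * G (graphPt κ w a)) U) ∧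
    ∫ x, G x ∂((Measure.euclideanHausdorffMeasure k).restrict (graphPt κ w '' U)) =
      ∫ a in U, √(areaSq w a) * G (graphPt κ w a) := by
  classical
  -- w is controlled only on U. Modifying it off U makes the graph map a global measurable embedding
  -- without changing it almost everywhere for the density on U.
  set w' : E k → ℝ := U.piecewise w 0 with hw'
  have hw'm : Measurable w' := hw.continuousOn.measurable_piecewise continuousOn_const hU.measurableSet
  have hm : Measurable (graphPt κ w') := by
    unfold graphPt
    exact (hyperplaneIncl κ).continuous.measurable.add (hw'm.smul_const _)
  have hemb : MeasurableEmbedding (graphPt κ w') := hm.measurableEmbedding (graphPt_injective w')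
  have heq : ∀ a ∈ U, graphPt κ w a = graphPt κ w' a := fun a ha => by
    simp [graphPt, hw', ha]
  have hae : graphPt κ w =ᵐ[(volume.restrict U).withDensity
      fun a => ENNReal.ofReal √(1 + ∑ j, pd j w a ^ 2)] graphPt κ w' :=
    (withDensity_absolutelyContinuous _ _).ae_le (ae_restrict_of_forall_mem hU.measurableSet heq)
  have hdens : AEMeasurable (fun a => ENNReal.ofReal √(1 + ∑ j, pd j w a ^ 2)) (volume.restrict U) := by
    have : ContinuousOn (fun a => √(1 + ∑ j, pd j w a ^ 2)) U :=
      (continuousOn_const.add (continuousOn_finsetSum _ fun j _ =>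
        (contDiffOn_pd (N := 0) (by norm_num) hU hw j).continuousOn.pow 2)).sqrt
    exact (this.aemeasurable hU.measurableSet).ennreal_ofReal
  rw [hausdorffMeasure_restrict_graph κ hU hw, Measure.map_congr hae, hemb.integrable_map_iff,
    hemb.integral_map, integrable_withDensity_iff_integrable_smul₀' hdens (by simp),
    integral_withDensity_eq_integral_toReal_smul₀ hdens (by simp)]
  have hfun : ∀ a ∈ U, (ENNReal.ofReal √(1 + ∑ j, pd j w a ^ 2)).toReal • G (graphPt κ w' a) =
      √(areaSq w a) * G (graphPt κ w a) := fun a ha => by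
    rw [ENNReal.toReal_ofReal (Real.sqrt_nonneg _), heq a ha]; rfl
  exact ⟨integrable_congr (ae_restrict_of_forall_mem hU.measurableSet hfun),
    setIntegral_congr_fun hU.measurableSet hfun⟩

end

variable {m k : ℕ} {Ω : Set (E (k + 1))} {f : E (k + 1) → E m} {κ : Fin (k + 1)}
  {φ : E (k + 1) → ℝ} {y : E (k + 1) → E m} {H : E (k + 1) → ℝ} {z₀ x₀ : E (k + 1)} {r R : ℝ}

/-- The image point determines z_κ through H, and the other coordinates are not moved. -/
theorem IsBoundaryChart.injOn (h : IsBoundaryChart Ω f κ φ y H z₀ r R x₀) :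
    InjOn (chartMap κ φ) (Metric.ball z₀ R ∩ {z | 0 ≤ z κ}) := fun z hz z' hz' he => by
  refine ext_succAbove κ ?_ ?_
  · rw [← h.height z hz.1 hz.2, ← h.height z' hz'.1 hz'.2, he]
  · rw [← dropCoord_chartMap κ φ z, he, dropCoord_chartMap]

theorem IsBoundaryChart.map_mem_compl (h : IsBoundaryChart Ω f κ φ y H z₀ r R x₀) (hΩ : IsOpen Ω)
    {z : E (k + 1)} (hz : z ∈ Metric.ball z₀ R) (h0 : 0 ≤ z κ) : chartMap κ φ z ∈ Ωᶜ := by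
  rcases h0.eq_or_lt with h0 | h0
  · exact ((mem_frontier_iff hΩ).1 (h.bdry z hz h0.symm)).2
  · exact fun hx => h.ext z hz h0 (subset_closure hx)

/-- The part of V outside Ω is already covered by the smaller ball, and injectivity on the larger
half-ball allows no other preimage. Functions supported in V thus pull back to functions supported
in the smaller ball. -/
theorem IsBoundaryChart.mem_ball_of_map_mem (h : IsBoundaryChart Ω f κ φ y H z₀ r R x₀)
    (hΩ : IsOpen Ω) {V : Set (E (k + 1))}
    (hV : ∀ x ∈ V, x ∈ Ωᶜ → ∃ z ∈ Metric.ball z₀ r, 0 ≤ z κ ∧ chartMap κ φ z = x)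
    {z : E (k + 1)} (hz : z ∈ Metric.ball z₀ R) (h0 : 0 ≤ z κ) (hzV : chartMap κ φ z ∈ V) :
    z ∈ Metric.ball z₀ r := by
  obtain ⟨z', hz', h0', he⟩ := hV _ hzV (h.map_mem_compl hΩ hz h0)
  rwa [← h.injOn ⟨Metric.ball_subset_ball h.r_lt.le hz', h0'⟩ ⟨hz, h0⟩ he]

theorem measurableSet_halfBall : MeasurableSet (Metric.ball z₀ r ∩ {z : E (k + 1) | 0 < z κ}) :=
  Metric.isOpen_ball.measurableSet.inter (isOpen_lt continuous_const
    (EuclideanSpace.proj κ : E (k + 1) →L[ℝ] ℝ).continuous).measurableSet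

/-- Change of variables by a boundary chart. -/
theorem IsBoundaryChart.changeVars (h : IsBoundaryChart Ω f κ φ y H z₀ r R x₀)
    {V : Set (E (k + 1))}
    (hV : ∀ x ∈ V, x ∈ Ωᶜ → ∃ z ∈ Metric.ball z₀ r, 0 ≤ z κ ∧ chartMap κ φ z = x)
    {G : E (k + 1) → ℝ} (hG : ∀ x, x ∉ V → G x = 0) :
    (IntegrableOn G (closure Ω)ᶜ ↔ IntegrableOn (fun z => |pd κ φ z| * G (chartMap κ φ z))
      (Metric.ball z₀ r ∩ {z | 0 < z κ})) ∧
    ∫ x in (closure Ω)ᶜ, G x =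
      ∫ z in Metric.ball z₀ r ∩ {z | 0 < z κ}, |pd κ φ z| * G (chartMap κ φ z) := by
  set S : Set (E (k + 1)) := Metric.ball z₀ r ∩ {z | 0 < z κ} with hS
  have hSm : MeasurableSet S := measurableSet_halfBall
  have hSR : ∀ z ∈ S, z ∈ Metric.ball z₀ R := fun z hz => Metric.ball_subset_ball h.r_lt.le hz.1
  have hd : ∀ z ∈ S, DifferentiableAt ℝ φ z := fun z hz =>
    (h.contDiffAt_φ (hSR z hz)).differentiableAt two_ne_zero
  have hder : ∀ z ∈ S, HasFDerivWithinAt (chartMap κ φ) (fderiv ℝ (chartMap κ φ) z) S z :=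
    fun z hz => (hasFDerivAt_chartMap κ (hd z hz)).differentiableAt.hasFDerivAt.hasFDerivWithinAt
  have hSB : S ⊆ Metric.ball z₀ R ∩ {z | 0 ≤ z κ} := fun z hz =>
    ⟨hSR z hz, le_of_lt (show 0 < z κ from hz.2)⟩
  have hinj : InjOn (chartMap κ φ) S := h.injOn.mono hSB
  have hsub : chartMap κ φ '' S ⊆ (closure Ω)ᶜ := by
    rintro _ ⟨z, hz, rfl⟩
    exact h.ext z (hSR z hz) hz.2
  -- An exterior point of V has a preimage with z_κ ≥ 0, and z_κ = 0 is impossible because it would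
  -- put the point on ∂Ω.
  have hzero : ∀ x ∈ (closure Ω)ᶜ \ (chartMap κ φ '' S), G x = 0 := fun x hx => by
    refine hG x fun hxV => hx.2 ?_
    obtain ⟨z, hz, h0, he⟩ := hV x hxV fun hxΩ => hx.1 (subset_closure hxΩ)
    refine ⟨z, ⟨hz, h0.lt_of_ne fun h0 => hx.1 ?_⟩, he⟩
    rw [← he]
    exact frontier_subset_closure (h.bdry z (Metric.ball_subset_ball h.r_lt.le hz) h0.symm)
  have hm : MeasurableSet (closure Ω)ᶜ := isClosed_closure.measurableSet.compl
  have hfun : ∀ z ∈ S, |(fderiv ℝ (chartMap κ φ) z).det| • G (chartMap κ φ z) =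
      |pd κ φ z| * G (chartMap κ φ z) := fun z hz => by
    rw [det_fderiv_chartMap κ (hd z hz), smul_eq_mul]
  constructor
  · rw [← integrableOn_congr_fun hfun hSm,
      ← integrableOn_image_iff_integrableOn_abs_det_fderiv_smul volume hSm hder hinj]
    exact ⟨fun hi => hi.mono_set hsub, fun hi => hi.of_forall_sdiff_eq_zero hm hzero⟩
  · rw [← setIntegral_congr_fun hSm hfun,
      ← integral_image_eq_integral_abs_det_fderiv_smul volume hSm hder hinj]
    exact setIntegral_eq_of_subset_of_forall_sdiff_eq_zero hm hsub hzero

end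

/-! ### Green's formula near a boundary point -/

section

/-- The divergence theorem for the mass field on the complement of `Ω`, tested against `ζ`. -/
def GreenHolds {n m : ℕ} (Ω : Set (E n)) (f : E n → E m) (ζ : E n → ℝ) : Prop :=
  IntegrableOn (fun x => fderiv ℝ ζ x (massField f x)) (closure Ω)ᶜ ∧
  Integrable (fun x => ζ x * meanCurv Ω x) (boundaryArea Ω) ∧
  ∫ x in (closure Ω)ᶜ, (fderiv ℝ ζ x (massField f x) + ζ x * massDiv f x) =
    -∫ x, ζ x * meanCurv Ω x ∂(boundaryArea Ω)

variable {m k : ℕ} {Ω : Set (E (k + 1))} {f : E (k + 1) → E m} {κ : Fin (k + 1)}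
  {φ : E (k + 1) → ℝ} {y : E (k + 1) → E m} {H : E (k + 1) → ℝ} {z₀ x₀ : E (k + 1)} {r R : ℝ}

/-- The boundary term of the divergence theorem in a boundary chart. -/
theorem IsBoundaryChart.boundary_integral (h : IsBoundaryChart Ω f κ φ y H z₀ r R x₀)
    {V : Set (E (k + 1))}
    {σ : ℝ} (hH : ∀ x ∈ V, hyperplaneIncl κ (dropCoord κ x) ∈ Metric.ball z₀ R ∧
        (x ∈ frontier Ω ↔ x κ = bdryFun κ φ (dropCoord κ x)) ∧
        (x ∈ frontier Ω → meanCurv Ω x * √(areaSq (bdryFun κ φ) (dropCoord κ x)) =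
          σ * chartVec κ φ y (hyperplaneIncl κ (dropCoord κ x)) κ))
    {ζ : E (k + 1) → ℝ} (hζ0 : ∀ x, x ∉ V → ζ x = 0)
    (hv : Continuous (evenExt κ z₀ R fun z => ζ (chartMap κ φ z) * chartVec κ φ y z κ))
    (hvc : HasCompactSupport (evenExt κ z₀ R fun z => ζ (chartMap κ φ z) * chartVec κ φ y z κ)) :
    Integrable (fun x => ζ x * meanCurv Ω x) (boundaryArea Ω) ∧
    ∫ x, ζ x * meanCurv Ω x ∂(boundaryArea Ω) =
      σ * ∫ a, evenExt κ z₀ R (fun z => ζ (chartMap κ φ z) * chartVec κ φ y z κ)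
        (hyperplaneIncl κ a) := by
  set v := evenExt κ z₀ R fun z => ζ (chartMap κ φ z) * chartVec κ φ y z κ with hvdef
  set w := bdryFun κ φ with hw
  set U : Set (E k) := hyperplaneIncl κ ⁻¹' Metric.ball z₀ R with hUdef
  have hU : IsOpen U := Metric.isOpen_ball.preimage (hyperplaneIncl κ).continuous
  have hw1 : ContDiffOn ℝ 1 w U := fun a ha =>
    ((h.contDiffAt_bdryFun ha).of_le (by norm_num)).contDiffWithinAt
  have hgraph : graphPt κ w '' U ⊆ frontier Ω := by
    rintro _ ⟨a, ha, rfl⟩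
    rw [graphPt_bdryFun]
    exact h.bdry _ ha (by simp)
  have hzero : ∀ x ∈ frontier Ω \ (graphPt κ w '' U), ζ x * meanCurv Ω x = 0 := fun x hx => by
    rw [hζ0 x fun hxV => hx.2 ?_, zero_mul]
    refine ⟨dropCoord κ x, (hH x hxV).1, ?_⟩
    rw [graphPt_eq, ← (hH x hxV).2.1.1 hx.1, slicePt_dropCoord]
  -- Area density times mean curvature is σ times the transverse component of the transformed mass
  -- field, by `exists_sign`.
  have hfun : ∀ a ∈ U, √(areaSq w a) * (ζ (graphPt κ w a) * meanCurv Ω (graphPt κ w a)) =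
      σ * v (hyperplaneIncl κ a) := fun a ha => by
    rw [hvdef, evenExt_of_nonneg ha (by simp), ← graphPt_bdryFun]
    by_cases hV' : graphPt κ w a ∈ V
    · have h1 := (hH _ hV').2.2 (hgraph ⟨a, ha, rfl⟩)
      rw [graphPt_eq, dropCoord_slicePt] at h1
      rw [← hw, graphPt_eq]
      linear_combination ζ (slicePt κ a (w a)) * h1
    · rw [← hw, hζ0 _ hV']; ring
  have hout : ∀ a, a ∉ U → v (hyperplaneIncl κ a) = 0 := fun a ha => evenExt_of_notMem ha
  have hint : Integrable (fun a => v (hyperplaneIncl κ a)) := by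
    refine (hv.comp (hyperplaneIncl κ).continuous).integrable_of_hasCompactSupport ?_
    refine HasCompactSupport.intro (hvc.isCompact.image (dropCoord κ).continuous) fun a ha => ?_
    by_contra hne
    exact ha ⟨_, subset_tsupport v hne, by simp⟩
  have hm : MeasurableSet (frontier Ω) := isClosed_frontier.measurableSet
  obtain ⟨hi, he⟩ := integrable_graph_iff (κ := κ) hU hw1 fun x => ζ x * meanCurv Ω x
  have hba : boundaryArea Ω = (Measure.euclideanHausdorffMeasure k).restrict (frontier Ω) := rfl
  rw [hba]
  constructor
  · have h1 : IntegrableOn (fun x => ζ x * meanCurv Ω x) (graphPt κ w '' U)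
        (Measure.euclideanHausdorffMeasure k) :=
      hi.2 ((integrableOn_congr_fun hfun hU.measurableSet).2 (hint.const_mul σ).integrableOn)
    exact h1.of_forall_sdiff_eq_zero hm hzero
  · rw [setIntegral_eq_of_subset_of_forall_sdiff_eq_zero hm hgraph hzero, he,
      setIntegral_congr_fun hU.measurableSet hfun, setIntegral_eq_integral_of_forall_compl_eq_zero
      (fun a ha => by rw [hout a ha, mul_zero]), integral_const_mul]

/-- The divergence theorem for the mass field near a boundary point. -/
theorem IsBoundaryChart.green_local (h : IsBoundaryChart Ω f κ φ y H z₀ r R x₀) (hΩ : IsOpen Ω)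
    (hf : ContDiffOn ℝ 2 f (closure Ω)ᶜ) (hQ : IntegrableOn (massDiv f) (closure Ω)ᶜ) :
    ∃ V ∈ 𝓝 x₀, ∀ ζ : E (k + 1) → ℝ, ContDiff ℝ 1 ζ → HasCompactSupport ζ → tsupport ζ ⊆ V →
      GreenHolds Ω f ζ := by
  obtain ⟨σ, hσσ, hσ, hev⟩ := h.exists_sign hΩ
  have hσabs : |σ| = 1 := by
    have := abs_mul_abs_self σ
    rw [hσσ] at this
    nlinarith [abs_nonneg σ]
  -- The neighbourhood consists of the points with the three local properties: covered by the chart,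
  -- described as a graph with known mean curvature, and continuity of H.
  refine ⟨_, h.surj.and (hev.and h.continuousWithinAt_height), fun ζ hζ hζc hζV => ?_⟩
  set V : Set (E (k + 1)) := tsupport ζ with hVdef
  have hV1 : ∀ x ∈ V, x ∈ Ωᶜ → ∃ z ∈ Metric.ball z₀ r, 0 ≤ z κ ∧ chartMap κ φ z = x :=
    fun x hx => (hζV hx).1
  have hV3 : ∀ x ∈ V, x ∈ Ωᶜ → ContinuousWithinAt H Ωᶜ x := fun x hx => (hζV hx).2.2
  have hζ0 : ∀ x, x ∉ V → ζ x = 0 := fun x hx => image_eq_zero_of_notMem_tsupport hx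
  have hdζ0 : ∀ x, x ∉ V → fderiv ℝ ζ x = 0 := fun x hx => by
    have : ζ =ᶠ[𝓝 x] fun _ => 0 := by
      filter_upwards [(isClosed_tsupport ζ).isOpen_compl.mem_nhds hx] with y hy using hζ0 y hy
    rw [this.fderiv_eq]; simp
  set B : Set (E (k + 1)) := Metric.ball z₀ R ∩ {z | 0 ≤ z κ} with hB
  set S : Set (E (k + 1)) := Metric.ball z₀ r ∩ {z | 0 < z κ} with hS
  have hSm : MeasurableSet S := measurableSet_halfBall
  have hSR : ∀ z ∈ S, z ∈ Metric.ball z₀ R := fun z hz => Metric.ball_subset_ball h.r_lt.le hz.1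
  have hKc : IsCompact (Metric.closedBall z₀ r ∩ {z : E (k + 1) | 0 ≤ z κ}) :=
    (isCompact_closedBall z₀ r).inter_right (isClosed_le continuous_const
      (EuclideanSpace.proj κ : E (k + 1) →L[ℝ] ℝ).continuous)
  have hKB : Metric.closedBall z₀ r ∩ {z : E (k + 1) | 0 ≤ z κ} ⊆ B := fun z hz =>
    ⟨Metric.closedBall_subset_ball h.r_lt hz.1, hz.2⟩
  have hSK : S ⊆ Metric.closedBall z₀ r ∩ {z : E (k + 1) | 0 ≤ z κ} := fun z hz =>
    ⟨Metric.ball_subset_closedBall hz.1, le_of_lt (show 0 < z κ from hz.2)⟩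
  -- continuity in the chart
  have hTc : ContDiffOn ℝ 1 (fun z => ζ (chartMap κ φ z)) (Metric.ball z₀ R) := fun z hz =>
    (hζ.contDiffAt.comp z (contDiffAt_chartMap κ ((h.contDiffAt_φ hz).of_le
      (by norm_num)))).contDiffWithinAt
  have hYc := h.continuousOn_chartVec
  have hYκ : ContinuousOn (fun z => chartVec κ φ y z κ) B :=
    (EuclideanSpace.proj κ : E (k + 1) →L[ℝ] ℝ).continuous.comp_continuousOn hYc
  set g : E (k + 1) → ℝ := fun z => ζ (chartMap κ φ z) * chartVec κ φ y z κ with hg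
  have hgc : ContinuousOn g B := (hTc.continuousOn.mono inter_subset_left).mul hYκ
  have hgsupp : ∀ z ∈ Metric.ball z₀ R, 0 ≤ z κ → z ∉ Metric.ball z₀ r → g z = 0 :=
    fun z hz h0 hzr => by
      simp only [hg]
      rw [hζ0 _ fun hzV => hzr (h.mem_ball_of_map_mem hΩ hV1 hz h0 hzV), zero_mul]
  have hvcont := continuous_evenExt h.base h.r_lt hgc hgsupp
  have hvcomp := hasCompactSupport_evenExt h.base hgsupp
  set v := evenExt κ z₀ R g with hv
  obtain ⟨hbi, hbe⟩ := h.boundary_integral (σ := σ) (fun x hx => (hζV hx).2.1) hζ0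
    hvcont hvcomp
  -- integrability of the flux
  have habs : ∀ z ∈ S, |pd κ φ z| = σ * pd κ φ z := fun z hz => by
    have h1 := hσ z (hSR z hz) hz.2
    rw [← abs_of_pos h1, abs_mul, hσabs, one_mul]
  have hflux : ∀ z ∈ S, |pd κ φ z| * fderiv ℝ ζ (chartMap κ φ z) (massField f (chartMap κ φ z)) =
      σ * fderiv ℝ (fun z => ζ (chartMap κ φ z)) z (chartVec κ φ y z) := fun z hz => by
    rw [habs z hz, mul_assoc, h.pd_mul_fderiv_massField hf (hSR z hz) hz.2
      (hζ.differentiable one_ne_zero _)]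
  have hflc : ContinuousOn (fun z => σ * fderiv ℝ (fun z => ζ (chartMap κ φ z)) z
      (chartVec κ φ y z)) B :=
    continuousOn_const.mul (((hTc.continuousOn_fderiv_of_isOpen Metric.isOpen_ball le_rfl).mono
      inter_subset_left).clm_apply hYc)
  -- After the change of variables the flux density is continuous up to z_κ = 0 on a compact
  -- half-ball, even though X itself may be unbounded near ∂Ω.
  have hi1 : IntegrableOn (fun x => fderiv ℝ ζ x (massField f x)) (closure Ω)ᶜ := by
    refine (h.changeVars hV1 fun x hx => by rw [hdζ0 x hx]; rfl).1.2 ?_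
    refine (integrableOn_congr_fun hflux hSm).2 ?_
    exact ((hflc.mono hKB).integrableOn_compact hKc).mono_set hSK
  obtain ⟨C, hC⟩ := hζc.exists_bound_of_continuous hζ.continuous
  have hi2 : IntegrableOn (fun x => ζ x * massDiv f x) (closure Ω)ᶜ :=
    Integrable.bdd_mul hQ hζ.continuous.aestronglyMeasurable (Eventually.of_forall hC)
  refine ⟨hi1, hbi, ?_⟩
  set F : E (k + 1) → ℝ := fun x => fderiv ℝ ζ x (massField f x) + ζ x * massDiv f x with hF
  have hF0 : ∀ x, x ∉ V → F x = 0 := fun x hx => by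
    simp only [hF]; rw [hdζ0 x hx, hζ0 x hx]; simp
  obtain ⟨hFi, hFe⟩ := h.changeVars hV1 hF0
  set P : E (k + 1) → ℝ := fun z => |pd κ φ z| * F (chartMap κ φ z) with hP
  have hPi : IntegrableOn P S := hFi.1 (hi1.add hi2)
  -- the approximating identities
  have happrox : ∀ ε : ℝ, 0 < ε → (∫ z in S, stepFun (ε⁻¹ * z κ) * P z) +
      σ * ∫ z, v z * (ε⁻¹ * deriv stepFun (ε⁻¹ * z κ)) = 0 := by
    intro ε hε
    classical
    -- ζ cut off at height ε. It lives on K, a compact subset of the exterior, so the interior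
    -- identity applies; H is C¹ at points of K, and off K the function vanishes locally.
    set ξ : E (k + 1) → ℝ := fun x => if x ∈ Ωᶜ then ζ x * stepFun (ε⁻¹ * H x) else 0 with hξ
    have hHK : ContinuousOn H (V ∩ Ωᶜ) := fun x hx => (hV3 x hx.1 hx.2).mono inter_subset_right
    set K : Set (E (k + 1)) := (V ∩ Ωᶜ) ∩ H ⁻¹' Ici ε with hK
    have hKcl : IsClosed K := hHK.preimage_isClosed_of_isClosed
      ((isClosed_tsupport ζ).inter hΩ.isClosed_compl) isClosed_Ici
    have hKext : K ⊆ (closure Ω)ᶜ := fun x hx => by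
      obtain ⟨z, hz, h0, rfl⟩ := hV1 x hx.1.1 hx.1.2
      have hzR := Metric.ball_subset_ball h.r_lt.le hz
      refine h.ext z hzR ?_
      have := hx.2
      rw [mem_preimage, h.height z hzR h0] at this
      exact hε.trans_le this
    have hξ0 : ∀ x, x ∉ K → ξ x = 0 := fun x hx => by
      by_cases hxΩ : x ∈ Ωᶜ
      · simp only [hξ]
        rw [if_pos hxΩ]
        by_cases hxV : x ∈ V
        · have : H x < ε := by
            by_contra hle
            exact hx ⟨⟨hxV, hxΩ⟩, not_lt.1 hle⟩
          rw [stepFun_of_le, mul_zero]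
          rw [inv_mul_le_iff₀ hε, mul_one]
          exact this.le
        · rw [hζ0 x hxV, zero_mul]
      · simp only [hξ]
        rw [if_neg hxΩ]
    have hξnear : ∀ x ∈ (closure Ω)ᶜ, ξ =ᶠ[𝓝 x] fun x => ζ x * stepFun (ε⁻¹ * H x) := fun x hx => by
      filter_upwards [isClosed_closure.isOpen_compl.mem_nhds hx] with x hx
      simp only [hξ]
      have hxΩ : x ∈ Ωᶜ := fun hxΩ => hx (subset_closure hxΩ)
      rw [if_pos hxΩ]
    have hξc : ContDiff ℝ 1 ξ := contDiff_iff_contDiffAt.2 fun x => by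
      by_cases hx : x ∈ K
      · obtain ⟨z, hz, h0, rfl⟩ := hV1 x hx.1.1 hx.1.2
        have hzR := Metric.ball_subset_ball h.r_lt.le hz
        have hz0 : 0 < z κ := by
          have := hx.2
          rw [mem_preimage, h.height z hzR h0] at this
          exact hε.trans_le this
        refine ContDiffAt.congr_of_eventuallyEq ?_ (hξnear _ (h.ext z hzR hz0))
        exact hζ.contDiffAt.mul ((contDiff_stepFun.of_le (by norm_num)).contDiffAt.comp _
          (contDiffAt_const.mul (h.contDiffAt_height z hzR hz0)))
      · refine (contDiffAt_const (c := (0 : ℝ))).congr_of_eventuallyEq ?_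
        filter_upwards [hKcl.isOpen_compl.mem_nhds hx] with x hx using hξ0 x hx
    have hξK : tsupport ξ ⊆ K := closure_minimal (fun x hx => by
      by_contra hxK; exact hx (hξ0 x hxK)) hKcl
    have hξcomp : HasCompactSupport ξ :=
      HasCompactSupport.intro' (hζc.isCompact.of_isClosed_subset hKcl fun x hx => hx.1.1) hKcl hξ0
    have hid := integral_mass_identity isClosed_closure.isOpen_compl hf hξc hξcomp (hξK.trans hKext)
    have hdξ0 : ∀ x, x ∉ K → fderiv ℝ ξ x = 0 := fun x hx => by
      have : ξ =ᶠ[𝓝 x] fun _ => 0 := by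
        filter_upwards [hKcl.isOpen_compl.mem_nhds hx] with y hy using hξ0 y hy
      rw [this.fderiv_eq]; simp
    set Fε : E (k + 1) → ℝ := fun x => fderiv ℝ ξ x (massField f x) + ξ x * massDiv f x with hFε
    have hFε0 : ∀ x, x ∉ K → Fε x = 0 := fun x hx => by
      simp only [hFε]; rw [hdξ0 x hx, hξ0 x hx]; simp
    rw [← setIntegral_eq_integral_of_forall_compl_eq_zero (s := (closure Ω)ᶜ)
      (fun x hx => hFε0 x fun hxK => hx (hKext hxK)),
      (h.changeVars hV1 (G := Fε) fun x hx => hFε0 x fun hxK => hx hxK.1.1).2] at hid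
    -- The product rule in the chart: the derivative of the step in z_κ/ε picks out the κ-component
    -- of `chartVec`, multiplied by the kernel ε⁻¹ η'(z_κ/ε).
    have hpt : ∀ z ∈ S, |pd κ φ z| * Fε (chartMap κ φ z) = stepFun (ε⁻¹ * z κ) * P z +
        σ * (v z * (ε⁻¹ * deriv stepFun (ε⁻¹ * z κ))) := fun z hz => by
      have hzR := hSR z hz
      have hext := h.ext z hzR hz.2
      have hvz : v z = g z := evenExt_of_nonneg hzR (le_of_lt (show 0 < z κ from hz.2))
      have hξz : ξ (chartMap κ φ z) = ζ (chartMap κ φ z) * stepFun (ε⁻¹ * z κ) := by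
        refine (hξnear _ hext).self_of_nhds.trans ?_
        beta_reduce
        rw [h.height z hzR (le_of_lt (show 0 < z κ from hz.2))]
      have hloc : (fun w => ξ (chartMap κ φ w)) =ᶠ[𝓝 z]
          fun w => ζ (chartMap κ φ w) * stepFun (ε⁻¹ * w κ) := by
        have h3 : ∀ᶠ w : E (k + 1) in 𝓝 z, 0 < w κ :=
          ((EuclideanSpace.proj κ : E (k + 1) →L[ℝ] ℝ).continuous.tendsto z).eventually
            (lt_mem_nhds (show 0 < z κ from hz.2))
        filter_upwards [Metric.isOpen_ball.mem_nhds hzR, h3] with w h1 h2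
        refine (hξnear _ (h.ext w h1 h2)).self_of_nhds.trans ?_
        beta_reduce
        rw [h.height w h1 h2.le]
      have e1 := (hTc.differentiableOn one_ne_zero).differentiableAt
        (Metric.isOpen_ball.mem_nhds hzR)
      have e2 : HasFDerivAt (fun w : E (k + 1) => stepFun (ε⁻¹ * w κ))
          (deriv stepFun (ε⁻¹ * z κ) • (ε⁻¹ • (EuclideanSpace.proj κ : E (k + 1) →L[ℝ] ℝ))) z :=
        (contDiff_stepFun.differentiable two_ne_zero _).hasDerivAt.comp_hasFDerivAt
          (f := fun w : E (k + 1) => ε⁻¹ * w κ) z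
          ((EuclideanSpace.proj κ : E (k + 1) →L[ℝ] ℝ).hasFDerivAt.const_mul ε⁻¹)
      have e3 := (e1.hasFDerivAt.mul e2).congr_of_eventuallyEq hloc
      have e4 := h.pd_mul_fderiv_massField hf hzR hz.2 (hξc.differentiable one_ne_zero _)
      rw [e3.fderiv] at e4
      simp only [add_apply, smul_apply, smul_eq_mul, PiLp.proj_apply] at e4
      have e5 := hflux z hz
      simp only [hP, hF, hFε, hvz, hg]
      rw [hξz, mul_add, mul_add, e5, habs z hz, mul_assoc, e4]
      ring
    have hi3 : IntegrableOn (fun z => stepFun (ε⁻¹ * z κ) * P z) S := by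
      refine Integrable.bdd_mul (c := 1) hPi ?_ (Eventually.of_forall fun z => ?_)
      · exact (contDiff_stepFun.continuous.comp (continuous_const.mul
          (EuclideanSpace.proj κ : E (k + 1) →L[ℝ] ℝ).continuous)).aestronglyMeasurable
      · rw [Real.norm_of_nonneg (stepFun_mem _).1]; exact (stepFun_mem _).2
    have hlayer : Continuous fun z : E (k + 1) => ε⁻¹ * deriv stepFun (ε⁻¹ * z κ) :=
      continuous_const.mul (continuous_deriv_stepFun.comp (continuous_const.mul
        (EuclideanSpace.proj κ : E (k + 1) →L[ℝ] ℝ).continuous))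
    have hi4 : Integrable (fun z => v z * (ε⁻¹ * deriv stepFun (ε⁻¹ * z κ))) :=
      (hvcont.mul hlayer).integrable_of_hasCompactSupport hvcomp.mul_right
    rw [setIntegral_congr_fun hSm hpt, integral_add hi3 (hi4.const_mul σ).integrableOn,
      integral_const_mul, setIntegral_eq_integral_of_forall_compl_eq_zero (s := S)
        (f := fun z => v z * (ε⁻¹ * deriv stepFun (ε⁻¹ * z κ)))] at hid
    · exact hid
    -- Extending the layer integral from the half-ball to the whole space costs nothing: v vanishes
    -- off the ball and the kernel for z_κ ≤ 0.
    · intro z hz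
      by_cases h0 : 0 < z κ
      · have hv0 : v z = 0 := support_evenExt h.base hgsupp fun hzr => hz ⟨hzr, h0⟩
        rw [hv0, zero_mul]
      · rw [deriv_stepFun_of_notMem fun hmem => ?_, mul_zero, mul_zero]
        have h1 : ε⁻¹ * z κ ≤ 0 := mul_nonpos_of_nonneg_of_nonpos (inv_pos.2 hε).le (not_lt.1 h0)
        linarith [hmem.1]
  -- the limit
  have hlim1 : Tendsto (fun ε : ℝ => ∫ z in S, stepFun (ε⁻¹ * z κ) * P z) (𝓝[>] 0)
      (𝓝 (∫ z in S, P z)) := by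
    refine tendsto_integral_filter_of_dominated_convergence (fun z => ‖P z‖)
      (Eventually.of_forall fun ε => ?_) (Eventually.of_forall fun ε => Eventually.of_forall
        fun z => ?_) hPi.norm ?_
    · exact (contDiff_stepFun.continuous.comp (continuous_const.mul
          (EuclideanSpace.proj κ : E (k + 1) →L[ℝ] ℝ).continuous)).aestronglyMeasurable.mul
          hPi.aestronglyMeasurable
    · rw [norm_mul, Real.norm_of_nonneg (stepFun_mem _).1]
      exact mul_le_of_le_one_left (norm_nonneg _) (stepFun_mem _).2
    · refine ae_restrict_of_forall_mem hSm fun z hz => ?_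
      have hz0 : 0 < z κ := hz.2
      refine tendsto_const_nhds.congr' ?_
      filter_upwards [Ioo_mem_nhdsGT (half_pos hz0)] with ε hε
      rw [stepFun_of_ge, one_mul]
      rw [le_inv_mul_iff₀ hε.1]
      linarith [hε.2]
  have hlim2 := (tendsto_integral_boundary_layer κ hvcont hvcomp continuous_deriv_stepFun
    hasCompactSupport_deriv_stepFun).const_mul σ
  rw [integral_deriv_stepFun, mul_one] at hlim2
  have hlim := hlim1.add hlim2
  have hzero := tendsto_nhds_unique hlim (tendsto_const_nhds.congr' (by
    filter_upwards [self_mem_nhdsWithin] with ε hε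
    exact (happrox ε hε).symm))
  rw [hFe, hbe]
  linarith

end

section

variable {n m : ℕ} {Ω : Set (E n)} {f : E n → E m}

/-! ### The divergence theorem for the mass field -/

theorem fderiv_eq_zero_of_notMem_tsupport {ζ : E n → ℝ} {x : E n} (hx : x ∉ tsupport ζ) :
    fderiv ℝ ζ x = 0 := by
  have : ζ =ᶠ[𝓝 x] fun _ => 0 := by
    filter_upwards [(isClosed_tsupport ζ).isOpen_compl.mem_nhds hx] with y hy
    exact image_eq_zero_of_notMem_tsupport hy
  rw [this.fderiv_eq]; simp

theorem integrableOn_mul_massDiv (hQ : IntegrableOn (massDiv f) (closure Ω)ᶜ) {ζ : E n → ℝ}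
    (hζ : Continuous ζ) (hc : HasCompactSupport ζ) :
    IntegrableOn (fun x => ζ x * massDiv f x) (closure Ω)ᶜ := by
  obtain ⟨C, hC⟩ := hc.exists_bound_of_continuous hζ
  exact Integrable.bdd_mul hQ hζ.aestronglyMeasurable (Eventually.of_forall hC)

theorem GreenHolds.add (hQ : IntegrableOn (massDiv f) (closure Ω)ᶜ) {ζ ξ : E n → ℝ}
    (hζ : ContDiff ℝ 1 ζ) (hζc : HasCompactSupport ζ) (hξ : ContDiff ℝ 1 ξ)
    (hξc : HasCompactSupport ξ) (h1 : GreenHolds Ω f ζ) (h2 : GreenHolds Ω f ξ) :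
    GreenHolds Ω f (ζ + ξ) := by
  have hd : ∀ x, fderiv ℝ (ζ + ξ) x (massField f x) =
      fderiv ℝ ζ x (massField f x) + fderiv ℝ ξ x (massField f x) := fun x => by
    rw [fderiv_add (hζ.differentiable one_ne_zero x) (hξ.differentiable one_ne_zero x)]; rfl
  refine ⟨?_, ?_, ?_⟩
  · simp only [hd]; exact h1.1.add h2.1
  · simp only [Pi.add_apply, add_mul]; exact h1.2.1.add h2.2.1
  · simp only [Pi.add_apply, add_mul]
    rw [integral_add h1.2.1 h2.2.1, neg_add, ← h1.2.2, ← h2.2.2]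
    refine Eq.trans ?_ (integral_add
      (h1.1.add (integrableOn_mul_massDiv hQ hζ.continuous hζc))
      (h2.1.add (integrableOn_mul_massDiv hQ hξ.continuous hξc)))
    refine integral_congr_ae (Eventually.of_forall fun x => ?_)
    simp only [hd]
    ring

/-- The divergence theorem for test functions supported in `U`. -/
def GreenOn (Ω : Set (E n)) (f : E n → E m) (U : Set (E n)) : Prop :=
  ∀ ζ : E n → ℝ, ContDiff ℝ 1 ζ → HasCompactSupport ζ → tsupport ζ ⊆ U → GreenHolds Ω f ζ

theorem GreenOn.mono {U V : Set (E n)} (h : GreenOn Ω f V) (hUV : U ⊆ V) : GreenOn Ω f U :=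
  fun ζ hζ hc hs => h ζ hζ hc (hs.trans hUV)

/-- ζ is split by a cutoff χ supported in U that equals 1 near supp ζ \ V; then (1 - χ)ζ is
supported in V. -/
theorem GreenOn.union (hQ : IntegrableOn (massDiv f) (closure Ω)ᶜ) {U V : Set (E n)}
    (hUo : IsOpen U) (hVo : IsOpen V) (hU : GreenOn Ω f U) (hV : GreenOn Ω f V) :
    GreenOn Ω f (U ∪ V) := by
  intro ζ hζ hc hs
  have hK : IsCompact (tsupport ζ \ V) := hc.isCompact.diff hVo
  obtain ⟨χ, hχ, hχc, hχU, hχ1⟩ := exists_cutoff hK hUo fun x hx => (hs hx.1).resolve_right hx.2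
  have hχ' : ContDiff ℝ 1 χ := hχ.of_le (by norm_num)
  have hsplit : ζ = (fun x => χ x * ζ x) + fun x => (1 - χ x) * ζ x := by
    funext x; simp only [Pi.add_apply]; ring
  have c1 : ContDiff ℝ 1 fun x => χ x * ζ x := hχ'.mul hζ
  have c2 : ContDiff ℝ 1 fun x => (1 - χ x) * ζ x := (contDiff_const.sub hχ').mul hζ
  have s1 : HasCompactSupport fun x => χ x * ζ x := hχc.mul_right
  have s2 : HasCompactSupport fun x => (1 - χ x) * ζ x := hc.mul_left
  rw [hsplit]
  refine GreenHolds.add hQ c1 s1 c2 s2 (hU _ c1 s1 ?_) (hV _ c2 s2 ?_)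
  · exact (closure_mono fun x hx => left_ne_zero_of_mul hx).trans hχU
  · intro x hx
    have hxζ : x ∈ tsupport ζ := closure_mono (fun x hx => right_ne_zero_of_mul hx) hx
    by_contra hxV
    have h1 : ∀ᶠ y in 𝓝 x, χ y = 1 := eventually_nhdsSet_iff_forall.1 hχ1 x ⟨hxζ, hxV⟩
    refine (mem_closure_iff_frequently.1 hx) (h1.mono fun y hy => ?_)
    simp [hy]

theorem boundaryArea_eq_zero_of_forall {g : E n → ℝ} (hg : ∀ x ∈ frontier Ω, g x = 0) :
    g =ᵐ[boundaryArea Ω] fun _ => 0 :=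
  ae_restrict_of_forall_mem isClosed_frontier.measurableSet hg

theorem greenOn_exterior (hf : ContDiffOn ℝ 2 f (closure Ω)ᶜ) : GreenOn Ω f (closure Ω)ᶜ := by
  intro ζ hζ hc hs
  have ho : IsOpen (closure Ω)ᶜ := isClosed_closure.isOpen_compl
  have h0 : (fun x => ζ x * meanCurv Ω x) =ᵐ[boundaryArea Ω] fun _ => 0 :=
    boundaryArea_eq_zero_of_forall fun x hx => by
      rw [image_eq_zero_of_notMem_tsupport fun h => hs h (frontier_subset_closure hx), zero_mul]
  refine ⟨?_, (integrable_congr h0).2 (integrable_zero _ _ _), ?_⟩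
  · have h1 : ContinuousOn (fun x => fderiv ℝ ζ x (massField f x)) (tsupport ζ) :=
      (hζ.continuous_fderiv one_ne_zero).continuousOn.clm_apply
        ((continuousOn_massField ho hf).mono hs)
    refine (h1.integrableOn_compact hc.isCompact).of_forall_sdiff_eq_zero ho.measurableSet
      fun x hx => ?_
    rw [fderiv_eq_zero_of_notMem_tsupport hx.2]; rfl
  · rw [integral_congr_ae h0, integral_zero, neg_zero, ← integral_mass_identity ho hf hζ hc hs]
    refine setIntegral_eq_integral_of_forall_compl_eq_zero fun x hx => ?_
    have hx' : x ∉ tsupport ζ := fun h => hx (hs h)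
    rw [fderiv_eq_zero_of_notMem_tsupport hx', image_eq_zero_of_notMem_tsupport hx']
    simp

theorem greenOn_interior (hΩ : IsOpen Ω) : GreenOn Ω f Ω := by
  intro ζ hζ hc hs
  have h0 : (fun x => ζ x * meanCurv Ω x) =ᵐ[boundaryArea Ω] fun _ => 0 :=
    boundaryArea_eq_zero_of_forall fun x hx => by
      rw [image_eq_zero_of_notMem_tsupport fun h => ((mem_frontier_iff hΩ).1 hx).2 (hs h), zero_mul]
  have hm : MeasurableSet (closure Ω)ᶜ := isClosed_closure.measurableSet.compl
  have hx' : ∀ x ∈ (closure Ω)ᶜ, x ∉ tsupport ζ := fun x hx h => hx (subset_closure (hs h))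
  refine ⟨?_, (integrable_congr h0).2 (integrable_zero _ _ _), ?_⟩
  · refine (integrableOn_congr_fun (g := fun _ => (0 : ℝ)) (fun x hx => ?_) hm).2 integrableOn_zero
    rw [fderiv_eq_zero_of_notMem_tsupport (hx' x hx)]; rfl
  · rw [integral_congr_ae h0, integral_zero, neg_zero]
    refine setIntegral_eq_zero_of_forall_eq_zero fun x hx => ?_
    rw [fderiv_eq_zero_of_notMem_tsupport (hx' x hx), image_eq_zero_of_notMem_tsupport (hx' x hx)]
    simp

/-- Finitely many local neighbourhoods cover the compact set ∂Ω; together with Ω and the exterior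
they cover ℝ^n. -/
theorem greenOn_univ (hΩ : IsOpen Ω) (hΩb : Bornology.IsBounded Ω)
    (hf : ContDiffOn ℝ 2 f (closure Ω)ᶜ) (hQ : IntegrableOn (massDiv f) (closure Ω)ᶜ)
    (hloc : ∀ x ∈ frontier Ω, ∃ V ∈ 𝓝 x, GreenOn Ω f V) : GreenOn Ω f univ := by
  have hK : IsCompact (frontier Ω) := Metric.isCompact_of_isClosed_isBounded isClosed_frontier
    (hΩb.closure.subset frontier_subset_closure)
  obtain ⟨U, hUo, hfU, hU⟩ : ∃ U, IsOpen U ∧ frontier Ω ⊆ U ∧ GreenOn Ω f U := by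
    refine hK.induction_on (p := fun s => ∃ U, IsOpen U ∧ s ⊆ U ∧ GreenOn Ω f U) ?_ ?_ ?_ ?_
    · exact ⟨Ω, hΩ, empty_subset _, greenOn_interior hΩ⟩
    · rintro s t hst ⟨U, h1, h2, h3⟩
      exact ⟨U, h1, hst.trans h2, h3⟩
    · rintro s t ⟨U, h1, h2, h3⟩ ⟨V, h4, h5, h6⟩
      exact ⟨U ∪ V, h1.union h4, union_subset_union h2 h5, h3.union hQ h1 h4 h6⟩
    · intro x hx
      obtain ⟨V, hV, hG⟩ := hloc x hx
      obtain ⟨W, hWV, hW, hxW⟩ := mem_nhds_iff.1 hV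
      exact ⟨W, mem_nhdsWithin_of_mem_nhds (hW.mem_nhds hxW), W, hW, subset_rfl, hG.mono hWV⟩
  have h1 := (hU.union hQ hUo hΩ (greenOn_interior hΩ)).union hQ (hUo.union hΩ)
    isClosed_closure.isOpen_compl (greenOn_exterior hf)
  refine h1.mono fun x _ => ?_
  by_cases hx : x ∈ closure Ω
  · by_cases hxΩ : x ∈ Ω
    · exact Or.inl (Or.inr hxΩ)
    · exact Or.inl (Or.inl (hfU ((mem_frontier_iff hΩ).2 ⟨hx, hxΩ⟩)))
  · exact Or.inr hx

/-- The divergence theorem for the mass field and all test functions. -/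
theorem greenHolds {k : ℕ} {Ω : Set (E (k + 1))} {f : E (k + 1) → E m} (hΩ : IsOpen Ω)
    (hΩb : Bornology.IsBounded Ω) (hcont : ContinuousOn f Ωᶜ)
    (hconst : ∀ x ∈ frontier Ω, ∀ y ∈ connectedComponentIn (frontier Ω) x, f y = f x)
    (hf : ContDiffOn ℝ 2 f (closure Ω)ᶜ) (hQ : IntegrableOn (massDiv f) (closure Ω)ᶜ)
    (hext : GraphExtendsC2 Ω f) (htan : TangentToCylinders Ω f) {ζ : E (k + 1) → ℝ}
    (hζ : ContDiff ℝ 1 ζ) (hc : HasCompactSupport ζ) : GreenHolds Ω f ζ := by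
  refine greenOn_univ hΩ hΩb hf hQ (fun x hx => ?_) ζ hζ hc (subset_univ _)
  obtain ⟨κ, φ, y, H, z₀, r, R, h⟩ :=
    exists_boundaryChart hΩ hcont hconst hf hx (hext x hx) (htan x hx)
  exact h.green_local hΩ hf hQ

end

section

variable {n m : ℕ} {Ω : Set (E n)} {f : E n → E m}

/-! ### Decay at infinity -/

/-- The function `F` is `O(|x|^s)` at infinity. -/
def Decays (s : ℝ) (F : E n → ℝ) : Prop :=
  F =O[Bornology.cobounded (E n)] fun x => ‖x‖ ^ s

theorem eventually_norm_gt (R : ℝ) : ∀ᶠ x in Bornology.cobounded (E n), R < ‖x‖ :=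
  tendsto_norm_cobounded_atTop.eventually_gt_atTop R

theorem Decays.mul {s t : ℝ} {F G : E n → ℝ} (hF : Decays s F) (hG : Decays t G) :
    Decays (s + t) fun x => F x * G x := by
  refine (Asymptotics.IsBigO.mul hF hG).congr' EventuallyEq.rfl ?_
  filter_upwards [eventually_norm_gt 0] with x hx
  exact (Real.rpow_add hx s t).symm

theorem Decays.add {s : ℝ} {F G : E n → ℝ} (hF : Decays s F) (hG : Decays s G) :
    Decays s fun x => F x + G x := Asymptotics.IsBigO.add hF hG

theorem Decays.sub {s : ℝ} {F G : E n → ℝ} (hF : Decays s F) (hG : Decays s G) :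
    Decays s fun x => F x - G x := Asymptotics.IsBigO.sub hF hG

theorem Decays.neg {s : ℝ} {F : E n → ℝ} (hF : Decays s F) :
    Decays s fun x => - F x := Asymptotics.IsBigO.neg_left hF

theorem Decays.sum {s : ℝ} {ι : Type*} {A : Finset ι} {F : ι → E n → ℝ}
    (hF : ∀ i, Decays s (F i)) : Decays s fun x => ∑ i ∈ A, F i x :=
  Asymptotics.IsBigO.fun_sum fun i _ => hF i

theorem Decays.of_tendsto {F : E n → ℝ} {c : ℝ} (h : Tendsto F (Bornology.cobounded (E n)) (𝓝 c)) :
    Decays 0 F := by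
  unfold Decays
  simp only [Real.rpow_zero]
  exact h.isBigO_one ℝ

theorem Decays.tendsto_zero {s : ℝ} (hs : s < 0) {F : E n → ℝ} (hF : Decays s F) :
    Tendsto F (Bornology.cobounded (E n)) (𝓝 0) := by
  refine Asymptotics.IsBigO.trans_tendsto hF ?_
  have := (tendsto_rpow_neg_atTop (y := -s) (by linarith)).comp
    (tendsto_norm_cobounded_atTop (E := E n))
  simpa [Function.comp_def] using this

open Matrix in
theorem Decays.mulVec {k l : ℕ} {s t r : ℝ} (hr : s + t = r) {M : E n → Matrix (Fin k) (Fin l) ℝ}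
    {v : E n → Fin l → ℝ}
    (hM : ∀ i j, Decays s fun x => M x i j) (hv : ∀ j, Decays t fun x => v x j) (i : Fin k) :
    Decays r fun x => (M x *ᵥ v x) i := by
  subst hr
  exact Decays.sum (A := Finset.univ) (F := fun j x => M x i j * v x j)
    fun j => (hM i j).mul (hv j)

theorem Decays.matrix_mul {k l r : ℕ} {s t u : ℝ} (hu : s + t = u)
    {M : E n → Matrix (Fin k) (Fin l) ℝ} {N : E n → Matrix (Fin l) (Fin r) ℝ}
    (hM : ∀ i j, Decays s fun x => M x i j) (hN : ∀ i j, Decays t fun x => N x i j)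
    (i : Fin k) (j : Fin r) :
    Decays u fun x => (M x * N x) i j := by
  subst hu
  simp only [Matrix.mul_apply]
  exact Decays.sum (F := fun a x => M x i a * N x a j) fun a => (hM i a).mul (hN a j)

theorem Decays.trace {k : ℕ} {s : ℝ} {M : E n → Matrix (Fin k) (Fin k) ℝ}
    (hM : ∀ i j, Decays s fun x => M x i j) : Decays s fun x => (M x).trace :=
  Decays.sum (F := fun a x => M x a a) fun a => hM a a

open Matrix in
theorem Decays.dotProduct {k : ℕ} {s t r : ℝ} (hr : s + t = r) {v w : E n → Fin k → ℝ}
    (hv : ∀ j, Decays s fun x => v x j) (hw : ∀ j, Decays t fun x => w x j) :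
    Decays r fun x => v x ⬝ᵥ w x := by
  subst hr
  exact Decays.sum (F := fun j x => v x j * w x j) fun j => (hv j).mul (hw j)

section
variable {q : ℝ} (hq : 0 < q) (h1 : ∀ α i, Decays (-q) (d1 f α i))
  (h2 : ∀ α i j, Decays (-q - 1) (d2 f α i j))
include hq h1

theorem tendsto_jet1 : Tendsto (jet1 f) (Bornology.cobounded (E n)) (𝓝 0) := by
  refine tendsto_pi_nhds.2 fun α => tendsto_pi_nhds.2 fun i => ?_
  exact (h1 α i).tendsto_zero (by linarith)

theorem decays_gJ_inv (i j : Fin n) : Decays 0 fun x => (gJ (jet1 f x))⁻¹ i j := by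
  have := (continuous_gJ_inv (n := n) (m := m)).continuousAt (x := 0) |>.tendsto.comp
    (tendsto_jet1 hq h1)
  exact Decays.of_tendsto (tendsto_pi_nhds.1 (tendsto_pi_nhds.1 this i) j)

/-- g⁻¹ - 1 = -g⁻¹ pᵀ p is quadratic in the first derivatives, with g⁻¹ bounded. -/
theorem decays_gJ_inv_sub_one (i j : Fin n) :
    Decays (-(2 * q)) fun x => ((gJ (jet1 f x))⁻¹ - 1) i j := by
  have e : ∀ x, (gJ (jet1 f x))⁻¹ - 1 =
      -((gJ (jet1 f x))⁻¹ * ((jet1 f x).transpose * jet1 f x)) := fun x => by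
    have : (gJ (jet1 f x))⁻¹ * gJ (jet1 f x) = 1 :=
      Matrix.nonsing_inv_mul _ (gJ_isUnit_det _)
    nth_rewrite 2 [gJ] at this
    rw [mul_add, mul_one] at this
    rw [sub_eq_iff_eq_add, ← sub_eq_neg_add, eq_sub_iff_add_eq, this]
  simp only [e, Matrix.neg_apply]
  refine Decays.neg (Decays.matrix_mul (s := 0) (t := -(2 * q)) (by ring) (decays_gJ_inv hq h1)
    (fun i j => ?_) i j)
  exact Decays.matrix_mul (s := -q) (t := -q) (by ring) (fun i α => h1 α i) h1 i j

theorem decays_vJ (α : Fin m) (i : Fin n) : Decays (-q) fun x => vJ (jet1 f x) α i :=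
  Decays.mulVec (by ring) (decays_gJ_inv hq h1) (h1 α) i

include h2

/-- S^⊥ contains two first and two second derivatives in each product, which gives -2q - 2(q + 1).
-/
theorem decays_Sperp : Decays (-(4 * q + 2)) (Sperp f) := by
  have hA : ∀ α i j, Decays (-q - 1) fun x => AJ (jet1 f x) (jet2 f x) α i j := fun α =>
    Decays.matrix_mul (by ring) (decays_gJ_inv hq h1) (h2 α)
  have hAv : ∀ α β i, Decays (-(2 * q + 1)) fun x =>
      (Matrix.mulVec (AJ (jet1 f x) (jet2 f x) α) (vJ (jet1 f x) β)) i := fun α β =>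
    Decays.mulVec (by ring) (hA α) (decays_vJ hq h1 β)
  have hhv : ∀ α β i, Decays (-(2 * q + 1)) fun x =>
      (Matrix.mulVec (jet2 f x α) (vJ (jet1 f x) β)) i := fun α β =>
    Decays.mulVec (by ring) (h2 α) (decays_vJ hq h1 β)
  have : Sperp f = fun x => PJ (jet1 f x) (jet2 f x) := funext (Sperp_eq f)
  rw [this]
  unfold PJ
  refine Decays.sum fun α => Decays.sum fun β => Decays.sub ?_ ?_
  · exact Decays.dotProduct (by ring) (hAv α α) (hhv β β)
  · exact Decays.dotProduct (by ring) (hAv β α) (hhv α β)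

end

open Matrix in
/-- The leading part of the mass field at infinity. -/
def flatXJ (p : Matrix (Fin m) (Fin n) ℝ) (h : Fin m → Matrix (Fin n) (Fin n) ℝ) : Fin n → ℝ :=
  ∑ α, ((h α).trace • p α - h α *ᵥ p α)

/-- The leading part of the mass field of the graph of `f` at infinity. -/
def flatField (f : E n → E m) (x : E n) : E n := WithLp.toLp 2 (flatXJ (jet1 f x) (jet2 f x))

open Matrix in
-- Every term of the difference contains a factor g⁻¹ - 1, hence two more first derivatives than the
-- leading part.
theorem XJ_sub_flatXJ (p : Matrix (Fin m) (Fin n) ℝ) (h : Fin m → Matrix (Fin n) (Fin n) ℝ) :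
    XJ p h - flatXJ p h = ∑ α, (((((gJ p)⁻¹ - 1) * h α).trace • vJ p α
      + (h α).trace • (((gJ p)⁻¹ - 1) *ᵥ p α)) - (((gJ p)⁻¹ - 1) *ᵥ (h α *ᵥ vJ p α)
      + h α *ᵥ (((gJ p)⁻¹ - 1) *ᵥ p α))) := by
  unfold XJ flatXJ
  rw [← Finset.sum_sub_distrib]
  refine Finset.sum_congr rfl fun α _ => ?_
  simp only [AJ, Matrix.sub_mul, Matrix.sub_mulVec, Matrix.one_mul, Matrix.one_mulVec,
    Matrix.trace_sub, Matrix.mulVec_sub, sub_smul, smul_sub, ← Matrix.mulVec_mulVec]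
  simp only [vJ]
  abel

theorem decays_massField_sub {q : ℝ} (hq : 0 < q) (h1 : ∀ α i, Decays (-q) (d1 f α i))
    (h2 : ∀ α i j, Decays (-q - 1) (d2 f α i j)) (i : Fin n) :
    Decays (-(4 * q + 1)) fun x => (massField f x - flatField f x) i := by
  have e : ∀ x, (massField f x - flatField f x) i =
    _ := fun x => congrFun (XJ_sub_flatXJ (jet1 f x) (jet2 f x)) i
  simp only [e, Finset.sum_apply, Pi.sub_apply, Pi.add_apply, Pi.smul_apply,
    smul_eq_mul]
  have hT := decays_gJ_inv_sub_one hq h1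
  have hv := decays_vJ hq h1
  have hTp : ∀ α i, Decays (-(3 * q)) fun x =>
      Matrix.mulVec ((gJ (jet1 f x))⁻¹ - 1) (jet1 f x α) i := fun α =>
    Decays.mulVec (by ring) hT (h1 α)
  have hTh : ∀ α, Decays (-(3 * q + 1)) fun x =>
      (((gJ (jet1 f x))⁻¹ - 1) * jet2 f x α).trace := fun α =>
    Decays.trace (Decays.matrix_mul (by ring) hT (h2 α))
  have htr : ∀ α, Decays (-q - 1) fun x => (jet2 f x α).trace := fun α => Decays.trace (h2 α)
  have hhv : ∀ α i, Decays (-(2 * q + 1)) fun x =>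
      Matrix.mulVec (jet2 f x α) (vJ (jet1 f x) α) i := fun α =>
    Decays.mulVec (by ring) (h2 α) (hv α)
  refine Decays.sum fun α => Decays.sub (Decays.add ?_ ?_) (Decays.add ?_ ?_)
  · have := (hTh α).mul (hv α i)
    rwa [show -(3 * q + 1) + -q = -(4 * q + 1) by ring] at this
  · have := (htr α).mul (hTp α i)
    rwa [show (-q - 1) + -(3 * q) = -(4 * q + 1) by ring] at this
  · exact Decays.mulVec (by ring) hT (hhv α) i
  · exact Decays.mulVec (by ring) (h2 α) (hTp α) i

/-! ### Integrability of the divergence -/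

theorem Decays.isBigO_one_add_norm {s : ℝ} (hs : 0 ≤ s) {F : E n → ℝ} (hF : Decays (-s) F) :
    F =O[cocompact (E n)] fun x => (1 + ‖x‖) ^ (-s) := by
  rw [← Metric.cobounded_eq_cocompact]
  refine Asymptotics.IsBigO.trans hF ?_
  refine Asymptotics.IsBigO.of_bound (2 ^ s) ?_
  filter_upwards [eventually_norm_gt 1] with x hx
  have hx0 : 0 < ‖x‖ := by linarith
  rw [Real.norm_of_nonneg (by positivity), Real.norm_of_nonneg (by positivity),
    Real.rpow_neg (by positivity), Real.rpow_neg (by positivity), ← div_eq_mul_inv,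
    inv_eq_one_div, div_le_div_iff₀ (by positivity) (by positivity), one_mul,
    ← Real.mul_rpow (by positivity) (by positivity)]
  exact Real.rpow_le_rpow (by positivity) (by linarith) hs

/-- Extended by zero, S^⊥ is locally bounded: by continuity in the exterior, and at ∂Ω because it
tends to 0. At infinity it decays faster than |x|^{-n}. -/
theorem integrableOn_Sperp (hcd : ContDiffOn ℝ 2 f (closure Ω)ᶜ) {s : ℝ} (hs : (n : ℝ) < s)
    (hdec : Decays (-s) (Sperp f))
    (hSperp : ∀ x ∈ frontier Ω, Tendsto (Sperp f) (𝓝[(closure Ω)ᶜ] x) (𝓝 0)) (hΩ : IsOpen Ω) :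
    IntegrableOn (Sperp f) (closure Ω)ᶜ := by
  have hop : IsOpen (closure Ω)ᶜ := isClosed_closure.isOpen_compl
  have hcont : ContinuousOn (Sperp f) (closure Ω)ᶜ := by
    have : Sperp f = fun x => (fun q : Jet n m => PJ q.1 q.2) (jet f x) :=
      funext (Sperp_eq f)
    rw [this]
    exact continuous_PJ.comp_continuousOn (continuousOn_jet hop hcd)
  rw [← integrable_indicator_iff hop.measurableSet]
  set F := (closure Ω)ᶜ.indicator (Sperp f)
  have hm : AEStronglyMeasurable F :=
    (aestronglyMeasurable_indicator_iff hop.measurableSet).2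
      (hcont.aestronglyMeasurable hop.measurableSet)
  have hle : ∀ x, ‖F x‖ ≤ ‖Sperp f x‖ := fun x => norm_indicator_le_norm_self _ _
  have hF : Decays (-s) F := Asymptotics.IsBigO.trans (Asymptotics.IsBigO.of_norm_le hle)
    (Asymptotics.IsBigO.norm_left hdec)
  refine LocallyIntegrable.integrable_of_isBigO_cocompact ?_
    (hF.isBigO_one_add_norm (n.cast_nonneg.trans hs.le))
    ((integrable_one_add_norm (by simpa using hs)).integrableAtFilter _)
  intro x
  have hb : ∃ c, F =O[𝓝 x] fun _ => (c : ℝ) := by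
    refine ⟨1, ?_⟩
    by_cases hx : x ∈ closure Ω
    · have : Tendsto F (𝓝 x) (𝓝 0) := by
        rw [← nhdsWithin_univ, ← union_compl_self (closure Ω), nhdsWithin_union, tendsto_sup]
        constructor
        · refine tendsto_const_nhds.congr' ?_
          filter_upwards [self_mem_nhdsWithin] with y hy
          exact (indicator_of_notMem (fun h : _ ∈ (closure Ω)ᶜ => h hy) _).symm
        · by_cases hxΩ : x ∈ Ω
          · have : 𝓝[(closure Ω)ᶜ] x = ⊥ := by
              rw [← notMem_closure_iff_nhdsWithin_eq_bot, closure_compl, mem_compl_iff, not_not]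
              exact interior_mono subset_closure (hΩ.interior_eq.symm ▸ hxΩ)
            rw [this]; exact tendsto_bot
          · refine (hSperp x ⟨hx, by rwa [hΩ.interior_eq]⟩).congr' ?_
            filter_upwards [self_mem_nhdsWithin] with y hy
            exact (indicator_of_mem hy _).symm
      exact this.isBigO_one ℝ
    · have : ContinuousAt F x := by
        refine (hcont.continuousAt (hop.mem_nhds hx)).congr ?_
        filter_upwards [hop.mem_nhds hx] with y hy
        exact (indicator_of_mem hy _).symm
      exact this.tendsto.isBigO_one ℝ
  obtain ⟨c, hc⟩ := hb
  exact hc.integrableAtFilter ⟨univ, univ_mem, hm.restrict⟩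
    (continuous_const.locallyIntegrable (f := fun _ : E n => c) x)

/-- The exponents and the integrability that asymptotic flatness provides. -/
theorem AsymptoticallyFlatOff.exists_decay (hn : 2 ≤ n) (hΩ : IsOpen Ω)
    (hflat : AsymptoticallyFlatOff Ω f)
    (hSperp : ∀ x ∈ frontier Ω, Tendsto (Sperp f) (𝓝[(closure Ω)ᶜ] x) (𝓝 0)) :
    IntegrableOn (massDiv f) (closure Ω)ᶜ ∧
      ∃ t : ℝ, (n : ℝ) - 1 < t ∧ ∀ i, Decays (-t) fun x => (massField f x - flatField f x) i := by
  obtain ⟨p, hp, h1, h2⟩ := hflat.decay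
  have hn' : (2 : ℝ) ≤ n := by exact_mod_cast hn
  have hq : 0 < p / 2 := by linarith
  have h1' : ∀ α i, Decays (-(p / 2)) (d1 f α i) := fun α i => by
    rw [← neg_div]; exact h1 α i
  have h2' : ∀ α i j, Decays (-(p / 2) - 1) (d2 f α i j) := fun α i j => by
    rw [← neg_div]; exact h2 α i j
  -- With q = p/2 the exponents are 2p + 1 for the field error and 2p + 2 for S^⊥. The condition p >
  -- (n - 2)/2 is exactly 2p + 1 > n - 1 and 2p + 2 > n.
  refine ⟨?_, 4 * (p / 2) + 1, by linarith, decays_massField_sub hq h1' h2'⟩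
  refine (hflat.integrableOn_scalarCurv.add (integrableOn_Sperp hflat.contDiffOn
    (s := 4 * (p / 2) + 2) (by linarith) (decays_Sperp hq h1' h2') hSperp hΩ)).congr_fun ?_
    isClosed_closure.isOpen_compl.measurableSet
  intro x hx
  exact (massDiv_eq (hflat.contDiffOn.contDiffAt
    (isClosed_closure.isOpen_compl.mem_nhds hx))).symm

end

section

variable {n m : ℕ} {Ω : Set (E n)} {f : E n → E m}

/-! ### The integrand of the ADM mass -/

/-- The outward radial component of a vector field. -/
def radial (X : E n → E n) (x : E n) : ℝ := ∑ j, X x j * (x j / ‖x‖)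

theorem differentiableAt_d1 {x : E n} (hf : ContDiffAt ℝ 2 f x) (α : Fin m) (i : Fin n) :
    DifferentiableAt ℝ (d1 f α i) x := by
  have h := ((contDiffAt_euclidean.1 hf α).fderiv_right (m := 1) (by norm_num)).clm_apply
    (contDiffAt_const (c := EuclideanSpace.single i (1 : ℝ)))
  exact h.differentiableAt one_ne_zero

theorem pd_metric {x : E n} (hf : ContDiffAt ℝ 2 f x) (k i j : Fin n) :
    pd k (fun y => metric f y i j) x =
      ∑ α, (d2 f α i k x * d1 f α j x + d1 f α i x * d2 f α j k x) := by
  have e : (fun y => metric f y i j) =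
      fun y => (if i = j then 1 else 0) + ∑ α, d1 f α i y * d1 f α j y := rfl
  rw [e, pd, fderiv_const_add]
  exact pd_sum_mul Finset.univ (u := fun α => d1 f α i) (v := fun α => d1 f α j)
    (fun α => differentiableAt_d1 hf α i) (fun α => differentiableAt_d1 hf α j) k

/-- An exact identity, with no error term: ∂_i g_ij - ∂_j g_ii = f_ii f_j - f_ij f_i (sums over i
and over the components), since one of the two equal terms of ∂_j g_ii cancels. -/
theorem adm_integrand_eq {x : E n} (hf : ContDiffAt ℝ 2 f x) :
    ∑ i, ∑ j, (pd i (fun y => metric f y i j) x - pd j (fun y => metric f y i i) x) *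
      (x j / ‖x‖) = radial (flatField f) x := by
  rw [Finset.sum_comm]
  refine Finset.sum_congr rfl fun j _ => ?_
  rw [← Finset.sum_mul]
  congr 1
  have hs : ∀ α a b, d2 f α a b x = d2 f α b a x := fun α a b =>
    congrFun (congrFun (jet2_symm hf α) b) a
  have e : flatField f x j =
      ∑ α, ((∑ i, d2 f α i i x) * d1 f α j x - ∑ i, d2 f α j i x * d1 f α i x) := by
    change flatXJ (jet1 f x) (jet2 f x) j = _
    rw [flatXJ, Finset.sum_apply]
    rfl
  rw [e]
  simp only [pd_metric hf, Finset.sum_mul, ← Finset.sum_sub_distrib]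
  rw [Finset.sum_comm]
  refine Finset.sum_congr rfl fun α _ => Finset.sum_congr rfl fun i _ => ?_
  rw [hs α i j]
  ring

theorem continuous_flatXJ : Continuous fun q : Jet n m => flatXJ q.1 q.2 := by
  unfold flatXJ
  refine continuous_finsetSum _ fun α _ => ?_
  have h1 : Continuous fun q : Jet n m => q.1 α := (continuous_apply α).comp continuous_fst
  have h2 : Continuous fun q : Jet n m => q.2 α := (continuous_apply α).comp continuous_snd
  exact (h2.matrix_trace.smul h1).sub (h2.matrix_mulVec h1)

theorem continuousOn_flatField {s : Set (E n)} (hs : IsOpen s) (hf : ContDiffOn ℝ 2 f s) :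
    ContinuousOn (flatField f) s := by
  have e : flatField f = fun x =>
      (WithLp.toLp 2 ((fun q : Jet n m => flatXJ q.1 q.2) (jet f x)) : E n) := rfl
  rw [e]
  exact (PiLp.continuous_toLp 2 _).comp_continuousOn
    (continuous_flatXJ.comp_continuousOn (continuousOn_jet hs hf))

theorem continuousOn_radial {s : Set (E n)} (h0 : (0 : E n) ∉ s) {X : E n → E n}
    (hX : ContinuousOn X s) : ContinuousOn (radial X) s := by
  refine continuousOn_finsetSum _ fun j _ => ?_
  refine ((PiLp.continuous_apply 2 _ j).comp_continuousOn hX).mul ?_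
  exact (PiLp.continuous_apply 2 _ j).continuousOn.div continuous_norm.continuousOn
    fun x hx => norm_ne_zero_iff.2 fun h => h0 (h ▸ hx)

theorem decays_radial {t : ℝ} {X Y : E n → E n}
    (h : ∀ i, Decays (-t) fun x => (X x - Y x) i) :
    Decays (-t) fun x => radial X x - radial Y x := by
  have e : ∀ x, radial X x - radial Y x = ∑ j, (X x - Y x) j * (x j / ‖x‖) := fun x => by
    rw [radial, radial, ← Finset.sum_sub_distrib]
    exact Finset.sum_congr rfl fun j _ => by rw [PiLp.sub_apply]; ring
  simp only [e]
  refine Decays.sum fun j => ?_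
  have h0 : Decays 0 fun x : E n => x j / ‖x‖ := by
    refine Asymptotics.IsBigO.of_bound 1 (Eventually.of_forall fun x => ?_)
    rw [Real.rpow_zero, norm_one, norm_div, norm_norm, mul_one]
    exact div_le_one_of_le₀ (PiLp.norm_apply_le x j) (norm_nonneg x)
  simpa using (h j).mul h0

/-! ### Polar coordinates -/

theorem norm_smul_sphere {t : ℝ} (ht : 0 < t) (θ : Metric.sphere (0 : E n) 1) :
    ‖t • (θ : E n)‖ = t := by
  rw [norm_smul, norm_eq_of_mem_sphere θ, mul_one, Real.norm_of_nonneg ht.le]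

theorem sphereIntegral_congr {t : ℝ} (ht : 0 < t) {g h : E n → ℝ}
    (hgh : ∀ x, ‖x‖ = t → g x = h x) : sphereIntegral t g = sphereIntegral t h := by
  unfold sphereIntegral
  congr 2
  ext θ
  exact hgh _ (norm_smul_sphere ht θ)

theorem sphereIntegral_radial_mul {t : ℝ} (ht : 0 < t) (φ : ℝ → ℝ) (g : E n → ℝ) :
    sphereIntegral t (fun x => φ ‖x‖ * g x) = φ t * sphereIntegral t g := by
  unfold sphereIntegral
  simp only [norm_smul_sphere ht]
  rw [integral_const_mul]
  ring

theorem continuous_sphereIntegral {g : E n → ℝ} (hg : Continuous g) :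
    Continuous fun t => sphereIntegral t g := by
  unfold sphereIntegral
  refine (continuous_pow _).mul ?_
  have : Continuous (Function.uncurry
      fun (t : ℝ) (θ : Metric.sphere (0 : E n) 1) => g (t • (θ : E n))) := by
    simp only [Function.uncurry_def]; fun_prop
  have h := continuous_parametric_integral_of_continuous (μ := volume.toSphere) this
    isCompact_univ
  simpa using h

/-- Fubini on sphere × (0, ∞), where Lebesgue measure becomes the sphere's measure times t^k dt; k +
1 is the dimension. -/
theorem integral_eq_integral_sphereIntegral {k : ℕ} {g : E (k + 1) → ℝ} (hg : Integrable g) :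
    ∫ x, g x = ∫ t in Ioi (0 : ℝ), sphereIntegral t g := by
  set μ : Measure (E (k + 1)) := volume
  have hd : Module.finrank ℝ (E (k + 1)) = k + 1 := by simp
  have mp := μ.measurePreserving_homeomorphUnitSphereProd
  rw [hd, Nat.add_sub_cancel] at mp
  set G : Metric.sphere (0 : E (k + 1)) 1 × Ioi (0 : ℝ) → ℝ := fun q => g (q.2.1 • q.1.1)
  have hG : ∀ x : ({0}ᶜ : Set (E (k + 1))), G (homeomorphUnitSphereProd _ x) = g x := fun x => by
    have := (homeomorphUnitSphereProd (E (k + 1))).symm_apply_apply x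
    simp only [G]
    conv_rhs => rw [← this]
    simp [homeomorphUnitSphereProd, smul_smul, norm_ne_zero_iff.2 x.2]
  have hemb := (homeomorphUnitSphereProd (E (k + 1))).measurableEmbedding
  have hGi : Integrable G (μ.toSphere.prod (.volumeIoiPow k)) := by
    rw [← mp.integrable_comp_emb hemb]
    have : G ∘ homeomorphUnitSphereProd (E (k + 1)) = g ∘ Subtype.val := funext hG
    rw [this, ← integrableOn_iff_comap_subtypeVal (measurableSet_singleton _).compl]
    exact hg.integrableOn
  calc
    ∫ x, g x ∂μ = ∫ x : ({(0)}ᶜ : Set (E (k + 1))), g x.1 ∂(μ.comap (↑)) := by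
      rw [integral_subtype_comap (measurableSet_singleton _).compl fun x ↦ g x,
        restrict_compl_singleton]
    _ = ∫ q, G q ∂μ.toSphere.prod (.volumeIoiPow k) := by
      rw [← mp.integral_comp hemb]
      simp only [hG]
    _ = ∫ t : Ioi (0 : ℝ), ∫ θ, G (θ, t) ∂μ.toSphere ∂.volumeIoiPow k :=
      integral_prod_symm _ hGi
    _ = _ := by
      simp only [Measure.volumeIoiPow, ENNReal.ofReal]
      rw [integral_withDensity_eq_integral_smul,
        integral_subtype_comap measurableSet_Ioi fun a ↦ Real.toNNReal (a ^ k) •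
          ∫ θ : Metric.sphere (0 : E (k + 1)) 1, g (a • θ.1) ∂μ.toSphere,
        setIntegral_congr_fun measurableSet_Ioi fun x hx ↦ ?_]
      · simp only [NNReal.smul_def, Real.coe_toNNReal _ (pow_nonneg hx.out.le _)]
        rfl
      · exact (measurable_subtype_coe.pow_const _).real_toNNReal

end

section

variable {n m : ℕ} {Ω : Set (E n)} {f : E n → E m}

/-! ### Radial cutoff functions -/

/-- A `C²` function of `|x|` which is `1` for `|x| ≤ r + ε` and `0` for `|x| ≥ r + 2 ε`. -/
def radialCutoff (r ε : ℝ) (x : E n) : ℝ := 1 - stepFun ((‖x‖ - r) / ε)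

theorem radialCutoff_of_le {r ε : ℝ} (hε : 0 < ε) {x : E n} (hx : ‖x‖ ≤ r + ε) :
    radialCutoff r ε x = 1 := by
  rw [radialCutoff, stepFun_of_le, sub_zero]
  rw [div_le_one hε]
  linarith

theorem radialCutoff_of_ge {r ε : ℝ} (hε : 0 < ε) {x : E n} (hx : r + 2 * ε ≤ ‖x‖) :
    radialCutoff r ε x = 0 := by
  rw [radialCutoff, stepFun_of_ge, sub_self]
  rw [le_div_iff₀ hε]
  linarith

theorem norm_radialCutoff_le (r ε : ℝ) (x : E n) : ‖radialCutoff r ε x‖ ≤ 1 := by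
  have := stepFun_mem ((‖x‖ - r) / ε)
  rw [radialCutoff, Real.norm_eq_abs, abs_le]
  constructor <;> linarith

theorem hasCompactSupport_radialCutoff {r ε : ℝ} (hε : 0 < ε) :
    HasCompactSupport (radialCutoff r ε : E n → ℝ) :=
  HasCompactSupport.intro (isCompact_closedBall 0 (r + 2 * ε)) fun x hx =>
    radialCutoff_of_ge hε (by
      rw [mem_closedBall_zero_iff, not_le] at hx
      exact hx.le)

theorem contDiff_radialCutoff {r ε : ℝ} (hr : 0 < r) (hε : 0 < ε) :
    ContDiff ℝ 1 (radialCutoff r ε : E n → ℝ) := by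
  rw [contDiff_iff_contDiffAt]
  intro x
  by_cases hx : x = 0
  · have : (radialCutoff r ε : E n → ℝ) =ᶠ[𝓝 x] fun _ => 1 := by
      filter_upwards [Metric.ball_mem_nhds x hr] with y hy
      refine radialCutoff_of_le hε ?_
      rw [hx, mem_ball_zero_iff] at hy
      linarith
    exact contDiffAt_const.congr_of_eventuallyEq this
  · exact contDiffAt_const.sub ((contDiff_stepFun.of_le (by norm_num)).contDiffAt.comp x
      (((contDiffAt_norm ℝ hx).sub contDiffAt_const).div_const ε))

theorem hasFDerivAt_norm_of_ne {x : E n} (hx : x ≠ 0) :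
    HasFDerivAt (fun y : E n => ‖y‖) (‖x‖⁻¹ • innerSL ℝ x) x := by
  have h := (hasStrictFDerivAt_norm_sq x).hasFDerivAt.sqrt
    (pow_ne_zero 2 (norm_ne_zero_iff.2 hx))
  simp only [Real.sqrt_sq (norm_nonneg _)] at h
  refine h.congr_fderiv ?_
  ext v
  have := norm_ne_zero_iff.2 hx
  simp
  field_simp

theorem fderiv_radialCutoff {r ε : ℝ} {x : E n} (hx : x ≠ 0) (X : E n → E n) :
    fderiv ℝ (radialCutoff r ε) x (X x) =
      -(ε⁻¹ * deriv stepFun ((‖x‖ - r) / ε)) * radial X x := by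
  have h1 : HasDerivAt stepFun (deriv stepFun ((‖x‖ - r) / ε)) ((‖x‖ - r) / ε) :=
    (contDiff_stepFun.differentiable two_ne_zero _).hasDerivAt
  have h2 : HasFDerivAt (fun y : E n => (‖y‖ - r) / ε) (ε⁻¹ • ‖x‖⁻¹ • innerSL ℝ x) x := by
    have := ((hasFDerivAt_norm_of_ne hx).sub_const r).const_mul ε⁻¹
    simpa only [div_eq_inv_mul] using this
  have h3 := (h1.comp_hasFDerivAt x h2).const_sub 1
  have h4 : fderiv ℝ (radialCutoff r ε) x = _ := h3.fderiv
  rw [h4]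
  have h5 : radial X x = ‖x‖⁻¹ * inner ℝ x (X x) := by
    rw [radial, PiLp.inner_apply, Finset.mul_sum]
    exact Finset.sum_congr rfl fun j _ => by simp [div_eq_mul_inv]; ring
  rw [h5]
  simp
  ring

/-! ### The flux through spheres -/

/-- The radial component of the mass field, cut off near `Ω`. -/
def cutFlux (f : E n → E m) (R : ℝ) (x : E n) : ℝ := stepFun (‖x‖ / R) * radial (massField f) x

theorem continuous_cutFlux {R : ℝ} (hR : 0 < R) (hΩR : closure Ω ⊆ Metric.ball 0 R)
    (hf : ContDiffOn ℝ 2 f (closure Ω)ᶜ) : Continuous (cutFlux f R) := by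
  rw [continuous_iff_continuousAt]
  intro x
  by_cases hx : ‖x‖ < R
  · have : cutFlux f R =ᶠ[𝓝 x] fun _ => 0 := by
      filter_upwards [Metric.isOpen_ball.mem_nhds (mem_ball_zero_iff.2 hx)] with y hy
      rw [cutFlux, stepFun_of_le, zero_mul]
      rw [div_le_one hR]
      exact (mem_ball_zero_iff.1 hy).le
    exact continuousAt_const.congr this.symm
  · have hx' : x ∈ (closure Ω)ᶜ \ {0} := by
      refine ⟨fun h => hx (mem_ball_zero_iff.1 (hΩR h)), fun h => hx ?_⟩
      rw [mem_singleton_iff.1 h, norm_zero]; exact hR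
    have hop : IsOpen (closure Ω)ᶜ := isClosed_closure.isOpen_compl
    have ho : IsOpen ((closure Ω)ᶜ \ {0}) := hop.sdiff isClosed_singleton
    have hr := continuousOn_radial (s := (closure Ω)ᶜ \ {0}) (fun h => h.2 rfl)
      ((continuousOn_massField hop hf).mono sdiff_subset)
    refine ContinuousAt.mul ?_ (hr.continuousAt (ho.mem_nhds hx'))
    exact (contDiff_stepFun.continuous.comp (continuous_norm.div_const R)).continuousAt

theorem cutFlux_of_ge {R : ℝ} (hR : 0 < R) {x : E n} (hx : 2 * R ≤ ‖x‖) :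
    cutFlux f R x = radial (massField f) x := by
  rw [cutFlux, stepFun_of_ge, one_mul]
  rwa [le_div_iff₀ hR]

theorem integral_comp_affine (G : ℝ → ℝ) (r : ℝ) {ε : ℝ} (hε : 0 < ε) :
    ∫ s, G (r + ε * s) = ε⁻¹ * ∫ t, G t := by
  rw [Measure.integral_comp_mul_left (fun t => G (r + t)) ε, integral_add_left_eq_self G r,
    abs_of_pos (inv_pos.2 hε), smul_eq_mul]

/-- The cutoff's gradient is radial and lives in the shell between r + ε and r + 2ε. Polar
coordinates and t = r + ε s turn the integral into an average of fluxes through spheres slightly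
larger than r. -/
theorem setIntegral_fderiv_radialCutoff {k : ℕ} {Ω : Set (E (k + 1))} {f : E (k + 1) → E m}
    {R r ε : ℝ} (hR : 0 < R) (hΩR : closure Ω ⊆ Metric.ball 0 R)
    (hf : ContDiffOn ℝ 2 f (closure Ω)ᶜ) (hr : 2 * R ≤ r) (hε : 0 < ε) :
    ∫ x in (closure Ω)ᶜ, fderiv ℝ (radialCutoff r ε) x (massField f x) =
      -∫ s, deriv stepFun s * sphereIntegral (r + ε * s) (cutFlux f R) := by
  set φ : ℝ → ℝ := fun t => -(ε⁻¹ * deriv stepFun ((t - r) / ε))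
  have hφ0 : ∀ t, t ≤ r → φ t = 0 := fun t ht => by
    simp only [φ]
    rw [deriv_stepFun_of_notMem, mul_zero, neg_zero]
    intro h
    have := h.1
    rw [le_div_iff₀ hε] at this
    linarith
  have hφ1 : ∀ t, r + 2 * ε < t → φ t = 0 := fun t ht => by
    simp only [φ]
    rw [deriv_stepFun_of_notMem, mul_zero, neg_zero]
    intro h
    have := h.2
    rw [div_le_iff₀ hε] at this
    linarith
  have hφc : Continuous φ :=
    (continuous_const.mul (continuous_deriv_stepFun.comp
      ((continuous_id.sub continuous_const).div_const ε))).neg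
  have hop : IsOpen (closure Ω)ᶜ := isClosed_closure.isOpen_compl
  -- For |x| ≤ r both sides vanish, and beyond r ≥ 2R the inner cutoff in `cutFlux` equals 1. That
  -- inner cutoff only serves to make the flux function continuous on all of ℝ^n.
  have e1 : ∀ x, x ∉ closure Ω → fderiv ℝ (radialCutoff r ε) x (massField f x) =
      φ ‖x‖ * cutFlux f R x := fun x hx => by
    by_cases hxr : ‖x‖ ≤ r
    · rw [hφ0 _ hxr, zero_mul]
      have : (radialCutoff r ε : E (k + 1) → ℝ) =ᶠ[𝓝 x] fun _ => 1 := by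
        have hb : x ∈ Metric.ball (0 : E (k + 1)) (r + ε) := by
          rw [mem_ball_zero_iff]; linarith
        filter_upwards [Metric.isOpen_ball.mem_nhds hb] with y hy
        exact radialCutoff_of_le hε (mem_ball_zero_iff.1 hy).le
      rw [this.fderiv_eq]
      simp
    · rw [not_le] at hxr
      rw [cutFlux_of_ge hR (by linarith), fderiv_radialCutoff]
      intro h
      rw [h, norm_zero] at hxr
      linarith
  have e2 : ∀ x, x ∉ (closure Ω)ᶜ → φ ‖x‖ * cutFlux f R x = 0 := fun x hx => by
    rw [hφ0, zero_mul]
    have := mem_ball_zero_iff.1 (hΩR (not_not.1 hx))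
    linarith
  have hint : Integrable fun x : E (k + 1) => φ ‖x‖ * cutFlux f R x := by
    refine Continuous.integrable_of_hasCompactSupport
      ((hφc.comp continuous_norm).mul (continuous_cutFlux hR hΩR hf)) ?_
    refine HasCompactSupport.intro (isCompact_closedBall 0 (r + 2 * ε)) fun x hx => ?_
    rw [mem_closedBall_zero_iff, not_le] at hx
    rw [hφ1 _ hx, zero_mul]
  rw [setIntegral_congr_fun hop.measurableSet fun x hx => e1 x hx,
    setIntegral_eq_integral_of_forall_compl_eq_zero e2, integral_eq_integral_sphereIntegral hint,
    setIntegral_congr_fun measurableSet_Ioi fun t ht => sphereIntegral_radial_mul ht φ _,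
    setIntegral_eq_integral_of_forall_compl_eq_zero fun t ht => by
      rw [hφ0, zero_mul]
      rw [mem_Ioi, not_lt] at ht
      linarith]
  have := integral_comp_affine (fun t => φ t * sphereIntegral t (cutFlux f R)) r hε
  rw [← inv_mul_eq_iff_eq_mul₀ (inv_ne_zero hε.ne'), inv_inv] at this
  rw [← this, ← integral_const_mul, ← integral_neg]
  congr 1
  ext s
  simp only [φ]
  rw [add_sub_cancel_left, mul_div_cancel_left₀ _ hε.ne']
  field_simp

theorem tendsto_integral_deriv_stepFun {F : ℝ → ℝ} (hF : Continuous F) (r : ℝ) :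
    Tendsto (fun ε => ∫ s, deriv stepFun s * F (r + ε * s)) (𝓝[>] 0) (𝓝 (F r)) := by
  have e : ∀ ε, ∫ s, deriv stepFun s * F (r + ε * s) =
      ∫ s in Icc (1 : ℝ) 2, deriv stepFun s * F (r + ε * s) := fun ε =>
    (setIntegral_eq_integral_of_forall_compl_eq_zero fun s hs => by
      rw [deriv_stepFun_of_notMem hs, zero_mul]).symm
  have hc : Continuous fun ε => ∫ s, deriv stepFun s * F (r + ε * s) := by
    simp only [e]
    refine continuous_parametric_integral_of_continuous ?_ isCompact_Icc
    have := continuous_deriv_stepFun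
    simp only [Function.uncurry_def]
    fun_prop
  have h0 : ∫ s, deriv stepFun s * F (r + 0 * s) = F r := by
    simp only [zero_mul, add_zero]
    rw [integral_mul_const, integral_deriv_stepFun, one_mul]
  have := hc.tendsto 0
  rw [h0] at this
  exact this.mono_left nhdsWithin_le_nhds

/-- The cutoffs equal 1 on the closed ball and vanish, for small ε, at each point outside it; Q
dominates. -/
theorem tendsto_setIntegral_radialCutoff_mul {Q : E n → ℝ} {s : Set (E n)}
    (hQ : IntegrableOn Q s) {r : ℝ} (hr : 0 < r) :
    Tendsto (fun ε => ∫ x in s, radialCutoff r ε x * Q x) (𝓝[>] 0)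
      (𝓝 (∫ x in s, (Metric.closedBall 0 r).indicator Q x)) := by
  refine tendsto_integral_filter_of_dominated_convergence (fun x => ‖Q x‖) ?_ ?_ hQ.norm ?_
  · filter_upwards [self_mem_nhdsWithin] with ε hε
    exact (contDiff_radialCutoff hr hε).continuous.aestronglyMeasurable.mul
      hQ.aestronglyMeasurable
  · refine Eventually.of_forall fun ε => Eventually.of_forall fun x => ?_
    rw [norm_mul]
    exact mul_le_of_le_one_left (norm_nonneg _) (norm_radialCutoff_le r ε x)
  · refine Eventually.of_forall fun x => ?_
    by_cases hx : x ∈ Metric.closedBall 0 r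
    · rw [indicator_of_mem hx]
      refine tendsto_const_nhds.congr' ?_
      filter_upwards [self_mem_nhdsWithin] with ε hε
      have hε' : 0 < ε := hε
      rw [radialCutoff_of_le hε', one_mul]
      linarith [mem_closedBall_zero_iff.1 hx]
    · rw [indicator_of_notMem hx]
      rw [mem_closedBall_zero_iff, not_le] at hx
      refine tendsto_const_nhds.congr' ?_
      filter_upwards [Ioo_mem_nhdsGT (show 0 < (‖x‖ - r) / 2 by linarith)] with ε hε
      rw [radialCutoff_of_ge hε.1, zero_mul]
      linarith [hε.2]

theorem tendsto_setIntegral_closedBall {Q : E n → ℝ} {s : Set (E n)} (hQ : IntegrableOn Q s) :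
    Tendsto (fun r : ℝ => ∫ x in s, (Metric.closedBall 0 r).indicator Q x) atTop
      (𝓝 (∫ x in s, Q x)) := by
  refine tendsto_integral_filter_of_dominated_convergence (fun x => ‖Q x‖) ?_ ?_ hQ.norm ?_
  · exact Eventually.of_forall fun r =>
      hQ.aestronglyMeasurable.indicator Metric.isClosed_closedBall.measurableSet
  · exact Eventually.of_forall fun r => Eventually.of_forall fun x =>
      norm_indicator_le_norm_self _ _
  · refine Eventually.of_forall fun x => tendsto_const_nhds.congr' ?_
    filter_upwards [eventually_ge_atTop ‖x‖] with r hr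
    exact (indicator_of_mem (mem_closedBall_zero_iff.2 hr) _).symm

theorem integral_boundaryArea_congr {g h : E n → ℝ} (hgh : ∀ x ∈ frontier Ω, g x = h x) :
    g =ᵐ[boundaryArea Ω] h := by
  unfold boundaryArea
  filter_upwards [ae_restrict_mem isClosed_frontier.measurableSet] with x hx using hgh x hx

/-- The flux of the mass field through large spheres. -/
theorem sphereIntegral_cutFlux {k : ℕ} {Ω : Set (E (k + 1))} {f : E (k + 1) → E m}
    {R r : ℝ} (hR : 0 < R) (hΩR : closure Ω ⊆ Metric.ball 0 R)
    (hf : ContDiffOn ℝ 2 f (closure Ω)ᶜ) (hQ : IntegrableOn (massDiv f) (closure Ω)ᶜ)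
    (hgreen : ∀ ζ : E (k + 1) → ℝ, ContDiff ℝ 1 ζ → HasCompactSupport ζ → GreenHolds Ω f ζ)
    (hr : 2 * R ≤ r) :
    sphereIntegral r (cutFlux f R) =
      (∫ x in (closure Ω)ᶜ, (Metric.closedBall 0 r).indicator (massDiv f) x) +
        ∫ x, meanCurv Ω x ∂(boundaryArea Ω) := by
  have h1 := tendsto_integral_deriv_stepFun
    (continuous_sphereIntegral (continuous_cutFlux hR hΩR hf)) r
  have h2 := (tendsto_setIntegral_radialCutoff_mul hQ (r := r) (by linarith)).add_const
    (∫ x, meanCurv Ω x ∂(boundaryArea Ω))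
  refine tendsto_nhds_unique (h1.congr' ?_) h2
  filter_upwards [self_mem_nhdsWithin] with ε hε
  have hε' : 0 < ε := hε
  have hζ : ContDiff ℝ 1 (radialCutoff r ε : E (k + 1) → ℝ) :=
    contDiff_radialCutoff (by linarith) hε'
  have hζc : HasCompactSupport (radialCutoff r ε : E (k + 1) → ℝ) :=
    hasCompactSupport_radialCutoff hε'
  have g := hgreen _ hζ hζc
  have h3 := g.2.2
  have h4 : ∫ x, radialCutoff r ε x * meanCurv Ω x ∂(boundaryArea Ω) =
      ∫ x, meanCurv Ω x ∂(boundaryArea Ω) := by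
    refine integral_congr_ae (integral_boundaryArea_congr fun x hx => ?_)
    have := mem_ball_zero_iff.1 (hΩR (frontier_subset_closure hx))
    rw [radialCutoff_of_le hε' (by linarith), one_mul]
  rw [h4, integral_add g.1 (integrableOn_mul_massDiv hQ hζ.continuous hζc),
    setIntegral_fderiv_radialCutoff hR hΩR hf hr hε'] at h3
  linarith

theorem sphereIntegral_sub {r : ℝ} {g h : E n → ℝ}
    (hg : Integrable (fun θ : Metric.sphere (0 : E n) 1 => g (r • (θ : E n))) volume.toSphere)
    (hh : Integrable (fun θ : Metric.sphere (0 : E n) 1 => h (r • (θ : E n))) volume.toSphere) :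
    sphereIntegral r (fun x => g x - h x) = sphereIntegral r g - sphereIntegral r h := by
  unfold sphereIntegral
  rw [integral_sub hg hh, mul_sub]

/-- The area of the sphere grows like r^(n-1), and t > n - 1. -/
theorem tendsto_sphereIntegral_of_decays {t : ℝ} (ht : (n : ℝ) - 1 < t) (hn : 1 ≤ n) {g : E n → ℝ}
    (hg : Decays (-t) g) : Tendsto (fun r => sphereIntegral r g) atTop (𝓝 0) := by
  obtain ⟨C, hC⟩ := Asymptotics.IsBigO.bound hg
  obtain ⟨R, hR⟩ := (Metric.hasBasis_cobounded_compl_closedBall (0 : E n)).eventually_iff.1 hC |>.imp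
    fun _ h => h.2
  have key : ∀ᶠ r in atTop, ‖sphereIntegral r g‖ ≤
      C * (volume : Measure (E n)).toSphere.real univ * r ^ (-(t - (n - 1))) := by
    filter_upwards [eventually_gt_atTop R, eventually_gt_atTop 0] with r hr hr0
    unfold sphereIntegral
    have h1 : ‖∫ θ : Metric.sphere (0 : E n) 1, g (r • (θ : E n)) ∂(volume.toSphere)‖ ≤
        C * r ^ (-t) * (volume : Measure (E n)).toSphere.real univ := by
      refine norm_integral_le_of_norm_le_const (Eventually.of_forall fun θ => ?_)
      have := hR (x := r • (θ : E n)) (by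
        rw [mem_compl_iff, mem_closedBall_zero_iff, norm_smul_sphere hr0]
        exact not_le.2 hr)
      rwa [norm_smul_sphere hr0, Real.norm_of_nonneg (Real.rpow_nonneg hr0.le (-t))] at this
    have h2 : r ^ (-(t - ((n : ℝ) - 1))) = r ^ (n - 1) * r ^ (-t) := by
      rw [← Real.rpow_natCast r (n - 1), ← Real.rpow_add hr0, Nat.cast_sub hn]
      congr 1
      push_cast
      ring
    rw [norm_mul, Real.norm_of_nonneg (by positivity), h2]
    calc _ ≤ r ^ (n - 1) * (C * r ^ (-t) * (volume : Measure (E n)).toSphere.real univ) := by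
          gcongr
      _ = _ := by ring
  refine squeeze_zero_norm' key ?_
  have := (tendsto_rpow_neg_atTop (y := t - (n - 1)) (by linarith)).const_mul
    (C * (volume : Measure (E n)).toSphere.real univ)
  rwa [mul_zero] at this

end

section

variable {n m : ℕ} {Ω : Set (E n)} {f : E n → E m}

/-! ### The mass of the graph -/

/-- The ADM integral over a large sphere is the flux of the mass field minus that of its deviation
from the flat field. Green's formula evaluates the former as the integral of S + S^⊥ inside the ball
plus the boundary term; the latter tends to 0. -/
theorem hasADMMass_of_green {k : ℕ} (hk : 1 ≤ k) {Ω : Set (E (k + 1))} {f : E (k + 1) → E m}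
    (hΩ : IsOpen Ω) (hΩb : Bornology.IsBounded Ω) (hflat : AsymptoticallyFlatOff Ω f)
    (hSperp : ∀ x ∈ frontier Ω, Tendsto (Sperp f) (𝓝[(closure Ω)ᶜ] x) (𝓝 0))
    (hgreen : ∀ ζ : E (k + 1) → ℝ, ContDiff ℝ 1 ζ → HasCompactSupport ζ → GreenHolds Ω f ζ) :
    HasADMMass (metric f) (massConst (k + 1) *
      ((∫ x in (closure Ω)ᶜ, massDiv f x) + ∫ x, meanCurv Ω x ∂(boundaryArea Ω))) := by
  obtain ⟨hQ, t, ht, hdec⟩ := hflat.exists_decay (by omega) hΩ hSperp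
  obtain ⟨R, hR, hΩR⟩ : ∃ R, 0 < R ∧ closure Ω ⊆ Metric.ball 0 R := by
    obtain ⟨R, hR⟩ := hΩb.closure.subset_ball 0
    exact ⟨max R 1, by positivity, hR.trans (Metric.ball_subset_ball (le_max_left _ _))⟩
  have hf := hflat.contDiffOn
  have hop : IsOpen (closure Ω)ᶜ := isClosed_closure.isOpen_compl
  have hflux := (tendsto_setIntegral_closedBall hQ).add_const
    (∫ x, meanCurv Ω x ∂(boundaryArea Ω))
  have herr := tendsto_sphereIntegral_of_decays ht (by omega) (decays_radial hdec)
  have h := hflux.sub herr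
  rw [sub_zero] at h
  refine (h.const_mul (massConst (k + 1))).congr' ?_
  filter_upwards [eventually_ge_atTop (2 * R)] with r hr
  have hr0 : 0 < r := by linarith
  have hmem : ∀ x : E (k + 1), ‖x‖ = r → x ∈ (closure Ω)ᶜ := fun x hx h => by
    have := mem_ball_zero_iff.1 (hΩR h)
    linarith
  have hint : ∀ X : E (k + 1) → E (k + 1), ContinuousOn X (closure Ω)ᶜ →
      Integrable (fun θ : Metric.sphere (0 : E (k + 1)) 1 => radial X (r • (θ : E (k + 1))))
        volume.toSphere := fun X hX => by
    have hc : Continuous fun θ : Metric.sphere (0 : E (k + 1)) 1 =>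
        radial X (r • (θ : E (k + 1))) := by
      refine (continuousOn_radial (s := (closure Ω)ᶜ \ {0}) (fun h => h.2 rfl)
        (hX.mono sdiff_subset)).comp_continuous (by fun_prop) fun θ => ?_
      have hθ := norm_smul_sphere hr0 θ
      refine ⟨hmem _ hθ, fun h => ?_⟩
      rw [mem_singleton_iff.1 h, norm_zero] at hθ
      linarith
    exact hc.integrable_of_hasCompactSupport (HasCompactSupport.of_compactSpace _)
  congr 1
  rw [← sphereIntegral_cutFlux hR hΩR hf hQ hgreen hr,
    sphereIntegral_sub (hint _ (continuousOn_massField hop hf))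
      (hint _ (continuousOn_flatField hop hf)),
    sphereIntegral_congr hr0 (g := cutFlux f R) fun x hx => cutFlux_of_ge hR (by linarith),
    sub_sub_cancel]
  exact (sphereIntegral_congr hr0 fun x hx =>
    adm_integrand_eq (hf.contDiffAt (hop.mem_nhds (hmem x hx)))).symm

/-- Green's formula includes integrability of ζ H^Σ; a test function equal to 1 near the compact
boundary gives it for H^Σ. -/
theorem integrable_meanCurv (hΩb : Bornology.IsBounded Ω)
    (hgreen : ∀ ζ : E n → ℝ, ContDiff ℝ 1 ζ → HasCompactSupport ζ → GreenHolds Ω f ζ) :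
    Integrable (meanCurv Ω) (boundaryArea Ω) := by
  have hK : IsCompact (frontier Ω) := Metric.isCompact_of_isClosed_isBounded isClosed_frontier
    (hΩb.closure.subset frontier_subset_closure)
  obtain ⟨χ, hχ, hχc, -, hχ1⟩ := exists_cutoff hK isOpen_univ (subset_univ _)
  refine (hgreen χ (hχ.of_le (by norm_num)) hχc).2.1.congr
    (integral_boundaryArea_congr fun x hx => ?_)
  rw [(hχ1.filter_mono (nhds_le_nhdsSet hx)).self_of_nhds]
  exact one_mul _

/-! ### The volume of the graph -/

theorem detMetric_pos (f : E n → E m) (x : E n) : 0 < detMetric f x := by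
  rw [detMetric, metric_eq]
  exact gJ_det_pos _

theorem aemeasurable_graphVolume_density (hf : ContDiffOn ℝ 2 f (closure Ω)ᶜ) :
    AEMeasurable (fun x => ENNReal.ofReal √(detMetric f x)) (volume.restrict (closure Ω)ᶜ) := by
  have hop : IsOpen (closure Ω)ᶜ := isClosed_closure.isOpen_compl
  have hg : Continuous fun p : Matrix (Fin m) (Fin n) ℝ => (gJ p).det := by
    unfold gJ; fun_prop
  have hc : ContinuousOn (detMetric f) (closure Ω)ᶜ := by
    have e : detMetric f = fun x => (gJ (jet1 f x)).det := funext fun x => by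
      rw [detMetric, metric_eq]
    rw [e]
    exact hg.comp_continuousOn (continuousOn_jet1 hop hf)
  exact (hc.aemeasurable hop.measurableSet).sqrt.ennreal_ofReal

theorem toReal_density_smul (f : E n → E m) (x : E n) (g : ℝ) :
    (ENNReal.ofReal √(detMetric f x)).toReal • (g * (1 / √(detMetric f x))) = g := by
  have := (Real.sqrt_pos.2 (detMetric_pos f x)).ne'
  rw [ENNReal.toReal_ofReal (Real.sqrt_nonneg _), smul_eq_mul]
  field_simp

theorem integrable_graphVolume (hf : ContDiffOn ℝ 2 f (closure Ω)ᶜ) {g : E n → ℝ}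
    (hg : IntegrableOn g (closure Ω)ᶜ) :
    Integrable (fun x => g x * (1 / √(detMetric f x))) (graphVolume f (closure Ω)ᶜ) := by
  rw [graphVolume, integrable_withDensity_iff_integrable_smul₀'
    (aemeasurable_graphVolume_density hf) (Eventually.of_forall fun _ => ENNReal.ofReal_lt_top)]
  simp only [toReal_density_smul]
  exact hg

theorem integral_graphVolume (hf : ContDiffOn ℝ 2 f (closure Ω)ᶜ) (g : E n → ℝ) :
    ∫ x, g x * (1 / √(detMetric f x)) ∂(graphVolume f (closure Ω)ᶜ) =
      ∫ x in (closure Ω)ᶜ, g x := by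
  rw [graphVolume, integral_withDensity_eq_integral_toReal_smul₀
    (aemeasurable_graphVolume_density hf) (Eventually.of_forall fun _ => ENNReal.ofReal_lt_top)]
  simp only [toReal_density_smul]

end

end GraphMass

end

/-! ### The mass formula -/

theorem theorem1p3 (n m : ℕ) (hn : 2 ≤ n)
    (Ω : Set (GraphMass.E n)) (hΩ : IsOpen Ω) (hΩb : Bornology.IsBounded Ω)
    (f : GraphMass.E n → GraphMass.E m)
    (hcont : ContinuousOn f Ωᶜ)
    (hconst : ∀ x ∈ frontier Ω, ∀ y ∈ connectedComponentIn (frontier Ω) x, f y = f x)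
    (hflat : GraphMass.AsymptoticallyFlatOff Ω f)
    (hext : GraphMass.GraphExtendsC2 Ω f)
    (hSperp : ∀ x ∈ frontier Ω, Tendsto (GraphMass.Sperp f) (𝓝[(closure Ω)ᶜ] x) (𝓝 0))
    (htan : GraphMass.TangentToCylinders Ω f) :
    Integrable
        (fun x => (GraphMass.scalarCurv f x + GraphMass.Sperp f x) *
          (1 / √(GraphMass.detMetric f x)))
        (GraphMass.graphVolume f (closure Ω)ᶜ) ∧
      Integrable (GraphMass.meanCurv Ω) (GraphMass.boundaryArea Ω) ∧
      GraphMass.HasADMMass (GraphMass.metric f)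
        (GraphMass.massConst n *
          ((∫ x, (GraphMass.scalarCurv f x + GraphMass.Sperp f x) *
              (1 / √(GraphMass.detMetric f x)) ∂(GraphMass.graphVolume f (closure Ω)ᶜ)) +
            ∫ x, GraphMass.meanCurv Ω x ∂(GraphMass.boundaryArea Ω))) := by
  -- Graphs over coordinate hyperplanes and polar coordinates are set up in dimension k + 1.
  obtain ⟨k, rfl⟩ : ∃ k, n = k + 1 := ⟨n - 1, by omega⟩
  have hf := hflat.contDiffOn
  have hop : IsOpen (closure Ω)ᶜ := isClosed_closure.isOpen_compl
  have hQ := (hflat.exists_decay hn hΩ hSperp).1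
  have hgreen : ∀ ζ : GraphMass.E (k + 1) → ℝ, ContDiff ℝ 1 ζ → HasCompactSupport ζ →
      GraphMass.GreenHolds Ω f ζ := fun ζ hζ hc =>
    GraphMass.greenHolds hΩ hΩb hcont hconst hf hQ hext htan hζ hc
  have hQe : EqOn (GraphMass.massDiv f)
      (fun x => GraphMass.scalarCurv f x + GraphMass.Sperp f x) (closure Ω)ᶜ := fun x hx =>
    GraphMass.massDiv_eq (hf.contDiffAt (hop.mem_nhds hx))
  refine ⟨GraphMass.integrable_graphVolume hf (hQ.congr_fun hQe hop.measurableSet),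
    GraphMass.integrable_meanCurv hΩb hgreen, ?_⟩
  have h := GraphMass.hasADMMass_of_green (by omega) hΩ hΩb hflat hSperp hgreen
  rwa [setIntegral_congr_fun hop.measurableSet hQe, ← GraphMass.integral_graphVolume hf] at h
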